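/- All circles have radius $1$. A packing of $n$ circles in a rectangle $[0,W]\times[0,H]$ is a set of $n$ non-overlapping circles contained in it; the packing is *optimal* if no rectangle of smaller area, of whatever aspect ratio, can hold $n$ such circles. A packing is *carved from* the square grid (respectively the hexagonal grid) if all its circles belong to one congruent copy, in any position and orientation, of the square grid packing with centres $(2a,2b)$ (respectively the hexagonal packing with centres $(2a+b,\sqrt3\,b)$), $a,b\in\mathbb Z$. The *search class* consists of the following packings. There are $h+s\ge 1$ horizontal rows of sites. Every row is either unshifted or shifted to the right by $1$, and at least one row is unshifted. A row whose shift differs from that of the row below nests into it (the two centre lines are $\sqrt3$ apart, as in the hexagonal packing), and a row with the same shift is stacked directly on top of it (the centre lines are $2$ apart, as in the square grid); $s$ counts the stacked rows, and $h$ the others, which alternate hexagonally (if no row is shifted, put $h=0$ and count all rows in $s$). Unshifted rows have $w\ge1$ sites; shifted rows have either all $w$ sites or all $w-1$ sites. In the latter case let $h_-$ and $s_-$ be the numbers of shifted rows among the $h$ and the $s$ rows, and in the former case put $h_-=s_-=0$. Finally, $d\ge0$ of the sites are vacant (*monovacancies*) and every other site carries a circle, so that $n=w(h+s)-h_--s_--d$.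 The rectangle has width $2w+1$ if there are shifted rows with $w$ sites and $2w$ otherwise, and its height is $2$ plus the sum of the distances between consecutive centre lines. A packing in the class is *best* if its rectangle has the least area among all packings in the class with the same number of circles. Call $n\ge1$ *irregular* if some best packing of $n$ circles in the class has $d\ge1$. **Theorem.** There are exactly $1495$ irregular values $n\le 5000$; the first five are $49, 61, 79, 97, 107$, and the last one is $4999$. For each irregular $n \le 5000$, no packing of $n$ circles that is carved from the square grid or from the hexagonal grid is optimal, and no packing of $n$ circles in the search class (in its rectangle) is optimal either. -/

import Mathlib

noncomputable section

namespace CirclePacking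

/-- The Euclidean plane. -/
abbrev Plane := EuclideanSpace ℝ (Fin 2)

/-! ### Packings of unit circles in rectangles -/

/-- The circles of radius 1 centred at the points of `C` lie in the rectangle `[0, W] × [0, H]`
and do not overlap. -/
def IsPackingIn (W H : ℝ) (C : Finset Plane) : Prop :=
  (∀ p ∈ C, 1 ≤ p 0 ∧ p 0 ≤ W - 1 ∧ 1 ≤ p 1 ∧ p 1 ≤ H - 1) ∧
    ∀ p ∈ C, ∀ q ∈ C, p ≠ q → 2 ≤ dist p q

/-- A packing is optimal if no rectangle, of whatever width and height, that has a smaller area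
can hold the same number of circles. -/
def IsOptimal (W H : ℝ) (C : Finset Plane) : Prop :=
  IsPackingIn W H C ∧
    ∀ (W' H' : ℝ) (C' : Finset Plane), C'.card = C.card → IsPackingIn W' H' C' → W * H ≤ W' * H'

/-- The centres of the square grid packing of the plane by unit circles. -/
def squareGrid : Set Plane := {p | ∃ a b : ℤ, p = !₂[2 * (a : ℝ), 2 * (b : ℝ)]}

/-- The centres of the hexagonal packing of the plane by unit circles. -/
def hexGrid : Set Plane := {p | ∃ a b : ℤ, p = !₂[2 * (a : ℝ) + b, √3 * (b : ℝ)]}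

/-- All circles of the packing belong to one congruent copy of the infinite grid packing `G`
(translated, rotated or reflected in any way relative to the rectangle). -/
def CarvedFrom (G : Set Plane) (C : Finset Plane) : Prop :=
  ∃ f : Plane → Plane, Isometry f ∧ ∀ p ∈ C, p ∈ f '' G

/-! ### The search class: square grid, hexagonal and hybrid packings, possibly with vacancies -/

/-- The sites of an arrangement with rows `0, …, rows - 1` (from bottom to top). Every row has
`w` sites, except that shifted rows have `w - 1` if the arrangement is `depleted`.
Site `(i, j)` is the `j`-th one of row `i`. -/
def sites (w rows : ℕ) (shifted : ℕ → Bool) (depleted : Bool) : Finset (ℕ × ℕ) :=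
  (Finset.range rows ×ˢ Finset.range w).filter fun s =>
    s.2 < if depleted = true ∧ shifted s.1 = true then w - 1 else w

/-- A member of the search class. Rows that are shifted (to the right, by one radius) and rows
that are not shifted follow one another in any order. A row whose shift differs from that of the
previous row nests into it as in the hexagonal packing, and a row with the same shift is stacked
directly on top of it as in the square grid. Some sites are vacant (the monovacancies). -/
structure SearchPacking where
  /-- the number of sites in a longest row -/
  w : ℕ
  /-- the number of rows -/
  rows : ℕ
  /-- which rows are shifted (only the values at `i < rows` matter) -/
  shifted : ℕ → Bool
  /-- whether the shifted rows are one site shorter -/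
  depleted : Bool
  /-- the vacant sites -/
  vacant : Finset (ℕ × ℕ)
  w_pos : 0 < w
  exists_unshifted : ∃ i ∈ Finset.range rows, shifted i = false
  vacant_subset : vacant ⊆ sites w rows shifted depleted

namespace SearchPacking

variable (P : SearchPacking)

/-- The sites that carry a circle. -/
def occupied : Finset (ℕ × ℕ) := sites P.w P.rows P.shifted P.depleted \ P.vacant

/-- The number of circles. -/
def n : ℕ := P.occupied.card

/-- The number of monovacancies. -/
def d : ℕ := P.vacant.card

/-- Both kinds of rows occur, so that there are hexagonally alternating rows. -/
def Alternates : Prop := ∃ i ∈ Finset.range P.rows, P.shifted i = true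

instance : Decidable P.Alternates := by unfold Alternates; infer_instance

/-- The distance between the centre lines of rows `i` and `i + 1`. -/
def step (i : ℕ) : ℝ := if P.shifted i = P.shifted (i + 1) then 2 else √3

/-- The width of the rectangle: shifted rows of full length stick out by one radius. -/
def width : ℝ := 2 * P.w + if P.depleted = false ∧ P.Alternates then 1 else 0

/-- The height of the rectangle. -/
def height : ℝ := 2 + ∑ i ∈ Finset.range (P.rows - 1), P.step i

/-- The area of the rectangle. -/
def area : ℝ := P.width * P.height

/-- The centre of the circle at a site. -/
def center (s : ℕ × ℕ) : Plane :=
  !₂[1 + 2 * (s.2 : ℝ) + (if P.shifted s.1 = true then 1 else 0),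
    1 + ∑ i ∈ Finset.range s.1, P.step i]

open Classical in
/-- The centres of the circles. -/
def centers : Finset Plane := P.occupied.image P.center

/-- The rows that alternate hexagonally: the first one (if there is any alternation), and every
row that nests into the previous one. -/
def hexRows : Finset ℕ :=
  (Finset.range P.rows).filter fun i =>
    P.Alternates ∧ (i = 0 ∨ P.shifted i ≠ P.shifted (i - 1))

/-- The other rows, stacked as in the square grid. -/
def squareRows : Finset ℕ := Finset.range P.rows \ P.hexRows

/-- The number of hexagonally alternating rows. -/
def h : ℕ := P.hexRows.card

/-- The number of additional rows stacked as in the square grid. -/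
def s : ℕ := P.squareRows.card

/-- The number of hexagonal rows with `w - 1` sites. -/
def hMinus : ℕ := (P.hexRows.filter fun i => P.depleted = true ∧ P.shifted i = true).card

/-- The number of square grid rows with `w - 1` sites. -/
def sMinus : ℕ := (P.squareRows.filter fun i => P.depleted = true ∧ P.shifted i = true).card

/-- The packing has the least rectangle area among the members of the search class with the same
number of circles. -/
def IsBest : Prop := ∀ Q : SearchPacking, Q.n = P.n → P.area ≤ Q.area

/-- The number of circles is `w * (h + s) - h₋ - s₋ - d`. -/
theorem count_eq : P.n + P.hMinus + P.sMinus + P.d = P.w * (P.h + P.s) := by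
  classical
  have hsub : P.hexRows ⊆ Finset.range P.rows := Finset.filter_subset _ _
  have h1 : P.n + P.d = (sites P.w P.rows P.shifted P.depleted).card := by
    unfold n d occupied
    exact Finset.card_sdiff_add_card_eq_card P.vacant_subset
  have h2 : P.h + P.s = P.rows := by
    have := Finset.card_sdiff_add_card_eq_card hsub
    rw [Finset.card_range] at this
    unfold h s squareRows
    omega
  have h3 : P.hMinus + P.sMinus =
      ((Finset.range P.rows).filter fun i => P.depleted = true ∧ P.shifted i = true).card := by
    unfold hMinus sMinus squareRows
    rw [← Finset.card_union_of_disjoint, ← Finset.filter_union,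
      Finset.union_sdiff_of_subset hsub]
    exact Finset.disjoint_filter_filter Finset.disjoint_sdiff
  have h4 : (sites P.w P.rows P.shifted P.depleted).card =
      ∑ i ∈ Finset.range P.rows,
        (if P.depleted = true ∧ P.shifted i = true then P.w - 1 else P.w) := by
    unfold sites
    rw [Finset.card_filter, Finset.sum_product]
    refine Finset.sum_congr rfl fun i _ => ?_
    rw [← Finset.card_filter]
    have : (Finset.range P.w).filter
        (fun j => j < if P.depleted = true ∧ P.shifted i = true then P.w - 1 else P.w) =
        Finset.range (if P.depleted = true ∧ P.shifted i = true then P.w - 1 else P.w) := by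
      ext j
      simp only [Finset.mem_filter, Finset.mem_range]
      split_ifs <;> omega
    simp [this]
  have h5 : ∑ i ∈ Finset.range P.rows,
        (if P.depleted = true ∧ P.shifted i = true then P.w - 1 else P.w) +
      ((Finset.range P.rows).filter fun i => P.depleted = true ∧ P.shifted i = true).card =
      P.w * P.rows := by
    rw [Finset.card_filter, ← Finset.sum_add_distrib]
    have hw := P.w_pos
    rw [Finset.sum_congr rfl (g := fun _ => P.w)]
    · simp [mul_comm]
    · intro i _
      split_ifs <;> omega
  rw [h2]
  omega

end SearchPacking

/-- The irregular values up to `N`: the positive numbers `n ≤ N` for which some best packing of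
`n` circles in the search class has a monovacancy. -/
def irregularValues (N : ℕ) : Set ℕ :=
  {n | 1 ≤ n ∧ n ≤ N ∧ ∃ P : SearchPacking, P.n = n ∧ P.IsBest ∧ 0 < P.d}

end CirclePacking

end

noncomputable section

namespace CirclePacking
-- Let a(n) be the least area of an arrangement of the class with at least n sites. Vacating surplus
-- sites shows that a(n) is also the least area for n circles, and n is irregular exactly when a(n)
-- = a(n + 1) (`mem_irregularValues_iff`). The table lists purely hexagonal arrangements that attain
-- a(n), so irregular values are counted as equal neighbours in it. Minimality of the entries
-- (`SearchPacking.entryArea_le_area`) is reduced to finitely many comparisons. An arrangement with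
-- u - 1 stacked and b nested steps wastes at least 0.1547 w u + b / 2 hexagonal cells of area 2√3,
-- while the table never wastes more than 0.682 √n; and with 5042 or more sites the cells alone
-- exceed the entry at 5001. Areas p + √3 q are compared through integers, by means of a convergent
-- of √3.
--
-- For irregular n the entry has a spare site. If it is put into a corner, the zigzag column along
-- that side can roll away from the side, and n circles fit into a rectangle of area less than a(n)
-- (`exists_smaller`). Hence it suffices that none of the packings in question has an area below
-- a(n). For the search class this is minimality of the table.
--
-- For carved packings the lattice points in the rectangle of centres are counted. An untilted
-- hexagonal packing is dominated by a member of the class (`HexFits.entryArea_le_of_aligned`), and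
-- the square grid is too sparse (`SquareFits.card_le`). For a tilted hexagonal lattice the rows are
-- chords of the rectangle whose lengths form a trapezoidal, hence concave, profile. Summing them
-- (`RowsIn.card_le`), and using on the plateau that neighbouring rows interleave
-- (`RowsIn.card_le_of_plateau`), gives a loss that is linear in the sides, hence of order √n with a
-- constant above 0.682 (`area_le_of_linear_loss`). The count contains an error term of order 1/s
-- for the tilt s. It is controlled because an optimal packing has two centres on a line parallel to
-- a side, since otherwise a small rotation would shrink the rectangle (`IsOptimal.exists_aligned`);
-- in a tilted lattice this forces a side of length at least 1/s (`RowsIn.sides_of_aligned`).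
/-! ### A table of the hexagonal arrangements of least area -/

/-- Entry `n` of the table (16 bits each, `1 ≤ n ≤ 5042`) encodes a hexagonal arrangement of least
area among those with at least `n` sites, as `128 * w + 2 * rows + e`: there are alternating rows,
the width is `2 * w + e`, and the shifted rows are depleted if `e = 0`. -/
def bestTable : ℕ :=
  0x3dd33dd33f513f5139d8375c375c42cc42cc4cc2444b40cf40cf35df35df35df5a3832e431e63dd2464846483f503c54385a385a424d4a44444a444a40ce40ce3ad63ad64ec0513e35de47c745c945c93d533d533ed13ed13bd5424c424c43cb39583958404f36dc36dc36dc47c647c645c845c845c84bc33d5249c43ed03ed041cd43ca43ca32643362404e38d938d94747474745493a563a56533c4945494549453cd33e5141cc434b434b3b553b553b55474647464746454832e332e34944494439d74dc04dc058b83cd2434a434a434a434a434a3b543fce3fce44c944c948c54fbf375a375a375a32e239d639d635dd414c3dd13dd146c64ac3553a553a3f4f48c434de34de34de34de34de34de385836db36db42ca40cd4ac23c5235dc4f3f4f3f44493f4e3f4e3ad43ad43ad451bd51bd345f54ba57b857b8424b4646464639563d513bd34448444832623ecf3ecf3ecf3a553066306630664a424ebf424a45c7404d404d37d837d83d503bd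23bd23bd23ece3ece3ece355c4ebe3a543a543a5445c641cb41cb404c404c53bb43c833df3cd13cd138d638d63e4f49c249c249c24bc14bc139d541ca474531e23fcd3fcd4349434943494e3e3cd03cd03b523e4e385735db35db454645464744414b39d439d43fcc43484dbf4dbf4dbf494249423c513c513c513dcf36d9385646c535da414a414a4dbe4dbe3f4d3f4d3f4d48c3345d345d345d345d3c503c503dce3ad23ad2306436d840cb40cb335e42c848c24ac139543954395439545fb25fb2345c3bd14d3e3d4f3d4f3a5340ca40ca30e337d637d63ecd3ecd355a32df38d538d52d6a4446444644463bd03d4e3d4e3d4e3a523a52424842482de93ecc375730e24cbe4cbe45c543c732de32de32de32de3b513ccf404a404a41c939d339d351ba3e4d3e4d4ebd375643c643c643c643c6385547c247c247c23cce3fcb41c84c3e4c3e39d239d23e4c454545454347434749c036d747434743513a385438543fca3c4f3c4f3c4f325e325e45443dcd4346494149414742335c335c2e6636d636d6355935593f4b3c4e3ad03ad0345a345a49403dcc395246c346c346c34b3f4b3f5339533932dd32dd3f4a3f4a35583bcf3a513a5142c646c23d4d4b3e4b3e38d330e02fe231de31de2ce92ce940c83ecb444536563bce3bce3a504abf4a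bf3d4c3d4c3d4c3d4c38d238d24fbb4fbb4fbb40493eca3eca4d3c464242463b4f35d739d137543ccd4fba4fba4fba4fba2a6e38533853404840483e4b45c345c341c741c73b4e3b4e3b4e35d63ccc36d5325c34594cbc4cbc43c4385245c23e4a3e4a41c641c641c62d6651b93acf3acf3acf3c4d30df355736d4434543453fc83fc83fc83dcb4147414741474147414732db3ace3ace49be3c4c39504344454235563f493f493f493dca33d937d237d237d247404740493f2de43a4f32da3bcd44c338d138d13f483f483f4840c73d4b3d4b46c1493e37533753315d315d315d3a4e3a4e3bcc3bcc3bcc3ec93ec940c640c63d4a3d4a34d634d634d634d63752305e42454245424539cf3b4d3b4d3ec84dba40474047325a3ccb3ccb2d642d6435d4444242444abd36d336d336d339ce3b4c3e4940464046404638503cca3cca3cca3cca43c341c541c535553456345636d245c145c13acd3fc732d932d92fde2fde3c4b43c243c241c441c42de22de231da45c03554355433d73fc6394e394e4a3c4f394cba3c4a3c4a37d037d047be47be45415236523658b22be62be63dc83dc8365238cf4342434243423bcb473f473f37513751375137514eb92f5e4c3a3f463d493d493d493a4c38ce473e40c53bca44c144c14eb854b437504bbb3258325832583ec73d4842c242c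246bf39cd40c4384f35d23b4b3356335633563356513636d136d13ec63ec63cc93cc94e384e38404539cc48bd384e3b4a3454355335532de030da30da30da424242423cc83cc84440404431d831d8394d394d394d3acb3acb3acb3552463e2f5d3e4632d632d63c493c493fc53fc53fc53fc53fc5394c31593aca37ce45bf45bf41c241c23dc743c043c03c483fc436503650305a305a2d602d6045be45be3a4b3a4b374f374f3dc63dc63dc634d23bc93bc93bc93bc935d132564a3a2ddf2ddf38cc3a4a3a4a4340374e3d473d4730d93f443bc83bc83453453e453e453e35d035d035d040c3384d39cb2dde3d463d4636cf3ec549ba3b4944bf30d8473c3452345232d540c235512be251b539ca31d63cc7493b3ec436ce36ce3b483b484bb94bb94eb62ae4404333d333d332d4355035503cc63cc63e4546bc315731573ac93ac93ac92e5c40424042404248bb48bb33d23058443e394a37cc37cc37cc37cc37cc3ac8364e41c13fc33fc33fc3543227eb2ddd43bf43bf3c463dc538cb374d3254325432543a493fc23fc235cf4db630d743be43be43be43be43be3bc73bc738ca3352374c345134513a483a483a4845bc35ce35ce2be02be030d630d63bc63bc63bc64d36384b384b3f4232d339c9433e433e31d42f592f59354f47ba47ba3d443b473b4740c140c1384a3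ec33ec336cc39c832d233d133d12e5a2d5c3155354e3cc53b4640c040c044bd3ec242be37cb37cb37cb3949394949b849b833d033d033d03cc440413ac73ac73ac73e434c364c3637ca37ca37ca3948364c364c364c4eb54eb5325232523ac6423e3e4246ba30d52dda2dda2cdc374b374b38c938c935cd443c2fd63c443c4441bf3a473dc33dc33dc3344f344f344f30d4374a374a38c838c83fc035cc41be41be41be3a463a463a4632d131d231d2344e344e43bc43bc36cb384945bb413f3bc4354d354d3d4339c739c74ab74ab72f5632d02b5e315345ba3f4036ca384838483b4530543d42354c39c639c639c6433c2dd92dd9453b453b3ec140bf33ce33ce37c93b443b443cc33cc34d3439473947453a453a453a453a40be2cda2dd82dd832502bdc364a3cc23cc242bc42bc3946394634cc34cc2fd43e413e413e414cb44cb44fb247383ac43749334e334e30d249b638c738c7403e344d344d4f3325ea2f552f552f55423c3c423c42374835ca31d032cf38c63fbf3dc12e5646b8344c344c344c443a493649363a443a442a5e36c936c93fbe3fbe32ce32ce32ce32ce305241bc33cd2dd72dd73bc239c539c539c539c536c836c8354a3846384643ba324f324f324f324f286233cc3b4339c42dd63f3e3f3e3f3e36493649433b37c737c737c737c7324e30d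130d13b423b4239452fd22fd22fd2433a433a3648364837c634ca34ca34ca2e554db24db23ac33ebe39443944334c3cc040bc2f532f5335c935c937472d56344b344b344b3ac23e3f42ba31ce31ce3c413c4132cd32cd44b94a342f5237463746295e344a3e3e3a432cd72cd738c43c403c40314f4736305032cc32cc32cc354936c7423a3dbf3a4233cb3fbd3fbd384546b72cd62cd64fb0314e314e2dd4324d41bb36c636c6493539c346b633ca3bc03844384438444c324c324c3241ba2c5730cf3d3f324c364739c239c239c23b413b4137c537c52e532e53413b413b27e03d3e3d3e3f3c30ce3646394339433b402d542a5a37c4334a334a334a45b72e523cbf3ebd3ebd3ebd3ebd394235c7344931cc31cc40bb37453745433832cb3cbe3ebc3ebc3ebc4e302dd32dd338c335c640ba3448304e314d3744374437443c3f32ca32ca2cd42cd4512e512e38c23a412dd23547354733c933c936c53c3e3c3e28dc28dc28dc324b44b7403a403a38433843384335463546354633c836c436c436c42fce2fce2fce3fbb324a324a3842384238422b562b5634c73bbe3bbe364536452d523fba41b930cc2f4f2f4f39c037c337c337c33d3d443634c634c634c636443348334829d925e249332cd3394137c237c231ca31ca3b3e3b3e3b3e3f3a3f3a35c535c532c932c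92ad62bd43940394037432cd22cd23abf314b3ebb3ebb3446344635c42dd02dd032c832c838c13cbc374237423abe3eba2fcd2fcd314a314a314a33c735453545256245b438c038c040b836c33a3f3a3f3a3f3a3f3a3f2fcc2fcc30cb33c6354435443c3c384138413e3a36c236c236c242b642b64ab14534453445342f4d30ca34c52e4e38403dbb3dbb39bf364347b244b544b52cd12cd12cd12cd13fb93bbc3bbc334637c1423639be2dcf36422bd231c831c831c831c83fb83fb83b3d3b3d3d3b41b7344532c7304a304a304a35c32dce2dce314931492b533b3c3d3a3d3a3d3a3d3a3741393e32c632c632c635c23f3846b246b246b231483cbb3cbb2a542b522956374038bf33c533c53247324735432fca2e4d3cba3cba3cba30c92d4e2d4e2d4e38be38be3eb833c443353246354235423a3d3a3d2f4b2e4c2e4c45b330c830c836c02ccf40b640b6334533453c3a34c334c345b228d628d62f4a2f4a2dcd383e3641364127d827d82cce334439bd34c231c631c631c642b43db94036403637bf36402dcc30483bba3bba39bc32c532c53443344331473fb73fb725dc37be37be35c12eca3b3b3b3b393d2856285632c4344234423442314631463146373f373f3b3a3b3a41b5393c2e4b29d32fc82d4c324533c333c327d74730373e373e3abb3541354138bd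3f363cb93cb92e4a2e4a2f4933c22ccd28d42ad03aba30c630c6354038bc2bce2bce46b046b049ae49ae49ae2dcb3343334336be2ccc3eb63eb634c134c1492f22e222e24cac2b4f25da25da25da33422dca363f363f3c38383c34c03046295240b42a5028544332433245b13e363e36363e3145314537bd37bd3441344134412fc72fc72fc7265839ba39ba39ba3bb832c232c23144314442b22d4a2d4a2d4a2d4a2fc62fc6393b393b3b393b3935be28d23243324330c530c533c133c12e482ccb393a393a2f473fb442322bcc353f373c3242324232423d3633c033c047ae38bb2dc92cca2cca2f462f46353e36bd36bd2b4d31c331c331c3334138ba3ab83ab8285228522dc82a4e2c4b34bf3cb63cb6443031c231c22b4c3340304430443044304446af46af46af34be34be2ec63eb43eb43eb4383a383a32c132c12fc52fc543b03c363c36363c343f343f2d482d482e4737bb3142314232c032c032c02fc42fc42acc35bd343e343e343e39b837ba2cc92e462e462bca3bb63bb63db545af2f4535bc35bc33bf39393939373b373b403240322cc830c2324032402b4b2b4b353d2f4433be33be373a373a452f3b363d352654265426542dc62dc62dc6353c2b4a3fb2333f36bb27d13ab73ab726d34230423029cd29cd3042304234bd34bd34bd333e3ab62ec441b141b141b141b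128ce28ce3f3226d2314134bc34bc2d46363b32bf32bf25d42e452aca2aca3eb33eb33eb33838383831402fc2363a363a32be2cc72bc83eb23eb22e442e442e4437b93c343c34343c30c135bb2f43284e323f323f2cc6294c2b492b492dc52dc539b639b62a4a35ba30c030c02f42323e323e323e432f3bb43739373939372dc42dc433bc353b353b304129cb29cb31bf3b353b353738393639362c4627ce27ce353a353a353a353a30403b3431be2ec236b938b73d333d3342ae45ac45ac333c333c2d442ac82ac82fc12fc138b638b62e432e43294b294b23d634ba32bd3ab42bc62bc62cc53cb32fc0313e313e284c2e422e422e422e42343b32bc25523cb23f30383636382cc42f4130bf2a482a482a482dc3343a343a323d323d323d37b735b935b935b92b4630be30be39b523563c322dc22dc2323c37b637b635b835b825d028ca28ca39b4303f2c442c4433ba33ba33ba31bd31bd3539353935391ee239353bb23bb2303e2ec02ec02ac6373640ae31bc2d422d42294939343b333b33432d432d22d62fbf333a36b7284a2bc4313d313d3b322cc32cc32cc32948402e245224522fbe32bb2e402e4034b8313c2b452a462a462cc22cc22cc22cc24d26363732ba2f3f3ab22dc12dc130bd30bd30bd2b4425ce27ca2c43363636363636323b2f3e343834382dc030bc30bc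422c3cb023d22ac535b72c423f2e323a323a33b92ebf2ebf21d7303d303d303d22d435b639b339b32ac42ac431bb33b8264c2ebe2ebe2ebe303c2d4039b23537353737353735205a31ba33392bc22bc229462e3f2e3f2fbd35362cc137343734373427c927c9313b3e2e23d12a4439322e3e2e3e2fbc36b536b52cc026ca26ca3daf313a313a27c838b338b338b334b62dbf2f3d2f3d28c628c62c412c4132b838b2264b264b46a822d2343734372dbe2f3c2f3c2f3c2f3c2f3c323930ba30ba30ba3ab03436264a254c254c254c2ebd2ac23832383232383238303b284635b533b733b733b733b733b733b72d3e2d3e2d3e31b92944303a35b433b633b633b627c727c737b237b23f2c2e3d2cbf31b825ca2a422fbb333733372b412b4137333c2e27c627c627c62e3c2cbe353435342fba2fba29c3373228c42b402b402b402b402b4020562dbd2dbd2c3f32b72f3b36b3393029c229c229c22ac12ac1264834b430b92dbc32b62c3e2f3a2f3a2f3a40ab47a647a6294329432ac03b2e30b824cb2d3d40aa23cd2ebb2ebb26c726c726c726c73434294229423632323627c52d3c2d3c2eba2bbe2bbe3aae23cc26c626c6383035b3303831b72a402a402cbd27c42e3b2e3b2b3f33b437b135b235b235b231b631b631b628c2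29c12cbc2e3a2e3a33352b3e35333533353335332fb839af39af26462646234c2c3d2dbb353235323f2a2abf39ae31362f392f3942283c2c373023cb32b52dba28422842392f392f2abe30b72f382f3836b13eaa3eaa34b234b2392e2d3b23ca25c627c330b630b62eb92eb91ed626c4323538af38af38af2d3a2bbc3e2a3e2a303727c22eb82a3e3432323432343b2c26453dab3dab2cbb2b3d3036303630362e3933b331b529bf234a234a40a840a835b12cba2cba2fb72fb733b22e3831b42841284129be29be35b024c724c737af2fb62fb62abd2abd2db92db921cd21cd2840284037ae26c326c326c32c3a2c3a2c3a2abc2db825c435303caa372f372f27c1293e293e2f362f362bbb30b530b52d39372e372e372e25452545254532b227c02eb73c2a2bba34b036af2d382a3c2a3c244623482348323325442eb62eb628be28be2b3b2b3b2642264229bd3baa3232323238ad23c72e37303424c524c52b3a2b3a2cb82cb82cb829bc29bc362e33b12e362fb52fb523c623c622c8283e2c3931b231b235af293d25c225c22db72db72db72db7382c382c2aba35ae27bf33313aaa3aaa293c2db62db6254325433d293d29313231322bb92bb927be234626412f342d372d372d37352e254230b332b132b12a3a2a3a372d372d2eb52d36264028bc23c530b232b032b03ca824c32b3929bb29bb2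eb434ae273e273e273e3033303322c623c423c423c42b3829ba2e352e352cb62cb6303226bf26bf283c25c025c025c0342e2ab92e34293b293b2c372fb32fb338ab26be26be27bd33af254125412ab8362c293a2c362c362c362442244233ae33ae263f27bc35ad2db42a392a392f332bb72bb73e26332f21c721c735ac382a263e2d352d352f322f322bb628ba28ba28ba352d37ab3aa822c430b12d342d342eb329b932af2b3737aa283b283b3d271cd230b030b02cb52eb232ae32ae25be2b362b362b36283a283a3031303130312cb42e3334ac34ac34ac29392ab723422146303027bb3ca6322e2e322e3220482048204820482ab62ab62fb1253e21c527ba27ba2c342c342c3423c13c26392839282a372a3731ae263c263c2db22bb522c238a93f24362a362a2f312a3628b828b83ba63ba62d332bb4273a273a273a273a2f30312e312e29b728391eca2d3235aa2b3525bc25bc26bb2eb130af3828382829b629b628382cb323402b3432ad32ad30ae26ba26ba243e352a352a29372cb227b932ac2ab52ab52e312e312e31253c263b263b1e4a29362c332c3327b8302e2e3034aa34aa20c422c022c0263a322c2c3228b723be2faf2a352a352a352a3536a936a931ad31ad22412bb328b628b62db02a3427382738402231ac39271dca1dca2bb22f2f25ba2837204429b5392626b9233e233e33aa33aa2f2e2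b332b332d302836253b29b421c121c126b826b835a92eaf2b322b322cb12cb130ad27b7253a253a23bd20c22eae2eae2eae2ab322be30ac30ac32ab27b629341ec624bb2e2f23bc26382ab22c3132aa352837a7223f223f28b52e2e2e2e24ba24ba302c2a332a332a333aa4204220422042273627361f44322a322a2a322a3225b8233c233c1e462dae3726283526b726b721bf2bb029b3243a243a253936a72d2f31aa2f2d283426b626b62b3129b221be21be33a92d2e25382f2c2f2c22bc27b527b52b302b3029332933312a2caf2ead23ba24b93626362627b42ab12636293230ab2cae2eac2eac35a72040213e24b824b8273530aa30aa28b32c2f2c2f2c2f2c2f32a932a932a91bca233a2734352728b225b625b621bd21bd21bd3824302a35262a302a3026b52baf2833283325371ec21ec22fab2fab2fab29b12dac2bae26b4283222ba34a625362536253625363aa229b029b02b2f2b2f263527b323b823b8223b24b731a8203e29312b2e2b2e213c2f2a27b227b227b22339233924b624b629302aaf2aaf2eab1ec11ec12733273333a62cac233823382aae2eaa2eaa2eaa30a930a9273225b42c2d20bc20bc20bc28b0243630a821ba21ba21ba35a526b3253525352e2a2a2e283132a722b823b723b723b72bad26b226b2253432a629af28301f3e1f3e203c23b62bac2bac2daa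213a213a29ae29ae27b127b127b127b12b2d32262337233726322632292f24b427b027b027b02b2c2d2a2d2a2d2a23361ebe292e292e1b46273120ba2aad2cab2cab2cab17521cc21cc225b221b821b827302caa2caa2caa203b203b33a5312628ae28ae22b622b626b126b123b51e3e1e3e30a7203a203a282f282f25322a2c26b026b030a623b41c421c422e28282e282e2bab29ad24b326312236223622362335233532a52baa2baa29ac1dbe24b2263035a22da821b71cc0233427ae27ae292d292d3523352325b11bc21f3b1f3b2b2a2b2a272f292c203932242d282d28243224322f272aab1f3a272e28ad22b42ca92ca920382f2625312aaa2aaa31a431a426af2ca8213622352ea71b421b42253023b223b223b226ae26ae2ea62ea62ea61eba2a2a2a2a24b124b12333282c262f262f30a530a51bc029ab20b620b624b02e262332262e1f391f39332329aa29aa29aa2ba821b4243127ac1e3a25af25af25af292b1c3e2da63024399e32a32430203625ae22b2292a292a2b2832a21eb91eb91eb9272c23b12134252f2d262233223318c61dba1dba1cbc26ad26ad23b0252e20b520b52232223222322232174a26ac2ca62ca6233124af24af20b420b421b31f371f37262d262d282a282a24ae24ae1e382ea4203521b221b21f3629a927ab31223122242f242f242f2ba71db9203425ad27aa27aa1eb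71eb7242e2ba62ba62ba630a2292925ac2132213221321bbc1eb623af2231223129282da4272a272a272a2b263022302223ae23ae223022302230252c252c2aa72aa720b21f352d24232f232f21b126aa2aa62aa62aa6399c2ca518c22829232e232e1a3e262b24ac24ac1db7322032202828282820322a26262a262a242d242d1cb81bba1db61db61db629a722ae25ab25ab242c2130213027a827a829a629a62ba525aa222f1fb223ad23ad20b120b129272ba42e222e22252b222e1b3a23ac2728292620b01e341e341a3c252a252a252a21af232d2da21f321f322031193e1db524ab24ab24ab21ae232c232c232c1cb61eb3203024aa2d221db42629262922ad22ad22ad19bc19bc1eb2242b2826262826281d35212e212e2ca218be2a24242a27a725a91c361b381b38222d20af29a5321e27a623ab25a825a81e321e321e32222c20ae20ae272723aa25292ba3319e319e1f301db321ad2726202f2ba2232b1cb41cb42924292419ba1eb11db22b23202e232a232a28a528a51c3518bc26a626a6212d212d24a822ab309e309e309e1b3626271c341a38212c242922aa1fae2aa2193a26262626301e2d20282420ad20ad222b222b1f2f25a72ca12ca127a518bb2a2220ac222a1bb425a61f2e1f2e1cb21cb229a323a823a8202d21ab252725271db029a229a229a223292329361a21aa21aa2724292329231eae1a36232823281c3224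a7292229222ba02ba02ba02ba022a922a924a626a4212a1fac1fac2e1e18b918b922a81e2e24272427242720ab1f2d1bb21bb21bb2222924262d9e1daf1cb020aa20aa1f2c28222822222823a723a723a71dae1dae202b27a31ead25a423a623a61b3219362a2027a2202a202a25251eac21a821a82c9e2c9e27231ab31ab31d2e1d2e2326212921292722272217b917b924a51faa1faa22a721281e2c1bb01bb01bb024a42920292022a626a21cae1cae1dad1dad24252425321a321a1f2a1f2a20a820a81a321dac1dac1dac2622222622261eab2029202923a51c2e1d2d25a318b521a71ab11eaa202823a42a9e25a225a21d2c21a619b2163a18b41fa91fa92523252327a0309a1bae2a1e2a1e23241e2a1e2a1a311a312c9d212621261cac22a524a31f291dab193219321a3020a720a724a21c2d1b2e1f281daa1daa1daa20a620a62225291e17b51c2c1ea91aaf1d2b1d2b24222224222418b219b02b9c1ea817b41d2a202621a521a52b1d2e9a16b616b61e2923a223a21fa71a2f1a2f13be281e25a025a01e281e281fa61caa1caa1a2e25211734232223221da921241f271b2c1c2b1636163622a322a322a31da81f2624a124a11c2a22a218b0271e19ae20a41d291ea71ea716b422231bab1bab1bab20252c9a1ea61ea622222222143a1baa1a2d2024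2024291c1e27192e1732173223a123a11fa5261e261e1e261ca81ca823a018af18af1fa41b2a1b2a21231da71c291c29259e259e18ae18ae21221aab1da619ac1c281c281c281f24279d20a322a11aaa1d271d271ba92a9a1ea520a222a0249f14b61d261a2b1a2b1ba81ea4249e249e2a1a271c271c1ca71a2a17af2022202218ad18ad18ad15b31ca6241e21a11e2417ae17ae16b018ac291b239f1c271fa21da519aa1aa91aa9239e261c21211c261f231da41da430161aa81aa82120172e1f221ba71d25231e231e231e192a192a15321ea31ba61d2417ad17ad20a020a01a281ea2229e229e1ca51ca516ae17ac249d279a1e2318aa18aa1b262020249c271b221e1e221e2219a819a81c251aa71aa7219f219f1da31da3162e1fa01c241aa61aa615301da2239d239d1f211f211ba515af1a2717ab1d231d231f20211e261a1ba418a91a261d2217aa1ea1209f209f231c1b251b2518a81ca3209e209e172b172b172b1b24251b1ca219a6229c229c162c172a152e1aa5201e1c231c231927249b1430143015ad1aa41c22249a2798192617a917a91f9e1f9e1a2516aa16aa16aa14ae18a7241a241a1d211ba21ba212b3211d1f1e18a618a61d201d201b23239a239a1e9f162a152c1ca11ca11b2219a41e9e1e9e261811361ca0182614ad1aa3192519251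925229b1c211c2125981aa21aa2229a16a8201c1c201c2013ae1d9f17a617a618a518a51ba11ba11d9e1d9e1a221f9c172718a4152a219b1d1f142c1f1d19a319a317261b211d1e1d1e1f1c15a919a2211b211b1b201c9f1e9d2716211a14aa192319231c9e1e9c16a6209b209b209b192219221aa0209a209a17a41627162723181c1e1a212616142a142a17251626201a18a21a201a202298229814a917241b9e15a719a119a112ad1f9a1d1d1d1d1b1f13aa182218221f1b1d1c21991b1e1b1e16a41f1a17a31c9d1c9d1c9d1a9f11ae1e9b192017a2142815261a9e1e9a2118211818a11624172323971a1f14a714a71c1c18a018a017221a1e1a1e112e14a614a618211d9b1d9b199f199f1b9c20181d9a18202297199e16a21b1d1b1d1d1b1d1b17a11426191f1b1c1d1a1524122a122a17a0191e1a9d1c9b1622162214a5219717211c9a1c9a1c9a13a615a312a814a4189e189e1e9811aa11aa15a21c1a1a1c181f181f181f181f28121b9b199d181e16a0142420961b9a1d99199c1522179f162112a71b1b1b1b191d2016179e14a31b1a1b1a12a6191c191c191c171f14a215a115a1189d189d1c99171e171e171e15a0189c1c981f161a1b169f169f169f14221e971a1a1a1a169e169e1e96181c1520199b102a102a161f161f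179d199a11a613a21b98161e161e179c191b1d9714a014a01323159f191a191a1b180faa14211224159e171c1a99201420141d161420189a169d12a312a31c9723121f94181b151e1c9612a20f2a0f2a181a181a161d149f149f0cb219991c161e95161c149e149e1998179a12221124159d159d1b961026171b171b2590159c1918141e171a171a1d951b16151d11a211a2169b12a01a971898151c0fa6169a139e139e18191d14149d149d161b161b1122112212201a16161a161a1799131e131e1997141d159b17980daa1996129f1f12159a17190ea719170fa4129e129e151b1916112111210ea60ea6151a139c139c139c10221b141896121e131d0f241a951a951619149a149a131c131c181616181618141b0fa2119e179715991a14141a141a1796129c15981c921c92139b171719941519111e0f22139a1c121c121518121c0fa11697131b0ea314991b9216961696131a131a14980ea21617119c1b12129b1419161616161a93111d129a1418101e0f200f201795111c159615960ca617941a121a12121a121a171519930f9e151613191992199219921c9014971318119a101d0c261496169412990f1e111b101c1417141712981892111a14160f9d0f9d12191f0e1595139718120f9c121815941396109a109a109a1199179213170ca2101b15141198131613161316101a101a111912970e9d149419900f9b1296169214150e9c0d9e0f9a12171414141414141612121610981c0e18901593159311970f1a15921b8e1b8e1196119610180e9b17911314151215120f990e9a129511160c9e0c9e0f9814920e1b1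09710971a0e1215121510960d1c141212140f180c1e1017139311950aa20e99101610160d9a15910c9c13130f9711151115131213120f961114111412930d1a0d1a1095129214911491178e0f1612130b1e0b9d1b0c12120c9a0d980d98141010140e960e96168e11920f950f950e170e170c1a0f9413110e161112158f0f150b9b158e109312910f140c9810920d96150e0e950e951013148f0d170e94101210120c180d160b1a0f93099e140e11900f920f92138f111111110c960c9611100a9a0f120d941091130e130e0e930d150c160b180e92128e0d140a1a0b970e130e130c95120e0e120e120a980c940f900d93118e099a0f110d92110f0b160f10110e0d13178a0e91108f0d120d12108e108e0a960c930e11168a128d0c920e10128c160a0f8f0d910a160f8e120c0c120c120f0f09970d110f0e0f0e0a9409960b92081a110c0e8e0e8e0b130b130c900a140b120e0e0c110c1109950d8f0c1008970d8e0a920b91128a0d0f0d0f0b900d0e120a0f0c0a120c8f0e8d118a0c8e08160895069b110a099209920c0e0a90108a0d8d0b8f0a110d8c0b8e0b8e0a100f8b0b0f0f8a09910b0e0c8d08920f0a0a8f12880e8b0a8e0e8a0e8a0c0c081208120e0a0a0e08910b8c11080d8a0b0d0792098e0b0c0d0a06160a8d0c8b0810090e071207120a0d088f0c0a0a0c088e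0b8b098d0b8a080f098c0b0b080e0b0a0b0a0d88090c06120a8a078e11060a0b088c0a0a0a0a080d070e0c08098a0b89068f090b0f06090a078c0b08088b070d088a0a88060e080b080b080a0d060989078b058e078a09090c06070b060c070a050e08880b060809068a0a860a86048e0a06060a09870986058b0708058a0689088708860886050a0806060807870786048a058807060509068706860984060706060488038a0586080405070506030a0487048606840407040605850387038605040485030604050404028606820602020605020482040203820302028202020182010200820000

/-- The entry of the table at `n`. -/
def entry (n : ℕ) : ℕ := Nat.mod (Nat.shiftRight bestTable (Nat.mul 16 n)) 65536

/-- An integer that orders the numbers `p + √3 * q` with small `p` and `q`. -/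
def areaKey (p q : ℕ) : ℕ := Nat.add (Nat.mul 151316 p) (Nat.mul 262087 q)

/-- The rational part of the area of `r` alternating rows of total width `u`. -/
def hexP (u : ℕ) : ℕ := Nat.mul 2 u

/-- The coefficient of `√3` in the area of `r` alternating rows of total width `u`. -/
def hexQ (u r : ℕ) : ℕ := Nat.mul u (Nat.sub r 1)

def entryW (t : ℕ) : ℕ := Nat.div t 128
def entryR (t : ℕ) : ℕ := Nat.mod (Nat.div t 2) 64
def entryE (t : ℕ) : ℕ := Nat.mod t 2
def entryU (t : ℕ) : ℕ := Nat.add (Nat.mul 2 (entryW t)) (entryE t)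
def entryP (t : ℕ) : ℕ := hexP (entryU t)
def entryQ (t : ℕ) : ℕ := hexQ (entryU t) (entryR t)
def entryKey (t : ℕ) : ℕ := areaKey (entryP t) (entryQ t)

/-- The number of sites of `r` alternating rows with `w` sites in the unshifted rows; the shifted
rows are depleted if `e = 0`. -/
def hexCap (w r e : ℕ) : ℕ :=
  bif Nat.beq e 0 then Nat.sub (Nat.mul w r) (Nat.div r 2) else Nat.mul w r

def entryCap (t : ℕ) : ℕ := hexCap (entryW t) (entryR t) (entryE t)

/-- Whether `p` holds for all numbers below `n`. -/
def allBelow (p : ℕ → Bool) (n : ℕ) : Bool := Nat.rec true (fun k ih => and (p k) ih) n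

/-- The number of `k < n` with `p k`. -/
def countBelow (p : ℕ → Bool) (n : ℕ) : ℕ :=
  Nat.rec 0 (fun k ih => bif p k then Nat.succ ih else ih) n

theorem allBelow_iff (p : ℕ → Bool) (n : ℕ) : allBelow p n = true ↔ ∀ k < n, p k = true := by
  induction n with
  | zero => simp [allBelow]
  | succ n ih =>
    have : allBelow p (n + 1) = and (p n) (allBelow p n) := rfl
    rw [this, Bool.and_eq_true, ih]
    constructor
    · rintro ⟨h1, h2⟩ k hk
      rcases Nat.lt_succ_iff_lt_or_eq.mp hk with h | rfl
      exacts [h2 k h, h1]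
    · exact fun h => ⟨h n (Nat.lt_succ_self n), fun k hk => h k (Nat.lt_succ_of_lt hk)⟩

theorem countBelow_eq (p : ℕ → Bool) (n : ℕ) :
    countBelow p n = ((Finset.range n).filter fun k => p k = true).card := by
  induction n with
  | zero => simp [countBelow]
  | succ n ih =>
    have : countBelow p (n + 1) = bif p n then Nat.succ (countBelow p n) else countBelow p n := rfl
    rw [this, Finset.range_add_one, Finset.filter_insert, ih]
    cases h : p n <;> simp

/-- The entry at `n` is well-formed, has at least `n` sites, has the area of the next entry only if
it agrees with it, and its area is at most `2 * √3 * (n + 0.682 * √n)`. -/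
def entryOk (n : ℕ) : Bool :=
  let t := entry n
  -- This is 10000 (√3 * area - 6 n) with √3 rounded up to 1.7321 in the first product, cut off at
  -- 0. The bound on its square below is (40920 √n) ^ 2, and 40920 = 60000 * 0.682.
  let x := Nat.sub (Nat.add (Nat.mul 17321 (entryP t)) (Nat.mul 30000 (entryQ t))) (Nat.mul 60000 n)
  and (and (and (Nat.ble 1 (entryW t)) (Nat.ble 1 (entryR t))) (Nat.ble n (entryCap t)))
    (and (and (Nat.ble (entryQ t) 20000) (or (Nat.ble 2 (entryR t)) (Nat.beq (entryE t) 0)))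
      (and (or (Nat.beq t (entry (Nat.succ n)))
          (Nat.ble (Nat.succ (entryKey t)) (entryKey (entry (Nat.succ n)))))
        (Nat.ble (Nat.mul x x) (Nat.mul 1674446400 n))))

/-- The arrangement encoded at its number `m` of sites has at most the area `p + √3 * q`. -/
def beats (m p q : ℕ) : Bool := or (Nat.ble 5042 m) (Nat.ble (entryKey (entry m)) (areaKey p q))

/-- If arrangements of `r` rows of `w` sites could compete, both kinds are beaten by the table. -/
def pairOk (w r : ℕ) : Bool :=
  -- As 46512400 = 6820 ^ 2, the first alternative says 0.682 √(w r) ≤ 0.1547 w + (r - 1) / 2: the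
  -- loss exceeds that of the table. The constant 0.1547 is 2 / √3 - 1 rounded down.
  let c := Nat.add (Nat.mul 1547 w) (Nat.mul 5000 (Nat.sub r 1))
  or (Nat.ble (Nat.mul 46512400 (Nat.mul w r)) (Nat.mul c c))
    (and (beats (hexCap w r 0) (hexP (Nat.mul 2 w)) (hexQ (Nat.mul 2 w) r))
      (beats (hexCap w r 1) (hexP (Nat.succ (Nat.mul 2 w))) (hexQ (Nat.succ (Nat.mul 2 w)) r)))

/-- The depleted hybrid with `b` nested and `u - 1` stacked steps is beaten by the table. -/
def hybridOk (w u b : ℕ) : Bool :=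
  beats (Nat.sub (Nat.mul w (Nat.add u b)) (Nat.div (Nat.succ b) 2)) (Nat.mul 4 (Nat.mul w u))
    (Nat.mul 2 (Nat.mul w b))

/-! ### Finite verifications on the table -/

theorem entryOk_all : allBelow (fun k => entryOk (Nat.succ k)) 5041 = true := by
  decide +kernel

theorem pairOk_all :
    allBelow (fun r => allBelow (fun w => pairOk (Nat.succ w) (Nat.succ r))
      (Nat.div 5150 (Nat.succ r))) 100 = true := by
  decide +kernel

theorem hybridOk_all :
    allBelow (fun u => allBelow (fun b => allBelow (fun w =>
      hybridOk (Nat.succ w) (Nat.succ (Nat.succ u)) b) 60) 10) 40 = true := by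
  decide +kernel

/-- Whether the table has the same entry at `n` and `n + 1`. -/
def isFlat (n : ℕ) : Bool := Nat.beq (entry n) (entry (Nat.succ n))

theorem countBelow_isFlat :
    Nat.beq (countBelow (fun k => isFlat (Nat.succ k)) 5000) 1495 = true := by
  decide +kernel

/-- The flat places are not below 49, their entries have at least two rows of at least two sites,
and up to 107 they are as listed; the last one up to 5000 is 4999. -/
theorem isFlat_all :
    allBelow (fun k => or (not (isFlat (Nat.succ k)))
      (and (Nat.ble 49 (Nat.succ k))
        (and (Nat.ble 2 (entryW (entry (Nat.succ k))))
          (Nat.ble 2 (entryR (entry (Nat.succ k))))))) 5000 = true := by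
  decide +kernel

theorem isFlat_small :
    allBelow (fun k => not (xor (isFlat (Nat.succ k)) (or (or (or (or (Nat.beq k 48) (Nat.beq k 60))
      (Nat.beq k 78)) (Nat.beq k 96)) (Nat.beq k 106)))) 107 = true := by
  decide +kernel

theorem isFlat_last : and (isFlat 4999) (not (isFlat 5000)) = true := by
  decide +kernel

theorem entry_5001_small :
    Nat.ble (Nat.add (Nat.mul 17321 (entryP (entry 5001))) (Nat.mul 30000 (entryQ (entry 5001))))
      302519999 = true := by
  decide +kernel

/-! ### From integer keys to real areas -/

/-- The area of the arrangement that an entry of the table encodes. -/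
def entryArea (t : ℕ) : ℝ := entryP t + √3 * entryQ t

theorem sqrt_three_bounds : (1.7320508 : ℝ) < √3 ∧ √3 < 1.7320509 := by
  constructor
  · exact Real.lt_sqrt_of_sq_lt (by norm_num)
  · exact (Real.sqrt_lt' (by norm_num)).2 (by norm_num)

theorem sqrt_three_sq : √3 * √3 = (3 : ℝ) := Real.mul_self_sqrt (by norm_num)

theorem area_sub_eq (p q p' q' : ℕ) :
    151316 * ((p' + √3 * q' : ℝ) - (p + √3 * q)) =
      ((areaKey p' q' : ℝ) - areaKey p q) - ((q' : ℝ) - q) * (262087 - 151316 * √3) := by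
  simp only [areaKey, Nat.add_eq, Nat.mul_eq]
  push_cast
  ring

/-- Since 262087 ^ 2 - 3 * 151316 ^ 2 = 1, the difference is the reciprocal of 262087 + 151316 √3.
-/
theorem convergent_bounds :
    0 < (262087 - 151316 * √3 : ℝ) ∧ (262087 - 151316 * √3 : ℝ) < 1 / 400000 := by
  have h : (262087 - 151316 * √3 : ℝ) * (262087 + 151316 * √3) = 1 := by
    linear_combination (-(151316 : ℝ) ^ 2) * sqrt_three_sq
  have h3 := sqrt_three_bounds
  have hpos : (0 : ℝ) < 262087 + 151316 * √3 := by linarith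
  constructor
  · by_contra hn
    nlinarith
  · by_contra hn
    nlinarith

/-- Distinct keys differ by at least 1, whereas the error of the convergent contributes at most
20000 / 400000. Only the coefficient on the larger side matters for this direction of the error. -/
theorem area_lt_of_areaKey_lt {p q p' q' : ℕ} (hq' : q' ≤ 20000)
    (h : areaKey p q < areaKey p' q') : (p + √3 * q : ℝ) < p' + √3 * q' := by
  have h1 := area_sub_eq p q p' q'
  obtain ⟨hd, hd'⟩ := convergent_bounds
  have h2 : (areaKey p q : ℝ) + 1 ≤ areaKey p' q' := by exact_mod_cast h
  have h3 : (q' : ℝ) ≤ 20000 := by exact_mod_cast hq'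
  have h4 : (0 : ℝ) ≤ q := q.cast_nonneg
  nlinarith

/-- Equal keys belong to equal pairs: 151316 is coprime to 262087, so it divides the difference of
the coefficients of √3, which is smaller in absolute value. -/
theorem area_le_of_areaKey_le {p q p' q' : ℕ} (hq : q ≤ 20000) (hq' : q' ≤ 20000)
    (h : areaKey p q ≤ areaKey p' q') : (p + √3 * q : ℝ) ≤ p' + √3 * q' := by
  rcases h.lt_or_eq with h | h
  · exact (area_lt_of_areaKey_lt hq' h).le
  · simp only [areaKey, Nat.add_eq, Nat.mul_eq] at h
    have h1 : (151316 : ℤ) * (p - p') = 262087 * (q' - q) := by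
      have : (151316 * p + 262087 * q : ℤ) = 151316 * p' + 262087 * q' := by exact_mod_cast h
      linarith
    -- The Bézout coefficients come from the Pell equation 262087 ^ 2 - 3 * 151316 ^ 2 = 1.
    have hcop : IsCoprime (151316 : ℤ) 262087 := ⟨-(3 * 151316), 262087, by norm_num⟩
    have hdvd : (151316 : ℤ) ∣ q' - q := hcop.dvd_of_dvd_mul_left ⟨_, h1.symm⟩
    have hzero : (q' - q : ℤ) = 0 := by
      refine Int.eq_zero_of_abs_lt_dvd hdvd ?_
      rw [abs_lt]
      constructor <;> linarith [(by exact_mod_cast hq : (q : ℤ) ≤ 20000),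
        (by exact_mod_cast hq' : (q' : ℤ) ≤ 20000), Int.natCast_nonneg q, Int.natCast_nonneg q']
    rw [hzero] at h1
    have hqq : q = q' := by
      have : (q' : ℤ) = q := by linarith
      exact_mod_cast this.symm
    have hpp : p = p' := by
      have : (p : ℤ) = p' := by linarith
      exact_mod_cast this
    rw [hqq, hpp]

theorem entryOk_spec {n : ℕ} (h1 : 1 ≤ n) (h2 : n ≤ 5041) :
    1 ≤ entryW (entry n) ∧ 1 ≤ entryR (entry n) ∧ n ≤ entryCap (entry n) ∧
    entryQ (entry n) ≤ 20000 ∧ (2 ≤ entryR (entry n) ∨ entryE (entry n) = 0) ∧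
    (isFlat n = true ∨ entryKey (entry n) < entryKey (entry (n + 1))) ∧
    (17321 * entryP (entry n) + 30000 * entryQ (entry n) - 60000 * n) ^ 2 ≤ 1674446400 * n := by
  have h := (allBelow_iff _ _).1 entryOk_all (n - 1) (by omega)
  have hn : Nat.succ (n - 1) = n := by omega
  simp only [hn, entryOk, isFlat, Bool.and_eq_true, Bool.or_eq_true, Nat.ble_eq, Nat.beq_eq,
    Nat.add_eq, Nat.mul_eq, Nat.sub_eq] at h ⊢
  rw [pow_two]
  tauto

theorem isFlat_iff (n : ℕ) : isFlat n = true ↔ entry n = entry (n + 1) := by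
  simp [isFlat, Nat.beq_eq]

theorem entryQ_le {n : ℕ} (h1 : 1 ≤ n) (h2 : n ≤ 5041) : entryQ (entry n) ≤ 20000 :=
  (entryOk_spec h1 h2).2.2.2.1

theorem entryArea_lt_succ {n : ℕ} (h1 : 1 ≤ n) (h2 : n ≤ 5040) (h : isFlat n = false) :
    entryArea (entry n) < entryArea (entry (n + 1)) := by
  obtain ⟨-, -, -, -, -, h6, -⟩ := entryOk_spec h1 (by omega : n ≤ 5041)
  rcases h6 with h6 | h6
  · simp [h] at h6
  · exact area_lt_of_areaKey_lt (entryQ_le (by omega) (by omega)) h6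

theorem entryArea_mono {m n : ℕ} (h1 : 1 ≤ m) (h2 : n ≤ 5041) (h : m ≤ n) :
    entryArea (entry m) ≤ entryArea (entry n) := by
  induction n, h using Nat.le_induction with
  | base => exact le_rfl
  | succ n hmn ih =>
    refine (ih (by omega)).trans ?_
    cases hf : isFlat n
    · exact (entryArea_lt_succ (by omega) (by omega) hf).le
    · rw [(isFlat_iff n).1 hf]

theorem entryArea_le_of_sq_le {n : ℕ} (h1 : 1 ≤ n) (h2 : n ≤ 5041) {l : ℝ} (hl : 0 ≤ l)
    (h : 0.682 ^ 2 * n ≤ l ^ 2) : entryArea (entry n) ≤ 2 * √3 * (n + l) := by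
  obtain ⟨-, -, -, -, -, -, h7⟩ := entryOk_spec h1 h2
  obtain ⟨h3, h3'⟩ := sqrt_three_bounds
  have hs := sqrt_three_sq
  set p := entryP (entry n)
  set q := entryQ (entry n)
  have key : (17321 * p + 30000 * q - 60000 * n : ℝ) ≤ 60000 * l := by
    by_contra hcon
    push Not at hcon
    have hle : 60000 * n ≤ 17321 * p + 30000 * q := by
      have : (60000 * n : ℝ) ≤ 17321 * p + 30000 * q := by linarith
      exact_mod_cast this
    have h8 : ((17321 * p + 30000 * q - 60000 * n : ℕ) : ℝ) ^ 2 ≤ 1674446400 * n := by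
      exact_mod_cast h7
    rw [Nat.cast_sub hle] at h8
    push_cast at h8
    nlinarith
  have hp : (0 : ℝ) ≤ p := p.cast_nonneg
  unfold entryArea
  have : √3 * (p + √3 * q) ≤ √3 * (2 * √3 * (n + l)) := by
    have e1 : √3 * (p + √3 * q) = √3 * p + 3 * q := by linear_combination (q : ℝ) * hs
    have e2 : √3 * (2 * √3 * (n + l)) = 6 * (n + l) := by linear_combination 2 * (n + l) * hs
    rw [e1, e2]
    nlinarith
  exact le_of_mul_le_mul_left this (by linarith)

theorem entryArea_le_sqrt {n : ℕ} (h1 : 1 ≤ n) (h2 : n ≤ 5041) :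
    entryArea (entry n) ≤ 2 * √3 * (n + 0.682 * √n) := by
  refine entryArea_le_of_sq_le h1 h2 (by positivity) ?_
  rw [mul_pow, Real.sq_sqrt n.cast_nonneg]

/-- Here 302520000 = 60000 * 5042: at 5001 the table still lies below 5042 hexagonal cells.
Therefore arrangements with 5042 or more sites need no comparison. -/
theorem entryArea_le_large {m n : ℕ} (h1 : 1 ≤ m) (h2 : m ≤ 5001) (hn : 5042 ≤ n) :
    entryArea (entry m) ≤ 2 * √3 * n := by
  refine (entryArea_mono h1 (by norm_num) h2).trans ?_
  have h := entry_5001_small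
  simp only [Nat.ble_eq, Nat.add_eq, Nat.mul_eq] at h
  obtain ⟨h3, h3'⟩ := sqrt_three_bounds
  have hs := sqrt_three_sq
  unfold entryArea
  set p := entryP (entry 5001)
  set q := entryQ (entry 5001)
  have hp : (0 : ℝ) ≤ p := p.cast_nonneg
  have h' : (17321 * p + 30000 * q : ℝ) ≤ 302519999 := by exact_mod_cast h
  have hn' : (5042 : ℝ) ≤ n := by exact_mod_cast hn
  have : √3 * (p + √3 * q) ≤ √3 * (2 * √3 * n) := by
    have e1 : √3 * (p + √3 * q) = √3 * p + 3 * q := by linear_combination (q : ℝ) * hs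
    have e2 : √3 * (2 * √3 * n) = 6 * n := by linear_combination 2 * (n : ℝ) * hs
    rw [e1, e2]
    nlinarith
  exact le_of_mul_le_mul_left this (by linarith)

theorem entryArea_le_of_beats {m p q : ℕ} (h1 : 1 ≤ m) (h2 : m ≤ 5041) (hq : q ≤ 20000)
    (h : beats m p q = true) : entryArea (entry m) ≤ p + √3 * q := by
  simp only [beats, Bool.or_eq_true, Nat.ble_eq] at h
  rcases h with h | h
  · omega
  · exact area_le_of_areaKey_le (entryQ_le h1 h2) hq h

/-! ### Minimality of the table -/

/-- Arrangements whose width and number of rows are out of proportion lose against the table. -/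
theorem entryArea_le_of_loss {n w u b : ℕ} (h1 : 1 ≤ n) (h2 : n ≤ 5041) (hn : n ≤ w * (u + b))
    (h : 46512400 * (w * (u + b)) ≤ (1547 * (w * u) + 5000 * b) ^ 2) :
    entryArea (entry n) ≤ 2 * √3 * (n + (0.1547 * (w * u) + b / 2)) := by
  refine entryArea_le_of_sq_le h1 h2 (by positivity) ?_
  have h' : (46512400 * (w * (u + b)) : ℝ) ≤ (1547 * (w * u) + 5000 * b) ^ 2 := by exact_mod_cast h
  have hn' : (n : ℝ) ≤ w * (u + b) := by exact_mod_cast hn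
  nlinarith

theorem pairOk_spec {w r : ℕ} (hw : 1 ≤ w) (hr : 1 ≤ r) (hwr : w * r ≤ 5041 + r / 2) :
    pairOk w r = true := by
  by_cases hc : 46512400 * (w * r) ≤ (1547 * w + 5000 * (r - 1)) ^ 2
  · simp only [pairOk, Bool.or_eq_true, Nat.ble_eq, Nat.mul_eq, Nat.add_eq, Nat.sub_eq]
    left
    rwa [← pow_two]
  -- From 101 rows on, the loss (r - 1) / 2 alone outweighs 0.682 √(w r), because w r ≤ 5041 + r /
  -- 2.
  · have hr100 : r ≤ 100 := by
      by_contra hr'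
      obtain ⟨k, rfl⟩ : ∃ k, r = k + 101 := ⟨r - 101, by omega⟩
      simp only [show k + 101 - 1 = k + 100 by omega] at hc
      have h5 : 2 * (w * (k + 101)) ≤ 10082 + (k + 101) := by omega
      nlinarith
    have hwr' : w * r ≤ 5150 := by omega
    have h := (allBelow_iff _ _).1 pairOk_all (r - 1) (by omega)
    have h' := (allBelow_iff _ _).1 h (w - 1) (by
      have : w ≤ 5150 / r := (Nat.le_div_iff_mul_le (by omega)).2 hwr'
      have hr' : Nat.succ (r - 1) = r := by omega
      rw [hr']
      change w - 1 < 5150 / r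
      omega)
    rwa [show Nat.succ (w - 1) = w by omega, show Nat.succ (r - 1) = r by omega] at h'

theorem pair_beats {w r : ℕ} (hw : 1 ≤ w) (hr : 1 ≤ r) (hwr : w * r ≤ 5041 + r / 2)
    (hc : ¬ 46512400 * (w * r) ≤ (1547 * w + 5000 * (r - 1)) ^ 2) :
    beats (w * r - r / 2) (2 * (2 * w)) (2 * w * (r - 1)) = true ∧
      beats (w * r) (2 * (2 * w + 1)) ((2 * w + 1) * (r - 1)) = true := by
  have h := pairOk_spec hw hr hwr
  simp only [pairOk, Bool.or_eq_true, Nat.ble_eq, Nat.mul_eq, Nat.add_eq, Nat.sub_eq,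
    Bool.and_eq_true, ← pow_two] at h
  exact h.resolve_left hc

/-- If the loss is small, the inequality between the means bounds u b / (u + b), hence b as u ≥ 2;
the square of the stacked part alone bounds w u ^ 2 / (u + b), hence w and u. What remains lies in
the verified range. -/
theorem hybrid_beats {w u b : ℕ} (hw : 1 ≤ w) (hu : 2 ≤ u)
    (hc : ¬ 46512400 * (w * (u + b)) ≤ (1547 * (w * u) + 5000 * b) ^ 2) :
    beats (w * (u + b) - (b + 1) / 2) (4 * (w * u)) (2 * (w * b)) = true ∧ w ≤ 60 ∧ b ≤ 9 := by
  push Not at hc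
  have h1 : 30940000 * (u * b) < 46512400 * (u + b) := by
    have : w * (30940000 * (u * b)) < w * (46512400 * (u + b)) := by
      have := four_mul_le_sq_add (1547 * (w * u)) (5000 * b)
      linarith
    exact lt_of_mul_lt_mul_left this (Nat.zero_le w)
  have hb : b ≤ 9 := by
    by_contra hb
    obtain ⟨k, rfl⟩ : ∃ k, b = k + 10 := ⟨b - 10, by omega⟩
    obtain ⟨l, rfl⟩ : ∃ l, u = l + 2 := ⟨u - 2, by omega⟩
    nlinarith
  have h2 : 2393209 * (w * u ^ 2) < 46512400 * (u + b) := by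
    have : w * (2393209 * (w * u ^ 2)) < w * (46512400 * (u + b)) := by
      nlinarith [Nat.zero_le (w * u * b)]
    exact lt_of_mul_lt_mul_left this (Nat.zero_le w)
  have hw' : w ≤ 60 := by
    by_contra hw'
    have h3 : 61 * u ^ 2 ≤ w * u ^ 2 := Nat.mul_le_mul_right _ (by omega)
    nlinarith
  have hu' : u ≤ 41 := by
    by_contra hu'
    have h3 : 1 * u ^ 2 ≤ w * u ^ 2 := Nat.mul_le_mul_right _ hw
    nlinarith
  have h := (allBelow_iff _ _).1 hybridOk_all (u - 2) (by omega)
  have h' := (allBelow_iff _ _).1 h b (by omega)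
  have h'' := (allBelow_iff _ _).1 h' (w - 1) (by omega)
  rw [show Nat.succ (w - 1) = w by omega, show Nat.succ (Nat.succ (u - 2)) = u by omega] at h''
  exact ⟨h'', hw', hb⟩

/-- The table is minimal among the arrangements with depleted shifted rows, with `u - 1` stacked
and `b` nested steps. -/
theorem entryArea_le_depleted {m w u b : ℕ} (hm : 1 ≤ m) (hm' : m ≤ 5001) (hw : 1 ≤ w) (hu : 1 ≤ u)
    (h : m + (b + 1) / 2 ≤ w * (u + b)) :
    entryArea (entry m) ≤ 2 * w * (2 * u + √3 * b) := by
  -- The comparison is made for the largest admissible count n; monotonicity of the table passes to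
  -- m.
  obtain ⟨n, hn⟩ : ∃ n, n + (b + 1) / 2 = w * (u + b) := ⟨w * (u + b) - (b + 1) / 2, by omega⟩
  have hmn : m ≤ n := by omega
  obtain ⟨h3, h3'⟩ := sqrt_three_bounds
  have hs := sqrt_three_sq
  have hn2 : (2 * n + b : ℝ) ≤ 2 * (w * (u + b)) := by
    have : 2 * n + b ≤ 2 * (w * (u + b)) := by omega
    exact_mod_cast this
  have hwu : (0 : ℝ) ≤ w * u := by positivity
  have hloss : 2 * √3 * (n + (0.1547 * (w * u) + b / 2)) ≤ 2 * w * (2 * u + √3 * b) := by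
    have e : 2 * √3 * (n + (0.1547 * (w * u) + b / 2)) =
      √3 * (2 * n + b) + 0.3094 * √3 * (w * u) := by ring
    have e2 : 2 * √3 * (w * (u + b)) = 2 * √3 * (w * u) + 2 * w * (√3 * b) := by ring
    nlinarith
  rcases Nat.lt_or_ge 5041 n with hn' | hn'
  · refine (entryArea_le_large hm hm' hn').trans (le_trans ?_ hloss)
    have : (0 : ℝ) ≤ 0.1547 * (w * u) + b / 2 := by positivity
    nlinarith
  refine (entryArea_mono hm hn' hmn).trans ?_
  have hn1 : 1 ≤ n := by omega
  by_cases hc : 46512400 * (w * (u + b)) ≤ (1547 * (w * u) + 5000 * b) ^ 2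
  · exact (entryArea_le_of_loss hn1 hn' (by omega) hc).trans hloss
  rcases Nat.lt_or_ge u 2 with hu2 | hu2
  · obtain rfl : u = 1 := by omega
    have hb : w * (1 + b) ≤ 5041 + (1 + b) / 2 := by
      have : (b + 1) / 2 = (1 + b) / 2 := by rw [add_comm]
      omega
    have h1 := (pair_beats hw (by omega : 1 ≤ 1 + b) hb (by simpa using hc)).1
    have hnn : w * (1 + b) - (1 + b) / 2 = n := by
      rw [add_comm 1 b] at hn ⊢
      omega
    rw [hnn, show 1 + b - 1 = b by omega] at h1
    have h2 := entryArea_le_of_beats hn1 hn' ?_ h1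
    · refine h2.trans (le_of_eq ?_)
      push_cast
      ring
    · nlinarith [Nat.div_le_self (1 + b) 2]
  · obtain ⟨h1, h2, h4⟩ := hybrid_beats hw hu2 hc
    rw [show w * (u + b) - (b + 1) / 2 = n by omega] at h1
    have h5 := entryArea_le_of_beats hn1 hn' (by nlinarith) h1
    refine h5.trans (le_of_eq ?_)
    push_cast
    ring

/-- The table is minimal among the arrangements with full shifted rows. -/
theorem entryArea_le_full {m w u b : ℕ} (hm : 1 ≤ m) (hm' : m ≤ 5001) (hw : 1 ≤ w) (hu : 1 ≤ u)
    (h : m ≤ w * (u + b)) :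
    entryArea (entry m) ≤ (2 * w + 1) * (2 * u + √3 * b) := by
  obtain ⟨h3, h3'⟩ := sqrt_three_bounds
  have hs := sqrt_three_sq
  obtain ⟨r, hr⟩ : ∃ r, u + b = 1 + r := ⟨u + b - 1, by omega⟩
  rw [hr] at h
  have hrr : (u + b : ℝ) = 1 + r := by exact_mod_cast hr
  have hu' : (1 : ℝ) ≤ u := by exact_mod_cast hu
  have hw' : (1 : ℝ) ≤ w := by exact_mod_cast hw
  -- When shifted rows are full, replacing a stacked step by a nested one keeps the number of sites
  -- and lowers the rectangle, so a single unit u = 1 is the worst case.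
  have hred : (2 * w + 1 : ℝ) * (2 + √3 * r) ≤ (2 * w + 1) * (2 * u + √3 * b) := by
    apply mul_le_mul_of_nonneg_left _ (by positivity)
    nlinarith
  refine le_trans ?_ hred
  have hr0 : (0 : ℝ) ≤ r := r.cast_nonneg
  have hloss : 2 * √3 * ((w * (1 + r) : ℕ) + (0.1547 * (w * (1 : ℕ)) + r / 2)) ≤
      (2 * w + 1) * (2 + √3 * r) := by
    push_cast
    nlinarith
  rcases Nat.lt_or_ge 5041 (w * (1 + r)) with hn' | hn'
  · refine (entryArea_le_large hm hm' hn').trans (le_trans ?_ hloss)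
    have : (0 : ℝ) ≤ 0.1547 * (w * (1 : ℕ)) + r / 2 := by positivity
    nlinarith
  have hn1 : 1 ≤ w * (1 + r) := by omega
  refine (entryArea_mono hm hn' h).trans ?_
  by_cases hc : 46512400 * (w * (1 + r)) ≤ (1547 * (w * 1) + 5000 * r) ^ 2
  · exact (entryArea_le_of_loss hn1 hn' le_rfl hc).trans hloss
  have h1 := (pair_beats hw (by omega : 1 ≤ 1 + r) (by omega) (by simpa using hc)).2
  rw [show 1 + r - 1 = r by omega] at h1
  refine (entryArea_le_of_beats hn1 hn' (by nlinarith) h1).trans (le_of_eq ?_)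
  push_cast
  ring

/-! ### Sizes of the packings in the search class -/

theorem sites_card {w : ℕ} (hw : 0 < w) (r : ℕ) (sh : ℕ → Bool) (dep : Bool) :
    (sites w r sh dep).card +
      (if dep = true then ((Finset.range r).filter fun i => sh i = true).card else 0) = w * r := by
  have h4 : (sites w r sh dep).card =
      ∑ i ∈ Finset.range r, (if dep = true ∧ sh i = true then w - 1 else w) := by
    unfold sites
    rw [Finset.card_filter, Finset.sum_product]
    refine Finset.sum_congr rfl fun i _ => ?_
    rw [← Finset.card_filter]
    have : (Finset.range w).filter (fun j => j < if dep = true ∧ sh i = true then w - 1 else w) =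
        Finset.range (if dep = true ∧ sh i = true then w - 1 else w) := by
      ext j
      simp only [Finset.mem_filter, Finset.mem_range]
      split_ifs <;> omega
    simp [this]
  rw [h4, Finset.card_filter]
  cases dep
  · simp [mul_comm]
  · simp only [true_and, if_true]
    rw [← Finset.sum_add_distrib, Finset.sum_congr rfl (g := fun _ => w)]
    · simp [mul_comm]
    · intro i _
      split_ifs <;> omega

/-- A nested step has exactly one shifted row next to it, and a row takes part in at most two steps.
Hence b nested steps cost a depleted arrangement at least ⌈b / 2⌉ sites. -/
theorem card_filter_ne_succ_le (sh : ℕ → Bool) (r : ℕ) :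
    ((Finset.range (r - 1)).filter fun i => sh i ≠ sh (i + 1)).card ≤
      2 * ((Finset.range r).filter fun i => sh i = true).card := by
  obtain _ | r := r
  · simp
  rw [Nat.add_sub_cancel, Finset.card_filter, Finset.card_filter]
  have h1 := Finset.sum_range_succ (fun i => if sh i = true then 1 else 0) r
  have h2 := Finset.sum_range_succ' (fun i => if sh i = true then 1 else 0) r
  have h3 : ∑ i ∈ Finset.range r, (if sh i ≠ sh (i + 1) then 1 else 0) ≤
      ∑ i ∈ Finset.range r,
        ((if sh i = true then 1 else 0) + (if sh (i + 1) = true then 1 else 0)) := by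
    refine Finset.sum_le_sum fun i _ => ?_
    cases sh i <;> cases sh (i + 1) <;> simp
  rw [Finset.sum_add_distrib] at h3
  omega

namespace SearchPacking

variable (P : SearchPacking)

theorem rows_pos : 0 < P.rows := by
  obtain ⟨i, hi, -⟩ := P.exists_unshifted
  exact (Nat.zero_le i).trans_lt (Finset.mem_range.1 hi)

theorem n_add_d : P.n + P.d = (sites P.w P.rows P.shifted P.depleted).card :=
  Finset.card_sdiff_add_card_eq_card P.vacant_subset

/-- The number of nested steps. -/
def nested : ℕ := ((Finset.range (P.rows - 1)).filter fun i => P.shifted i ≠ P.shifted (i + 1)).card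

theorem nested_lt_rows : P.nested < P.rows := by
  have h := Finset.card_filter_le (Finset.range (P.rows - 1))
    fun i => P.shifted i ≠ P.shifted (i + 1)
  rw [Finset.card_range] at h
  have := P.rows_pos
  unfold nested
  omega

theorem height_eq : P.height = 2 * ((P.rows - P.nested : ℕ) : ℝ) + √3 * P.nested := by
  have h1 : ∑ i ∈ Finset.range (P.rows - 1), P.step i =
      ∑ i ∈ Finset.range (P.rows - 1),
        (2 + (√3 - 2) * (if P.shifted i ≠ P.shifted (i + 1) then 1 else 0)) := by
    refine Finset.sum_congr rfl fun i _ => ?_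
    unfold step
    by_cases h : P.shifted i = P.shifted (i + 1) <;> simp [h]
  have h2 : (P.nested : ℝ) =
      ∑ i ∈ Finset.range (P.rows - 1), (if P.shifted i ≠ P.shifted (i + 1) then 1 else 0) := by
    unfold nested
    rw [Finset.card_filter]
    push_cast
    rfl
  have h3 := P.nested_lt_rows
  unfold height
  rw [h1, Finset.sum_add_distrib, ← Finset.mul_sum, ← h2, Finset.sum_const, Finset.card_range,
    Nat.cast_sub h3.le, nsmul_eq_mul, Nat.cast_sub (by omega)]
  push_cast
  ring

/-- The table is minimal in the search class. -/
theorem entryArea_le_area {m : ℕ} (hm : 1 ≤ m) (hm' : m ≤ 5001) (h : m ≤ P.n + P.d) :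
    entryArea (entry m) ≤ P.area := by
  have h1 := P.nested_lt_rows
  have h2 := sites_card P.w_pos P.rows P.shifted P.depleted
  have h3 := card_filter_ne_succ_le P.shifted P.rows
  have h4 : P.rows - P.nested + P.nested = P.rows := by omega
  rw [← n_add_d] at h2
  have h0 : ((Finset.range P.rows).filter fun i => P.shifted i = true).card = 0 ∨ P.Alternates := by
    by_cases ha : P.Alternates
    · exact Or.inr ha
    · left
      rw [Finset.card_eq_zero, Finset.filter_eq_empty_iff]
      intro i hi hs
      exact ha ⟨i, hi, hs⟩
  unfold area width
  rw [height_eq]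
  split_ifs with hd
  · refine entryArea_le_full hm hm' P.w_pos (by omega) ?_
    rw [h4]
    omega
  · rw [add_zero]
    refine entryArea_le_depleted hm hm' P.w_pos (by omega) ?_
    rw [h4]
    have h5 : P.nested ≤ 2 * ((Finset.range P.rows).filter fun i => P.shifted i = true).card := h3
    -- Without depletion this branch has no shifted row at all, hence no nested step, and the
    -- depleted bound applies with b = 0.
    cases hdep : P.depleted
    · simp only [hdep, true_and] at hd
      have := h0.resolve_right hd
      simp only [hdep] at h2
      simp only [Bool.false_eq_true, if_false] at h2
      omega
    · simp only [hdep, if_true] at h2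
      omega

theorem step_pos (i : ℕ) : 0 < P.step i := by
  unfold step
  split_ifs <;> positivity

theorem center_injective : Function.Injective P.center := by
  have hmono : StrictMono fun k : ℕ => ∑ i ∈ Finset.range k, P.step i :=
    strictMono_nat_of_lt_succ fun k => by
      rw [Finset.sum_range_succ]
      linarith [P.step_pos k]
  rintro ⟨i, j⟩ ⟨i', j'⟩ h
  have h0 : P.center (i, j) 0 = P.center (i', j') 0 := by rw [h]
  have h1 : P.center (i, j) 1 = P.center (i', j') 1 := by rw [h]
  simp only [center, PiLp.toLp_apply, Matrix.cons_val_zero, Matrix.cons_val_one] at h0 h1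
  obtain rfl : i = i' := hmono.injective (by simpa using h1)
  have : (j : ℝ) = j' := by linarith
  rw [Nat.cast_inj.1 this]

theorem centers_card : P.centers.card = P.n := by
  classical
  unfold centers n
  exact Finset.card_image_of_injective _ P.center_injective

end SearchPacking

/-! ### Attaining the table, and the irregular values -/

theorem card_filter_odd (r : ℕ) :
    ((Finset.range r).filter fun i => decide (i % 2 = 1) = true).card = r / 2 := by
  induction r with
  | zero => simp
  | succ r ih =>
    rw [Finset.range_add_one, Finset.filter_insert]
    split_ifs with h
    · rw [Finset.card_insert_of_notMem (by simp), ih]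
      simp only [decide_eq_true_eq] at h
      omega
    · rw [ih]
      simp only [decide_eq_true_eq] at h
      omega

theorem hexCap_add {w r e : ℕ} (hw : 0 < w) :
    hexCap w r e + (if e = 0 then r / 2 else 0) = w * r := by
  have : r ≤ w * r := Nat.le_mul_of_pos_left r hw
  unfold hexCap
  by_cases he : e = 0
  · subst he
    change w * r - r / 2 + r / 2 = w * r
    omega
  · have : Nat.beq e 0 = false := by
      rw [← Bool.not_eq_true, Nat.beq_eq]
      exact he
    simp [this, he]

/-- Alternating rows with `n` circles. -/
theorem exists_hexPacking {w r e n : ℕ} (hw : 0 < w) (hr : 0 < r) (he : e < 2)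
    (hre : 2 ≤ r ∨ e = 0) (hn : n ≤ hexCap w r e) :
    ∃ P : SearchPacking, P.n = n ∧ P.d = hexCap w r e - n ∧
      P.area = ((2 * w + e : ℕ) : ℝ) * (2 + √3 * ((r - 1 : ℕ) : ℝ)) := by
  have hs := sites_card hw r (fun i => decide (i % 2 = 1)) (decide (e = 0))
  have hc := hexCap_add (r := r) (e := e) hw
  simp only [decide_eq_true_eq] at hs
  have hodd := card_filter_odd r
  simp only [decide_eq_true_eq] at hodd
  rw [hodd] at hs
  have hcard : (sites w r (fun i => decide (i % 2 = 1)) (decide (e = 0))).card = hexCap w r e := by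
    omega
  obtain ⟨V, hV, hVc⟩ := Finset.exists_subset_card_eq
    (s := sites w r (fun i => decide (i % 2 = 1)) (decide (e = 0))) (n := hexCap w r e - n)
    (by omega)
  let P : SearchPacking :=
    { w := w, rows := r, shifted := fun i => decide (i % 2 = 1), depleted := decide (e = 0),
      vacant := V, w_pos := hw, exists_unshifted := ⟨0, Finset.mem_range.2 hr, rfl⟩,
      vacant_subset := hV }
  have hd : P.d = hexCap w r e - n := hVc
  have hnd : P.n + P.d = hexCap w r e := by rw [P.n_add_d]; exact hcard
  refine ⟨P, by omega, hd, ?_⟩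
  have hnest : P.nested = r - 1 := by
    change ((Finset.range (r - 1)).filter fun i =>
      decide (i % 2 = 1) ≠ decide ((i + 1) % 2 = 1)).card = r - 1
    rw [Finset.filter_true_of_mem, Finset.card_range]
    intro i _ h
    rw [decide_eq_decide] at h
    omega
  have hh : P.height = 2 + √3 * ((r - 1 : ℕ) : ℝ) := by
    rw [P.height_eq, hnest]
    change 2 * ((r - (r - 1) : ℕ) : ℝ) + _ = _
    rw [show r - (r - 1) = 1 by omega]
    norm_num
  have hwd : P.width = ((2 * w + e : ℕ) : ℝ) := by
    have halt : P.Alternates ↔ 2 ≤ r := by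
      constructor
      · rintro ⟨i, hi, hs⟩
        have hi : i < r := Finset.mem_range.1 hi
        have hs : decide (i % 2 = 1) = true := hs
        rw [decide_eq_true_eq] at hs
        omega
      · intro h
        exact ⟨1, Finset.mem_range.2 h, rfl⟩
    unfold SearchPacking.width
    change 2 * (w : ℝ) + (if decide (e = 0) = false ∧ P.Alternates then 1 else 0) = _
    simp only [halt, decide_eq_false_iff_not]
    split_ifs with h
    · obtain rfl : e = 1 := by omega
      push_cast
      ring
    · obtain rfl : e = 0 := by omega
      push_cast
      ring
  unfold SearchPacking.area
  rw [hh, hwd]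

theorem entryArea_eq (t : ℕ) :
    entryArea t = ((2 * entryW t + entryE t : ℕ) : ℝ) * (2 + √3 * ((entryR t - 1 : ℕ) : ℝ)) := by
  simp only [entryArea, entryP, entryQ, hexP, hexQ, entryU, Nat.add_eq, Nat.mul_eq, Nat.sub_eq]
  push_cast
  ring

/-- The table is attained in the search class. -/
theorem exists_entryPacking {m n : ℕ} (h1 : 1 ≤ m) (h2 : m ≤ 5041)
    (hn : n ≤ entryCap (entry m)) :
    ∃ P : SearchPacking, P.n = n ∧ P.d = entryCap (entry m) - n ∧
      P.area = entryArea (entry m) := by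
  obtain ⟨hw, hr, hc, -, he, -⟩ := entryOk_spec h1 h2
  obtain ⟨P, hP1, hP2, hP3⟩ := exists_hexPacking hw hr (e := entryE (entry m))
    (Nat.mod_lt _ (by norm_num)) he (n := n) hn
  exact ⟨P, hP1, hP2, by rw [hP3, entryArea_eq]⟩

/-- A best packing with a vacancy has at least n + 1 sites, so its area is at least that of entry n
+ 1; if entry n were strictly smaller, it would hold n circles in less area. Conversely, an entry
shared by n and n + 1 has a site to spare when it carries n circles, and it is best. -/
theorem mem_irregularValues_iff (n : ℕ) :
    n ∈ irregularValues 5000 ↔ 1 ≤ n ∧ n ≤ 5000 ∧ isFlat n = true := by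
  constructor
  · rintro ⟨h1, h2, P, rfl, hbest, hd⟩
    refine ⟨h1, h2, ?_⟩
    by_contra hf
    rw [Bool.not_eq_true] at hf
    have hlt := entryArea_lt_succ h1 (by omega) hf
    have hle := P.entryArea_le_area (m := P.n + 1) (by omega) (by omega) (by omega)
    obtain ⟨Q, hQ1, -, hQ3⟩ := exists_entryPacking h1 (by omega)
      (entryOk_spec h1 (by omega)).2.2.1
    have := hbest Q hQ1
    linarith
  · rintro ⟨h1, h2, hf⟩
    have he := (isFlat_iff n).1 hf
    obtain ⟨Q, hQ1, hQ2, hQ3⟩ := exists_entryPacking (m := n) (n := n) h1 (by omega)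
      (entryOk_spec h1 (by omega)).2.2.1
    refine ⟨h1, h2, Q, hQ1, fun Q' hQ' => ?_, ?_⟩
    · rw [hQ3]
      exact Q'.entryArea_le_area h1 (by omega) (by omega)
    · have := (entryOk_spec (n := n + 1) (by omega) (by omega)).2.2.1
      rw [← he] at this
      omega

theorem irregular_spec {n : ℕ} (h : n ∈ irregularValues 5000) :
    49 ≤ n ∧ n ≤ 5000 ∧ 2 ≤ entryW (entry n) ∧ 2 ≤ entryR (entry n) ∧
      n + 1 ≤ entryCap (entry n) := by
  obtain ⟨h1, h2, hf⟩ := (mem_irregularValues_iff n).1 h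
  have h3 := (allBelow_iff _ _).1 isFlat_all (n - 1) (by omega)
  have hn : Nat.succ (n - 1) = n := by omega
  simp only [hn, hf, Bool.not_true, Bool.false_or, Bool.and_eq_true, Nat.ble_eq] at h3
  refine ⟨h3.1, h2, h3.2.1, h3.2.2, ?_⟩
  have := (entryOk_spec (n := n + 1) (by omega) (by omega)).2.2.1
  rwa [← (isFlat_iff n).1 hf] at this

theorem irregularValues_ncard : (irregularValues 5000).ncard = 1495 := by
  have h := countBelow_isFlat
  rw [Nat.beq_eq, countBelow_eq] at h
  rw [← h]
  have : irregularValues 5000 =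
      Nat.succ '' ↑((Finset.range 5000).filter fun k => isFlat (Nat.succ k) = true) := by
    ext n
    rw [mem_irregularValues_iff]
    simp only [Finset.coe_filter, Finset.mem_range, Set.mem_image, Set.mem_ofPred_eq]
    constructor
    · rintro ⟨h1, h2, h3⟩
      have hn : Nat.succ (n - 1) = n := by omega
      exact ⟨n - 1, ⟨by omega, by rw [hn]; exact h3⟩, hn⟩
    · rintro ⟨k, ⟨hk, h3⟩, rfl⟩
      exact ⟨by omega, by omega, h3⟩
  rw [this, Set.ncard_image_of_injective _ Nat.succ_injective, Set.ncard_coe_finset]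

theorem irregularValues_small :
    {n ∈ irregularValues 5000 | n ≤ 107} = {49, 61, 79, 97, 107} := by
  ext n
  simp only [Set.mem_ofPred_eq, Set.mem_insert_iff, Set.mem_singleton_iff, mem_irregularValues_iff]
  have h := fun k hk => (allBelow_iff _ _).1 isFlat_small k hk
  constructor
  · rintro ⟨⟨h1, -, h3⟩, h4⟩
    have h5 := h (n - 1) (by omega)
    rw [show Nat.succ (n - 1) = n by omega, h3] at h5
    simp [Nat.beq_eq] at h5
    omega
  · intro hn
    have h5 := h (n - 1) (by omega)
    rw [show Nat.succ (n - 1) = n by omega] at h5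
    refine ⟨⟨by omega, by omega, ?_⟩, by omega⟩
    rcases hn with rfl | rfl | rfl | rfl | rfl <;> simpa [Nat.beq] using h5

theorem irregularValues_greatest : IsGreatest (irregularValues 5000) 4999 := by
  have h := isFlat_last
  rw [Bool.and_eq_true, Bool.not_eq_true'] at h
  constructor
  · exact (mem_irregularValues_iff _).2 ⟨by norm_num, by norm_num, h.1⟩
  · intro n hn
    obtain ⟨h1, h2, h3⟩ := (mem_irregularValues_iff n).1 hn
    by_contra hlt
    obtain rfl : n = 5000 := by omega
    rw [h.2] at h3
    exact absurd h3 (by simp)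

/-! ### Using a vacancy to shrink the rectangle

A corner circle is missing. The circles left in the outermost zigzag column roll, one after the
other, around circles of the next column, and thereby leave the side of the rectangle. -/

theorem two_le_dist_iff (p q : Plane) :
    2 ≤ dist p q ↔ 4 ≤ (p 0 - q 0) ^ 2 + (p 1 - q 1) ^ 2 := by
  rw [EuclideanSpace.dist_eq, Fin.sum_univ_two, Real.dist_eq, Real.dist_eq, sq_abs, sq_abs,
    Real.le_sqrt' (by norm_num)]
  norm_num

/-- The vertical parts of the rolls, by distance from the vacancy. -/
def rollY : ℕ → ℝ
  | 0 => 1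
  | k + 1 => (2 - √(4 - rollY k ^ 2)) / 2

/-- The horizontal part of the radius vector after the roll. -/
def rollX (k : ℕ) : ℝ := √(4 - rollY k ^ 2)

/-- Each roll is half the horizontal displacement 2 - `rollX k` that the preceding one achieves.
This is well within the room available, and it stays positive, so the rolling never stops before the
other end of the column. -/
theorem rollY_mem (k : ℕ) : 0 < rollY k ∧ rollY k ≤ 1 := by
  induction k with
  | zero => simp [rollY]
  | succ k ih =>
    obtain ⟨h1, h2⟩ := ih
    have h3 : √(4 - rollY k ^ 2) < 2 := (Real.sqrt_lt' (by norm_num)).2 (by nlinarith)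
    have h4 : 0 ≤ √(4 - rollY k ^ 2) := Real.sqrt_nonneg _
    constructor <;> simp only [rollY] <;> linarith

theorem rollX_sq (k : ℕ) : rollX k ^ 2 + rollY k ^ 2 = 4 := by
  obtain ⟨h1, h2⟩ := rollY_mem k
  have : rollX k ^ 2 = 4 - rollY k ^ 2 := Real.sq_sqrt (by nlinarith)
  linarith

theorem rollX_mem (k : ℕ) : √3 ≤ rollX k ∧ rollX k < 2 ∧ 2 ≤ rollX k + rollY k := by
  obtain ⟨h1, h2⟩ := rollY_mem k
  have h3 : 0 ≤ rollX k := Real.sqrt_nonneg _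
  have h4 := rollX_sq k
  refine ⟨Real.sqrt_le_sqrt (by nlinarith), by nlinarith, by nlinarith⟩

theorem rollY_succ (k : ℕ) : rollY (k + 1) = (2 - rollX k) / 2 := rfl

/-- Abscissa of the rolled circle in row `i` of `r` rows. -/
def columnX (r i : ℕ) : ℝ :=
  -- With site (i, j) at (2 j + i % 2, √3 i), the circle in an even row rolls clockwise around site
  -- (i, 1), and the one in an odd row around site (i + 1, 1).
  if i % 2 = 0 then 2 - rollX ((r - 1 - i) / 2)
  else 2 - (rollX ((r - 2 - i) / 2) / 2 + √3 / 2 * rollY ((r - 2 - i) / 2))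

/-- Ordinate of the rolled circle in row `i` of `r` rows. -/
def columnY (r i : ℕ) : ℝ :=
  if i % 2 = 0 then √3 * i + rollY ((r - 1 - i) / 2)
  else √3 * (i + 1) - (√3 / 2 * rollX ((r - 2 - i) / 2) - rollY ((r - 2 - i) / 2) / 2)

theorem columnX_even {r i : ℕ} (h : i % 2 = 0) : columnX r i = 2 - rollX ((r - 1 - i) / 2) :=
  if_pos h

theorem columnY_even {r i : ℕ} (h : i % 2 = 0) :
    columnY r i = √3 * i + rollY ((r - 1 - i) / 2) := if_pos h

theorem columnX_odd {r i : ℕ} (h : i % 2 = 1) : columnX r i =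
    2 - (rollX ((r - 2 - i) / 2) / 2 + √3 / 2 * rollY ((r - 2 - i) / 2)) :=
  if_neg (by omega)

theorem columnY_odd {r i : ℕ} (h : i % 2 = 1) : columnY r i =
    √3 * (i + 1) - (√3 / 2 * rollX ((r - 2 - i) / 2) - rollY ((r - 2 - i) / 2) / 2) :=
  if_neg (by omega)

/-- The circles of even rows move right and those of odd rows move left; what counts is that all
abscissae end up strictly positive. -/
theorem columnX_mem (r i : ℕ) : 0 < columnX r i ∧ columnX r i ≤ 1 := by
  obtain ⟨h3, h3'⟩ := sqrt_three_bounds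
  rcases Nat.mod_two_eq_zero_or_one i with h | h
  · rw [columnX_even h]
    obtain ⟨h1, h2, -⟩ := rollX_mem ((r - 1 - i) / 2)
    constructor <;> linarith
  · rw [columnX_odd h]
    obtain ⟨h1, h2, h4⟩ := rollX_mem ((r - 2 - i) / 2)
    obtain ⟨h5, h6⟩ := rollY_mem ((r - 2 - i) / 2)
    constructor <;> nlinarith

/-- A roll lifts a circle by at most 1 < √3, so the column stays within the height left by the empty
top place. -/
theorem columnY_mem (r i : ℕ) : √3 * i < columnY r i ∧ columnY r i ≤ √3 * i + 1 := by
  obtain ⟨h3, h3'⟩ := sqrt_three_bounds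
  rcases Nat.mod_two_eq_zero_or_one i with h | h
  · rw [columnY_even h]
    obtain ⟨h5, h6⟩ := rollY_mem ((r - 1 - i) / 2)
    constructor <;> linarith
  · rw [columnY_odd h]
    obtain ⟨h1, h2, h4⟩ := rollX_mem ((r - 2 - i) / 2)
    obtain ⟨h5, h6⟩ := rollY_mem ((r - 2 - i) / 2)
    constructor <;> nlinarith [sqrt_three_sq]

theorem four_le_of_abs_le {x y : ℝ} (h : 2 ≤ x ∨ x ≤ -2) : 4 ≤ x ^ 2 + y ^ 2 := by
  rcases h with h | h <;> nlinarith [sq_nonneg y]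

/-- Neighbours in the rolled column, the upper one in a shifted row. -/
theorem column_up {r i : ℕ} (h : i % 2 = 0) (hr : i + 3 ≤ r) :
    4 ≤ (columnX r i - columnX r (i + 1)) ^ 2 + (columnY r i - columnY r (i + 1)) ^ 2 := by
  obtain ⟨h3, h3'⟩ := sqrt_three_bounds
  have hs := sqrt_three_sq
  rw [columnX_even h, columnY_even h, columnX_odd (by omega), columnY_odd (by omega)]
  have e1 : (r - 1 - i) / 2 = (r - 2 - (i + 1)) / 2 + 1 := by omega
  rw [e1]
  set k := (r - 2 - (i + 1)) / 2
  obtain ⟨h1, h2, h4⟩ := rollX_mem k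
  obtain ⟨h5, h6⟩ := rollY_mem k
  obtain ⟨h7, h8, h9⟩ := rollX_mem (k + 1)
  obtain ⟨h10, h11⟩ := rollY_mem (k + 1)
  have hq := rollY_succ k
  have hsq := rollX_sq k
  have hsq' := rollX_sq (k + 1)
  set p' := rollX k
  set q' := rollY k
  set p := rollX (k + 1)
  set q := rollY (k + 1)
  push_cast
  have expand : (2 - p - (2 - (p' / 2 + √3 / 2 * q'))) ^ 2 +
      (√3 * i + q - (√3 * (i + 1 + 1) - (√3 / 2 * p' - q' / 2))) ^ 2 =
      20 - 6 * p' + 2 * √3 * q' - 4 * √3 * q - p * p' - √3 * (p * q') + √3 * (q * p') - q * q' := by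
    linear_combination hsq + hsq' + (4 - 2 * p' + q' ^ 2 / 4 + p' ^ 2 / 4) * hs
  rw [expand]
  -- These estimates leave 20 - 8 p' - (4√3 + 1) q, which is 4 + (15 - 4√3) q because p' = 2 - 2 q.
  have a1 : p * p' ≤ 2 * p' := by nlinarith
  have a2 : √3 * (p * q') ≤ √3 * (2 * q') := by
    apply mul_le_mul_of_nonneg_left _ (by linarith)
    nlinarith
  have a3 : 0 ≤ √3 * (q * p') :=
    mul_nonneg (by linarith) (mul_nonneg h10.le (by linarith))
  have a4 : q * q' ≤ q := by nlinarith
  have a5 : √3 * q ≤ 1.75 * q := by nlinarith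
  nlinarith

/-- Neighbours in the rolled column, the lower one in a shifted row. -/
theorem column_down {r i : ℕ} (h : i % 2 = 1) :
    4 ≤ (columnX r i - columnX r (i + 1)) ^ 2 + (columnY r i - columnY r (i + 1)) ^ 2 := by
  have hs := sqrt_three_sq
  rw [columnX_odd h, columnY_odd h, columnX_even (by omega), columnY_even (by omega)]
  have e1 : r - 1 - (i + 1) = r - 2 - i := by omega
  rw [e1]
  have hsq := rollX_sq ((r - 2 - i) / 2)
  set p := rollX ((r - 2 - i) / 2)
  set q := rollY ((r - 2 - i) / 2)
  push_cast
  -- Both circles roll around the same site (i + 1, 1) by the same angle, so the three centres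
  -- remain an equilateral triangle of side 2.
  apply le_of_eq
  linear_combination -hsq - (q ^ 2 / 4 + p ^ 2 / 4) * hs

theorem column_column {r i k : ℕ} (hik : i < k) (hk : k + 2 ≤ r) :
    4 ≤ (columnX r i - columnX r k) ^ 2 + (columnY r i - columnY r k) ^ 2 := by
  obtain ⟨h3, h3'⟩ := sqrt_three_bounds
  obtain rfl | hlt : k = i + 1 ∨ i + 2 ≤ k := by omega
  · rcases Nat.mod_two_eq_zero_or_one i with h | h
    · exact column_up h (by omega)
    · exact column_down h
  · have h1 := (columnY_mem r i).2
    have h2 := (columnY_mem r k).1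
    have hc : (i : ℝ) + 2 ≤ k := by exact_mod_cast hlt
    rw [add_comm]
    exact four_le_of_abs_le (Or.inr (by nlinarith))

/-- Only site 1 of an even row at most one row away needs a computation; for every other site one
coordinate difference is already at least 2. -/
theorem column_site {r i k l : ℕ} (hl : 1 ≤ l) :
    4 ≤ (columnX r i - (2 * l + (k % 2 : ℕ))) ^ 2 + (columnY r i - √3 * k) ^ 2 := by
  obtain ⟨h3, h3'⟩ := sqrt_three_bounds
  have hs := sqrt_three_sq
  have hl' : (1 : ℝ) ≤ l := by exact_mod_cast hl
  obtain ⟨hx, hx'⟩ := columnX_mem r i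
  obtain ⟨hy, hy'⟩ := columnY_mem r i
  have hm : (0 : ℝ) ≤ (k % 2 : ℕ) := Nat.cast_nonneg _
  by_cases hfar : 3 ≤ 2 * l + k % 2
  · have : (3 : ℝ) ≤ 2 * l + (k % 2 : ℕ) := by exact_mod_cast hfar
    exact four_le_of_abs_le (Or.inr (by linarith))
  obtain rfl : l = 1 := by omega
  have hk : k % 2 = 0 := by omega
  rw [hk]
  norm_num
  by_cases hup : i + 2 ≤ k
  · have hc : (i : ℝ) + 2 ≤ k := by exact_mod_cast hup
    rw [add_comm]
    exact four_le_of_abs_le (Or.inr (by nlinarith))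
  by_cases hdown : k + 2 ≤ i
  · have hc : (k : ℝ) + 2 ≤ i := by exact_mod_cast hdown
    rw [add_comm]
    exact four_le_of_abs_le (Or.inl (by nlinarith))
  rcases Nat.mod_two_eq_zero_or_one i with h | h
  · obtain rfl : i = k := by omega
    rw [columnX_even h, columnY_even h]
    nlinarith [rollX_sq ((r - 1 - i) / 2)]
  · rw [columnX_odd h, columnY_odd h]
    have hsq := rollX_sq ((r - 2 - i) / 2)
    obtain ⟨h1, h2, h4⟩ := rollX_mem ((r - 2 - i) / 2)
    obtain ⟨h5, h6⟩ := rollY_mem ((r - 2 - i) / 2)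
    set p := rollX ((r - 2 - i) / 2)
    set q := rollY ((r - 2 - i) / 2)
    obtain rfl | rfl : k = i + 1 ∨ i = k + 1 := by omega
    · push_cast
      apply le_of_eq
      linear_combination -hsq - (q ^ 2 / 4 + p ^ 2 / 4) * hs
    · push_cast
      have e : (2 - (p / 2 + √3 / 2 * q) - 2) ^ 2 +
          (√3 * (k + 1 + 1) - (√3 / 2 * p - q / 2) - √3 * k) ^ 2 =
          16 - 6 * p + 2 * √3 * q := by
        linear_combination hsq + (q ^ 2 / 4 + p ^ 2 / 4 + 4 - 2 * p) * hs
      rw [e]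
      nlinarith [mul_pos h5 (by linarith : (0 : ℝ) < √3)]

theorem site_site {i j k l : ℕ} (h : (i, j) ≠ (k, l)) :
    4 ≤ (2 * j + (i % 2 : ℕ) - (2 * l + (k % 2 : ℕ)) : ℝ) ^ 2 + (√3 * i - √3 * k) ^ 2 := by
  have key : (4 : ℤ) ≤ (2 * j + (i % 2 : ℕ) - (2 * l + (k % 2 : ℕ))) ^ 2 + 3 * ((i : ℤ) - k) ^ 2 := by
    have h2 : ∀ z : ℤ, (2 ≤ z ∨ z ≤ -2) → 4 ≤ z ^ 2 := fun z hz => by rcases hz with hz | hz <;> nlinarith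
    have h1 : ∀ z : ℤ, (1 ≤ z ∨ z ≤ -1) → 1 ≤ z ^ 2 := fun z hz => by rcases hz with hz | hz <;> nlinarith
    by_cases hik : i = k
    · subst hik
      have hjl : j ≠ l := fun e => h (by rw [e])
      have := h2 (2 * j + (i % 2 : ℕ) - (2 * l + (i % 2 : ℕ))) (by omega)
      nlinarith
    · by_cases hnear : (i : ℤ) - k = 1 ∨ (i : ℤ) - k = -1
      · have ha := h1 (2 * j + (i % 2 : ℕ) - (2 * l + (k % 2 : ℕ))) (by omega)
        have hb := h1 ((i : ℤ) - k) (by omega)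
        linarith
      · have hb := h2 ((i : ℤ) - k) (by omega)
        nlinarith [sq_nonneg (2 * j + (i % 2 : ℕ) - (2 * l + (k % 2 : ℕ)) : ℤ)]
  have e : (√3 * i - √3 * k) ^ 2 = 3 * ((i : ℝ) - k) ^ 2 := by
    linear_combination ((i : ℝ) - k) ^ 2 * sqrt_three_sq
  rw [e]
  exact_mod_cast key

/-- The new abscissa of the circle at a site. -/
def shrunkX (r : ℕ) (s : ℕ × ℕ) : ℝ :=
  if s.2 = 0 then columnX r s.1 else 2 * s.2 + (s.1 % 2 : ℕ)

/-- The new ordinate of the circle at a site. -/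
def shrunkY (r : ℕ) (s : ℕ × ℕ) : ℝ :=
  if s.2 = 0 then columnY r s.1 else √3 * s.1

theorem shrunk_separated {r : ℕ} {s t : ℕ × ℕ} (hs : s.2 = 0 → s.1 + 2 ≤ r)
    (ht : t.2 = 0 → t.1 + 2 ≤ r) (hst : s ≠ t) :
    4 ≤ (shrunkX r s - shrunkX r t) ^ 2 + (shrunkY r s - shrunkY r t) ^ 2 := by
  obtain ⟨i, j⟩ := s
  obtain ⟨k, l⟩ := t
  simp only [shrunkX, shrunkY] at *
  by_cases hj : j = 0 <;> by_cases hl : l = 0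
  · subst hj hl
    simp only [if_true]
    rcases lt_trichotomy i k with h | h | h
    · exact column_column h (ht rfl)
    · exact absurd (by rw [h]) hst
    · have := column_column h (hs rfl)
      nlinarith
  · simp only [hj, hl, if_true, if_false]
    exact column_site (by omega)
  · simp only [hj, hl, if_true, if_false]
    have := column_site (r := r) (i := k) (k := i) (l := j) (by omega)
    nlinarith
  · simp only [hj, hl, if_false]
    exact site_site hst

/-- Alternating rows with a vacancy can be rearranged in a smaller rectangle. -/
theorem exists_smaller {w r e n : ℕ} (hw : 2 ≤ w) (hr : 2 ≤ r) (he : e < 2)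
    (hn : n + 1 ≤ hexCap w r e) :
    ∃ (W H : ℝ) (C : Finset Plane), C.card = n ∧ IsPackingIn W H C ∧
      W * H < ((2 * w + e : ℕ) : ℝ) * (2 + √3 * ((r - 1 : ℕ) : ℝ)) := by
  classical
  obtain ⟨h3, h3'⟩ := sqrt_three_bounds
  have hs := sites_card (by omega : 0 < w) r (fun i => decide (i % 2 = 1)) (decide (e = 0))
  have hc := hexCap_add (w := w) (r := r) (e := e) (by omega)
  simp only [decide_eq_true_eq] at hs
  have hodd := card_filter_odd r
  simp only [decide_eq_true_eq] at hodd
  rw [hodd] at hs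
  set S := sites w r (fun i => decide (i % 2 = 1)) (decide (e = 0)) with hS
  -- The vacancies may be placed at will: one of them goes into the top left corner.
  obtain ⟨V, hV, hVc⟩ := Finset.exists_subset_card_eq (s := S.erase (r - 1, 0)) (n := n) (by
    have := Finset.pred_card_le_card_erase (s := S) (a := (r - 1, 0))
    omega)
  have hmem : ∀ s ∈ V, s.1 < r ∧ 2 * s.2 + s.1 % 2 + 2 ≤ 2 * w + e ∧ (s.2 = 0 → s.1 + 2 ≤ r) := by
    intro s hsV
    have h1 := hV hsV
    rw [Finset.mem_erase, hS, sites, Finset.mem_filter, Finset.mem_product, Finset.mem_range,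
      Finset.mem_range] at h1
    simp only [decide_eq_true_eq] at h1
    obtain ⟨h2, ⟨h4, h5⟩, h6⟩ := h1
    refine ⟨h4, ?_, fun h0 => ?_⟩
    · split_ifs at h6 <;> omega
    · by_contra hcon
      exact h2 (Prod.ext (by omega) h0)
  have hxpos : ∀ s ∈ V, 0 < shrunkX r s := by
    intro s _
    unfold shrunkX
    split_ifs with h
    · exact (columnX_mem r s.1).1
    · have : (1 : ℝ) ≤ s.2 := by exact_mod_cast Nat.one_le_iff_ne_zero.2 h
      positivity
  -- Finitely many positive abscissae have a positive minimum, by which the packing can be shifted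
  -- to the left.
  obtain ⟨ε, hε, hεV⟩ : ∃ ε : ℝ, 0 < ε ∧ ∀ s ∈ V, ε ≤ shrunkX r s := by
    rcases V.eq_empty_or_nonempty with rfl | hne
    · exact ⟨1, one_pos, by simp⟩
    · obtain ⟨s, hsV, hmin⟩ := V.exists_min_image (shrunkX r) hne
      exact ⟨shrunkX r s, hxpos s hsV, hmin⟩
  let f : ℕ × ℕ → Plane := fun s => !₂[1 + shrunkX r s - ε, 1 + shrunkY r s]
  have hf0 : ∀ s, f s 0 = 1 + shrunkX r s - ε := fun s => rfl
  have hf1 : ∀ s, f s 1 = 1 + shrunkY r s := fun s => rfl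
  have hsep : ∀ s ∈ V, ∀ t ∈ V, s ≠ t → 2 ≤ dist (f s) (f t) := by
    intro s hsV t htV hst
    rw [two_le_dist_iff, hf0, hf0, hf1, hf1]
    have := shrunk_separated (hmem s hsV).2.2 (hmem t htV).2.2 hst
    ring_nf at this ⊢
    exact this
  have hinj : Set.InjOn f V := by
    intro s hsV t htV hst
    by_contra hne
    have := hsep s hsV t htV hne
    rw [hst, dist_self] at this
    norm_num at this
  refine ⟨((2 * w + e : ℕ) : ℝ) - ε, 2 + √3 * ((r - 1 : ℕ) : ℝ), V.image f, ?_, ⟨?_, ?_⟩, ?_⟩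
  · rw [Finset.card_image_of_injOn hinj, hVc]
  · intro p hp
    obtain ⟨s, hsV, rfl⟩ := Finset.mem_image.1 hp
    obtain ⟨h1, h2, h4⟩ := hmem s hsV
    have h2' : (2 * s.2 + (s.1 % 2 : ℕ) + 2 : ℝ) ≤ ((2 * w + e : ℕ) : ℝ) := by exact_mod_cast h2
    have h5 := hεV s hsV
    rw [hf0, hf1, Nat.cast_sub (by omega), Nat.cast_one]
    have h1' : (s.1 : ℝ) + 1 ≤ r := by exact_mod_cast h1
    refine ⟨by linarith, ?_, ?_, ?_⟩
    · unfold shrunkX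
      split_ifs with h
      · have h6 := (columnX_mem r s.1).2
        have h7 : (3 : ℝ) ≤ ((2 * w + e : ℕ) : ℝ) := by exact_mod_cast (by omega)
        linarith
      · linarith
    · unfold shrunkY
      split_ifs with h
      · have h6 := (columnY_mem r s.1).1
        have : 0 ≤ √3 * (s.1 : ℝ) := by positivity
        linarith
      · have : 0 ≤ √3 * (s.1 : ℝ) := by positivity
        linarith
    · unfold shrunkY
      split_ifs with h
      · have h6 := (columnY_mem r s.1).2
        have h7 : (s.1 : ℝ) + 2 ≤ r := by exact_mod_cast h4 h
        nlinarith
      · nlinarith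
  · intro p hp q hq hpq
    obtain ⟨s, hsV, rfl⟩ := Finset.mem_image.1 hp
    obtain ⟨t, htV, rfl⟩ := Finset.mem_image.1 hq
    exact hsep s hsV t htV fun h => hpq (by rw [h])
  · have : (0 : ℝ) < 2 + √3 * ((r - 1 : ℕ) : ℝ) := by positivity
    nlinarith

theorem exists_smaller_of_irregular {n : ℕ} (h : n ∈ irregularValues 5000) :
    ∃ (W H : ℝ) (C : Finset Plane), C.card = n ∧ IsPackingIn W H C ∧
      W * H < entryArea (entry n) := by
  obtain ⟨-, -, h1, h2, h3⟩ := irregular_spec h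
  rw [entryArea_eq]
  exact exists_smaller h1 h2 (Nat.mod_lt _ (by norm_num)) h3

/-! ### Sums over equidistant rows -/

/-- A trapezoidal profile over `[0, T]` with ramps of length `q`. -/
def profile (T q t : ℝ) : ℝ := t - max (t - q) 0 - max (t - (T - q)) 0

/-- An antiderivative of the profile. -/
def profileInt (T q t : ℝ) : ℝ := (t ^ 2 - max (t - q) 0 ^ 2 - max (t - (T - q)) 0 ^ 2) / 2

/-- For the convex ramp the trapezoidal rule is at least the integral. -/
theorem ramp_step (x : ℝ) {h : ℝ} (hh : 0 ≤ h) :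
    max (x + h) 0 ^ 2 - max x 0 ^ 2 ≤ h * (max x 0 + max (x + h) 0) := by
  have h1 : max (x + h) 0 ≤ max x 0 + h := max_le (by linarith [le_max_left x 0])
    (by linarith [le_max_right x 0])
  have h2 : max x 0 ≤ max (x + h) 0 := max_le_max_right 0 (by linarith)
  have h3 : 0 ≤ max x 0 := le_max_right x 0
  nlinarith

/-- The profile is concave, so the trapezoidal rule stays below its integral. -/
theorem profileInt_step (T q t : ℝ) {h : ℝ} (hh : 0 ≤ h) :
    h * (profile T q t + profile T q (t + h)) / 2 ≤ profileInt T q (t + h) - profileInt T q t := by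
  have h1 := ramp_step (t - q) hh
  have h2 := ramp_step (t - (T - q)) hh
  rw [show t - q + h = t + h - q by ring] at h1
  rw [show t - (T - q) + h = t + h - (T - q) by ring] at h2
  unfold profile profileInt
  nlinarith

theorem sum_profile_le (T q t : ℝ) {h : ℝ} (hh : 0 < h) (m : ℕ) :
    ∑ i ∈ Finset.range (m + 1), profile T q (t + h * i) ≤
      (profileInt T q (t + h * m) - profileInt T q t) / h +
        (profile T q t + profile T q (t + h * m)) / 2 := by
  induction m with
  | zero => simp
  | succ m ih =>
    rw [Finset.sum_range_succ]
    have h1 := profileInt_step T q (t + h * m) hh.le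
    rw [show t + h * m + h = t + h * ((m + 1 : ℕ) : ℝ) by push_cast; ring] at h1
    have h2 : (profile T q (t + h * m) + profile T q (t + h * ((m + 1 : ℕ) : ℝ))) / 2 ≤
        (profileInt T q (t + h * ((m + 1 : ℕ) : ℝ)) - profileInt T q (t + h * m)) / h := by
      rw [le_div_iff₀ hh]
      linarith
    rw [sub_div] at h2 ih ⊢
    linarith

section profile

variable {T q t : ℝ}

theorem profile_of_le (h2q : 2 * q ≤ T) (h : t ≤ q) : profile T q t = t := by
  unfold profile
  rw [max_eq_right (by linarith), max_eq_right (by linarith)]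
  ring

theorem profile_of_mem (h1 : q ≤ t) (h2 : t ≤ T - q) : profile T q t = q := by
  unfold profile
  rw [max_eq_left (by linarith), max_eq_right (by linarith)]
  ring

theorem profile_of_ge (h2q : 2 * q ≤ T) (h : T - q ≤ t) : profile T q t = T - t := by
  unfold profile
  rw [max_eq_left (by linarith), max_eq_left (by linarith)]
  ring

theorem profile_cases (h2q : 2 * q ≤ T) :
    (t ≤ q ∧ profile T q t = t) ∨ (q ≤ t ∧ t ≤ T - q ∧ profile T q t = q) ∨
      (T - q ≤ t ∧ profile T q t = T - t) := by
  rcases le_total t q with h | h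
  · exact Or.inl ⟨h, profile_of_le h2q h⟩
  rcases le_total t (T - q) with h' | h'
  · exact Or.inr (Or.inl ⟨h, h', profile_of_mem h h'⟩)
  · exact Or.inr (Or.inr ⟨h', profile_of_ge h2q h'⟩)

theorem profile_le_min (h2q : 2 * q ≤ T) :
    profile T q t ≤ t ∧ profile T q t ≤ q ∧ profile T q t ≤ T - t := by
  rcases profile_cases (t := t) h2q with ⟨h, e⟩ | ⟨h, h', e⟩ | ⟨h, e⟩ <;> rw [e] <;>
    refine ⟨?_, ?_, ?_⟩ <;> linarith

theorem le_profile (h2q : 2 * q ≤ T) {x : ℝ} (h1 : x ≤ t) (h2 : x ≤ q) (h3 : x ≤ T - t) :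
    x ≤ profile T q t := by
  rcases profile_cases (t := t) h2q with ⟨h, e⟩ | ⟨h, h', e⟩ | ⟨h, e⟩ <;> rw [e] <;> assumption

theorem profile_nonneg (hq : 0 ≤ q) (h2q : 2 * q ≤ T) (h0 : 0 ≤ t) (h1 : t ≤ T) :
    0 ≤ profile T q t := le_profile h2q h0 hq (by linarith)

/-- The profile has slope at most 1, so the region under it to the left of t contains a right
isosceles triangle whose legs are the value at t. The next lemma is the mirror image; q (T - q) is
the whole area. -/
theorem profileInt_left (hq : 0 ≤ q) (h2q : 2 * q ≤ T) (h0 : 0 ≤ t) (h1 : t ≤ T) :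
    profile T q t ^ 2 / 2 ≤ profileInt T q t := by
  have h2 := profile_nonneg hq h2q h0 h1
  unfold profile at h2
  unfold profile profileInt
  have h3 : 0 ≤ max (t - q) 0 := le_max_right _ _
  have h4 : 0 ≤ max (t - (T - q)) 0 := le_max_right _ _
  nlinarith [mul_nonneg h2 (add_nonneg h3 h4), mul_nonneg h3 h4]

theorem profileInt_right (hq : 0 ≤ q) (h2q : 2 * q ≤ T) (h0 : 0 ≤ t) :
    profile T q t ^ 2 / 2 ≤ q * (T - q) - profileInt T q t := by
  rcases profile_cases (t := t) h2q with ⟨h, e⟩ | ⟨h, h', e⟩ | ⟨h, e⟩ <;> rw [e] <;>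
    unfold profileInt
  · rw [max_eq_right (by linarith), max_eq_right (by linarith)]
    nlinarith
  · rw [max_eq_left (by linarith), max_eq_right (by linarith)]
    nlinarith
  · rw [max_eq_left (by linarith), max_eq_left (by linarith)]
    nlinarith

end profile

/-- The gain or loss that comes with the first or last row, of profile `e`, at distance at least
`e` from the end. -/
def endTerm (h e : ℝ) : ℝ := e / 2 - e ^ 2 / (2 * h)

theorem sum_profile_le_ends {T q t h : ℝ} (hh : 0 < h) (hq : 0 ≤ q) (h2q : 2 * q ≤ T)
    (h0 : 0 ≤ t) {m : ℕ} (hm : t + h * m ≤ T) :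
    ∑ i ∈ Finset.range (m + 1), profile T q (t + h * i) ≤
      q * (T - q) / h + endTerm h (profile T q t) + endTerm h (profile T q (t + h * m)) := by
  have hhm : 0 ≤ h * m := by positivity
  have h1 := sum_profile_le T q t hh m
  have h2 := profileInt_left (t := t) hq h2q h0 (by linarith)
  have h3 := profileInt_right (t := t + h * m) hq h2q (by linarith)
  have h4 : (profileInt T q (t + h * m) - profileInt T q t) / h ≤
      (q * (T - q) - profile T q (t + h * m) ^ 2 / 2 - profile T q t ^ 2 / 2) / h :=
    div_le_div_of_nonneg_right (by linarith) hh.le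
  have h5 : (q * (T - q) - profile T q (t + h * m) ^ 2 / 2 - profile T q t ^ 2 / 2) / h =
      q * (T - q) / h - profile T q (t + h * m) ^ 2 / (2 * h) - profile T q t ^ 2 / (2 * h) := by
    field_simp
  unfold endTerm
  linarith

theorem sum_le_of_pairs {γ : ℝ} (hγ : 0 ≤ γ) (m : ℕ) : ∀ g : ℕ → ℝ, (∀ i < m, g i ≤ γ) →
    (∀ i, i + 1 < m → g i + g (i + 1) ≤ 0) → ∑ i ∈ Finset.range m, g i ≤ γ := by
  induction m using Nat.strong_induction_on with
  | _ m ih =>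
    intro g h1 h2
    obtain _ | _ | m := m
    · simpa using hγ
    · simpa using h1 0 (by norm_num)
    · rw [Finset.sum_range_succ, Finset.sum_range_succ]
      have := ih m (by omega) g (fun i hi => h1 i (by omega)) (fun i hi => h2 i (by omega))
      have := h2 m (by omega)
      linarith

theorem sum_Ico_le {γ : ℝ} {a b : ℕ} (hab : a ≤ b) (g : ℕ → ℝ) (h : ∀ i < b, g i ≤ γ) :
    ∑ i ∈ Finset.Ico a b, g i ≤ γ * (b - a) := by
  have := Finset.sum_le_card_nsmul (Finset.Ico a b) g γ
    (fun i hi => h i (Finset.mem_Ico.1 hi).2)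
  rw [Nat.card_Ico, nsmul_eq_mul, Nat.cast_sub hab] at this
  linarith

/-- If consecutive rows on the plateau have a small sum, only the rows on the ramps count fully. -/
theorem sum_le_of_plateau {T q t h γ : ℝ} (hh : 0 < h) (hγ : 0 ≤ γ) (hq : 0 ≤ q)
    (ht : t < h) {m : ℕ} (hm : T < t + h * (m + 1))
    (g : ℕ → ℝ) (h1 : ∀ i ≤ m, g i ≤ γ)
    (h2 : ∀ i, i + 1 ≤ m → q ≤ t + h * i → t + h * (i + 1) ≤ T - q → g i + g (i + 1) ≤ 0) :
    ∑ i ∈ Finset.range (m + 1), g i ≤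
      γ * ((q - t) / h + (q - (T - (t + h * m))) / h + 3) := by
  -- Rows before A lie on the first ramp and rows from B on lie on the last one. Between them the
  -- rows cancel in pairs, up to one leftover; this one and the two roundings make up the 3.
  set A := min (m + 1) ⌈(q - t) / h⌉₊ with hA
  set B := max A (min (m + 1) (⌊(T - q - t) / h⌋₊ + 1)) with hB
  have hAm : A ≤ m + 1 := min_le_left _ _
  have hAB : A ≤ B := le_max_left _ _
  have hBm : B ≤ m + 1 := max_le hAm (min_le_left _ _)
  have hA1 : (A : ℝ) ≤ (q - t) / h + 1 := by
    have h3 : -1 ≤ (q - t) / h := by rw [le_div_iff₀ hh]; linarith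
    have h4 : (A : ℝ) ≤ ⌈(q - t) / h⌉₊ := by exact_mod_cast min_le_right _ _
    rcases le_total ((q - t) / h) 0 with h5 | h5
    · rw [Nat.ceil_eq_zero.2 h5] at h4
      push_cast at h4
      linarith
    · linarith [Nat.ceil_lt_add_one h5]
  have hB1 : (m + 1 - B : ℝ) ≤ (q - (T - (t + h * m))) / h + 1 := by
    have h3 : -1 ≤ (q - (T - (t + h * m))) / h := by rw [le_div_iff₀ hh]; linarith
    have h4 : min (m + 1) (⌊(T - q - t) / h⌋₊ + 1) ≤ B := le_max_right _ _
    rcases min_le_iff.1 h4 with h5 | h5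
    · have : ((m + 1 : ℕ) : ℝ) ≤ B := by exact_mod_cast h5
      push_cast at this
      linarith
    · have h6 : ((⌊(T - q - t) / h⌋₊ + 1 : ℕ) : ℝ) ≤ B := by exact_mod_cast h5
      push_cast at h6
      have h7 := Nat.lt_floor_add_one ((T - q - t) / h)
      have h8 : (q - (T - (t + h * m))) / h = m - (T - q - t) / h := by
        field_simp
        ring
      linarith
  rw [Finset.range_eq_Ico, ← Finset.sum_Ico_consecutive g (Nat.zero_le A) hAm,
    ← Finset.sum_Ico_consecutive g hAB hBm]
  have h3 := sum_Ico_le (Nat.zero_le A) g (fun i hi => h1 i (by omega))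
  have h4 := sum_Ico_le hBm g (fun i hi => h1 i (by omega))
  have h5 : ∑ i ∈ Finset.Ico A B, g i ≤ γ := by
    rw [Finset.sum_Ico_eq_sum_range]
    refine sum_le_of_pairs hγ _ _ (fun i hi => h1 _ (by omega)) fun i hi => ?_
    have h6 : ¬ B ≤ A := by omega
    have hlt : A + i + 1 < B := by omega
    refine h2 (A + i) (by omega) ?_ ?_
    · have h7 : ⌈(q - t) / h⌉₊ ≤ A + i := by omega
      have := (Nat.ceil_le.1 h7)
      rw [div_le_iff₀ hh] at this
      linarith
    · have h7 : A + i + 1 ≤ ⌊(T - q - t) / h⌋₊ := by omega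
      have := (Nat.le_floor_iff' (by omega)).1 h7
      rw [le_div_iff₀ hh] at this
      push_cast at this ⊢
      linarith
  push_cast at h3 h4
  have h6 := mul_le_mul_of_nonneg_left hA1 hγ
  have h7 := mul_le_mul_of_nonneg_left hB1 hγ
  nlinarith

/-! ### Rows of a lattice inside a rectangle -/

theorem card_le_of_sub_le {S : Finset ℤ} {D : ℝ} (hD : 0 ≤ D + 1)
    (h : ∀ a ∈ S, ∀ a' ∈ S, ((a' : ℝ) - a) ≤ D) : (S.card : ℝ) ≤ D + 1 := by
  rcases S.eq_empty_or_nonempty with rfl | hS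
  · simpa using hD
  · have h1 : S ⊆ Finset.Icc (S.min' hS) (S.max' hS) := fun a ha =>
      Finset.mem_Icc.2 ⟨S.min'_le a ha, S.le_max' a ha⟩
    have h2 := Finset.card_le_card h1
    rw [Int.card_Icc] at h2
    have h3 := h _ (S.min'_mem hS) _ (S.max'_mem hS)
    have h4 : S.min' hS ≤ S.max' hS := S.min'_le _ (S.max'_mem hS)
    have h5 : (S.card : ℤ) ≤ S.max' hS + 1 - S.min' hS := by omega
    have h6 : (S.card : ℝ) ≤ S.max' hS + 1 - S.min' hS := by exact_mod_cast h5
    linarith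

/-- The row with index `b` of a set of lattice points, by their coordinates. -/
def latticeRow (I : Finset (ℤ × ℤ)) (b : ℤ) : Finset ℤ :=
  (I.filter fun p => p.2 = b).image Prod.fst

theorem mem_latticeRow {I : Finset (ℤ × ℤ)} {a b : ℤ} : a ∈ latticeRow I b ↔ (a, b) ∈ I := by
  simp [latticeRow]

theorem card_latticeRow (I : Finset (ℤ × ℤ)) (b : ℤ) :
    (latticeRow I b).card = (I.filter fun p => p.2 = b).card := by
  refine Finset.card_image_of_injOn ?_
  rintro ⟨a, b⟩ h ⟨a', b'⟩ h' rfl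
  simp only [Finset.coe_filter, Set.mem_ofPred_eq] at h h'
  rw [h.2, h'.2]

/-- The points `(x₀ + 2 c a + α b, y₀ + 2 s a + β b)` with indices in `I` lie in `[0, X] × [0, Y]`;
here `(c, s)` is a direction in the first quadrant, and the rows in this direction are `h`
apart. -/
structure RowsIn (I : Finset (ℤ × ℤ)) (c s α β x₀ y₀ X Y h : ℝ) : Prop where
  c_pos : 0 < c
  s_nonneg : 0 ≤ s
  sq_add_sq : c ^ 2 + s ^ 2 = 1
  h_pos : 0 < h
  h_eq : c * β - s * α = h
  x_mem : ∀ p ∈ I, 0 ≤ x₀ + 2 * c * p.1 + α * p.2 ∧ x₀ + 2 * c * p.1 + α * p.2 ≤ X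
  y_mem : ∀ p ∈ I, 0 ≤ y₀ + 2 * s * p.1 + β * p.2 ∧ y₀ + 2 * s * p.1 + β * p.2 ≤ Y

namespace RowsIn

variable {I : Finset (ℤ × ℤ)} {c s α β x₀ y₀ X Y h : ℝ}

/-- The left side is the distance of a row from the parallel line through the corner (X, 0). On the
rectangle it ranges from 0 to s X + c Y. -/
theorem height_eq (R : RowsIn I c s α β x₀ y₀ X Y h) (a b : ℤ) :
    c * y₀ - s * x₀ + s * X + h * b =
      s * (X - (x₀ + 2 * c * a + α * b)) + c * (y₀ + 2 * s * a + β * b) := by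
  rw [← R.h_eq]
  ring

theorem X_nonneg (R : RowsIn I c s α β x₀ y₀ X Y h) (hI : I.Nonempty) : 0 ≤ X := by
  obtain ⟨p, hp⟩ := hI
  linarith [(R.x_mem p hp).1, (R.x_mem p hp).2]

theorem Y_nonneg (R : RowsIn I c s α β x₀ y₀ X Y h) (hI : I.Nonempty) : 0 ≤ Y := by
  obtain ⟨p, hp⟩ := hI
  linarith [(R.y_mem p hp).1, (R.y_mem p hp).2]

/-- At distance t the rectangle has a chord of length profile / (s c), and the points of a row are 2
apart. -/
theorem card_latticeRow_le (R : RowsIn I c s α β x₀ y₀ X Y h) (hs : 0 < s) (hI : I.Nonempty) (b : ℤ) {t : ℝ}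
    (ht : t = c * y₀ - s * x₀ + s * X + h * b) (h0 : 0 ≤ t) (hT : t ≤ s * X + c * Y) :
    ((latticeRow I b).card : ℝ) ≤
      profile (s * X + c * Y) (min (s * X) (c * Y)) t / (2 * (s * c)) + 1 := by
  have hc := R.c_pos
  have hsc : 0 < s * c := mul_pos hs hc
  have hX := mul_nonneg hs.le (R.X_nonneg hI)
  have hY := mul_nonneg hc.le (R.Y_nonneg hI)
  have h2q : 2 * min (s * X) (c * Y) ≤ s * X + c * Y := by
    linarith [min_le_left (s * X) (c * Y), min_le_right (s * X) (c * Y)]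
  have h3 := profile_nonneg (le_min hX hY) h2q h0 hT
  refine card_le_of_sub_le (by positivity) fun a ha a' ha' => ?_
  rw [mem_latticeRow] at ha ha'
  obtain ⟨hx1, hx2⟩ := R.x_mem _ ha
  obtain ⟨hy1, hy2⟩ := R.y_mem _ ha
  obtain ⟨hx3, hx4⟩ := R.x_mem _ ha'
  obtain ⟨hy3, hy4⟩ := R.y_mem _ ha'
  rw [R.height_eq a b] at ht
  dsimp only at *
  rw [le_div_iff₀ (by positivity)]
  refine le_profile h2q ?_ (le_min ?_ ?_) ?_
  · have h5 : c * (2 * (a' - a)) ≤ X - (x₀ + 2 * c * a + α * b) := by linarith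
    have h6 := mul_le_mul_of_nonneg_left h5 hs.le
    have h7 := mul_nonneg hc.le hy1
    rw [ht]
    linarith
  · have h5 : c * (2 * (a' - a)) ≤ X := by linarith
    have h6 := mul_le_mul_of_nonneg_left h5 hs.le
    linarith
  · have h5 : s * (2 * (a' - a)) ≤ Y := by linarith
    have h6 := mul_le_mul_of_nonneg_left h5 hc.le
    linarith
  · have h5 : s * (2 * (a' - a)) ≤ Y - (y₀ + 2 * s * a + β * b) := by linarith
    have h6 := mul_le_mul_of_nonneg_left h5 hc.le
    have h7 := mul_nonneg hs.le hx1
    rw [ht]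
    linarith

theorem exists_rows (R : RowsIn I c s α β x₀ y₀ X Y h) (hI : I.Nonempty) :
    ∃ (t : ℝ) (m : ℕ) (b : ℤ), t = c * y₀ - s * x₀ + s * X + h * b ∧ 0 ≤ t ∧ t < h ∧
      t + h * m ≤ s * X + c * Y ∧ s * X + c * Y < t + h * (m + 1) ∧
      I.card = ∑ i ∈ Finset.range (m + 1), (latticeRow I (b + (i : ℕ))).card := by
  have hh := R.h_pos
  set τ := c * y₀ - s * x₀ + s * X with hτ
  set T := s * X + c * Y with hT
  set b := ⌈-τ / h⌉ with hb
  have hb1 : -τ / h ≤ b := Int.le_ceil _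
  have hb2 : (b : ℝ) < -τ / h + 1 := Int.ceil_lt_add_one _
  have hlo : ∀ p ∈ I, 0 ≤ τ + h * p.2 ∧ τ + h * p.2 ≤ T := by
    intro p hp
    have hx := R.x_mem p hp
    have hy := R.y_mem p hp
    rw [hτ, R.height_eq p.1 p.2]
    have h1 := mul_nonneg R.s_nonneg hx.1
    have h2 := mul_nonneg R.s_nonneg (sub_nonneg.2 hx.2)
    have h3 := mul_nonneg R.c_pos.le hy.1
    have h4 := mul_nonneg R.c_pos.le (sub_nonneg.2 hy.2)
    constructor <;> linarith
  have hpb : ∀ p ∈ I, b ≤ p.2 := by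
    intro p hp
    refine Int.ceil_le.2 ?_
    rw [div_le_iff₀ hh]
    linarith [(hlo p hp).1]
  rw [div_le_iff₀ hh] at hb1
  rw [← sub_lt_iff_lt_add, lt_div_iff₀ hh] at hb2
  have htT : τ + h * b ≤ T := by
    obtain ⟨p, hp⟩ := hI
    have h1 : (b : ℝ) ≤ p.2 := by exact_mod_cast hpb p hp
    have h2 := mul_le_mul_of_nonneg_left h1 hh.le
    linarith [(hlo p hp).2]
  set m := ⌊(T - (τ + h * b)) / h⌋₊ with hm
  have hm1 : (m : ℝ) ≤ (T - (τ + h * b)) / h :=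
    Nat.floor_le (div_nonneg (by linarith) hh.le)
  have hm2 : (T - (τ + h * b)) / h < m + 1 := Nat.lt_floor_add_one _
  rw [le_div_iff₀ hh] at hm1
  rw [div_lt_iff₀ hh] at hm2
  refine ⟨τ + h * b, m, b, rfl, by linarith, by linarith, by linarith, by linarith, ?_⟩
  rw [Finset.card_eq_sum_card_fiberwise (f := fun p => (p.2 - b).toNat)
    (t := Finset.range (m + 1))]
  · refine Finset.sum_congr rfl fun i _ => ?_
    rw [card_latticeRow]
    congr 1
    refine Finset.filter_congr fun p hp => ?_
    have := hpb p hp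
    omega
  · intro p hp
    have h1 := hpb p hp
    have h2 := (hlo p hp).2
    have h3 : ((p.2 - b : ℤ) : ℝ) < m + 1 := by
      push_cast
      by_contra hcon
      have := mul_le_mul_of_nonneg_left (not_lt.1 hcon) hh.le
      linarith
    have h4 : p.2 - b < m + 1 := by exact_mod_cast h3
    simp only [Finset.coe_range, Set.mem_Iio]
    omega

/-- The contribution of an end row to the number of points, where the row has profile `e`. -/
def endGain (h w e : ℝ) : ℝ := endTerm h e / (2 * w) - e / h

theorem card_le (R : RowsIn I c s α β x₀ y₀ X Y h) (hs : 0 < s) (hI : I.Nonempty) :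
    ∃ e e' : ℝ, 0 ≤ e ∧ e ≤ min (s * X) (c * Y) ∧ 0 ≤ e' ∧ e' ≤ min (s * X) (c * Y) ∧
      (I.card : ℝ) ≤ X * Y / (2 * h) + endGain h (s * c) e + endGain h (s * c) e' +
        (1 + (s * X + c * Y) / h) := by
  have hc := R.c_pos
  have hh := R.h_pos
  have hsc : 0 < s * c := mul_pos hs hc
  have hX := mul_nonneg hs.le (R.X_nonneg hI)
  have hY := mul_nonneg hc.le (R.Y_nonneg hI)
  obtain ⟨t, m, b, ht, h0, hth, hm, hm', hcard⟩ := R.exists_rows hI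
  -- The chord lengths integrate to the area X Y, whichever side determines the ramps.
  have hqT : min (s * X) (c * Y) * (s * X + c * Y - min (s * X) (c * Y)) = s * c * (X * Y) := by
    rcases min_cases (s * X) (c * Y) with ⟨e, -⟩ | ⟨e, -⟩ <;> rw [e] <;> ring
  have hq : 0 ≤ min (s * X) (c * Y) := le_min hX hY
  have h2q : 2 * min (s * X) (c * Y) ≤ s * X + c * Y := by
    linarith [min_le_left (s * X) (c * Y), min_le_right (s * X) (c * Y)]
  have hrow : ∀ i ∈ Finset.range (m + 1), ((latticeRow I (b + (i : ℕ))).card : ℝ) ≤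
      profile (s * X + c * Y) (min (s * X) (c * Y)) (t + h * i) / (2 * (s * c)) + 1 := by
    intro i hi
    have hi' : (i : ℝ) ≤ m := by exact_mod_cast Nat.lt_succ_iff.1 (Finset.mem_range.1 hi)
    have h1 := mul_le_mul_of_nonneg_left hi' hh.le
    refine R.card_latticeRow_le hs hI _ ?_ (by positivity) (by linarith)
    rw [ht]
    push_cast
    ring
  have hsum := Finset.sum_le_sum hrow
  rw [← Nat.cast_sum, ← hcard, Finset.sum_add_distrib, ← Finset.sum_div] at hsum
  have hends := sum_profile_le_ends hh hq h2q h0 hm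
  have hhm : 0 ≤ h * m := by positivity
  have hp0 := profile_le_min (t := t) h2q
  have hp1 := profile_le_min (t := t + h * m) h2q
  set e := profile (s * X + c * Y) (min (s * X) (c * Y)) t
  set e' := profile (s * X + c * Y) (min (s * X) (c * Y)) (t + h * m)
  refine ⟨e, e', profile_nonneg hq h2q h0 (by linarith), hp0.2.1,
    profile_nonneg hq h2q (by linarith) hm, hp1.2.1, hsum.trans ?_⟩
  have h5 := div_le_div_of_nonneg_right hends (show (0 : ℝ) ≤ 2 * (s * c) by positivity)
  -- The end rows lie at least e and e' away from the extreme corners, which limits the number of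
  -- rows.
  have h6 : (m : ℝ) ≤ (s * X + c * Y) / h - e / h - e' / h := by
    rw [← sub_div, ← sub_div, le_div_iff₀ hh]
    linarith
  have h7 : (min (s * X) (c * Y) * (s * X + c * Y - min (s * X) (c * Y)) / h + endTerm h e +
      endTerm h e') / (2 * (s * c)) = X * Y / (2 * h) + endTerm h e / (2 * (s * c)) +
        endTerm h e' / (2 * (s * c)) := by
    rw [hqT]
    field_simp
  rw [h7] at h5
  simp only [Finset.sum_const, Finset.card_range, nsmul_eq_mul, mul_one, Nat.cast_add,
    Nat.cast_one, endGain]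
  linarith

end RowsIn

/-- Two consecutive rows of the hexagonal packing interleave. -/
theorem RowsIn.card_add_card_le {I : Finset (ℤ × ℤ)} {c s x₀ y₀ X Y : ℝ}
    (R : RowsIn I c s (c - √3 * s) (s + √3 * c) x₀ y₀ X Y √3) (hX : 0 ≤ X) (b : ℤ) :
    ((latticeRow I b).card + (latticeRow I (b + 1)).card : ℝ) ≤ (X + √3 * s) / c + 1 := by
  have hc := R.c_pos
  have h3 : 0 ≤ √3 * s := mul_nonneg (Real.sqrt_nonneg 3) R.s_nonneg
  -- Both rows are merged into one sequence with step c: row b takes the even indices and row b + 1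
  -- the odd ones, displaced by √3 s.
  set S : Finset ℤ := (latticeRow I b).image (fun a => 2 * a) ∪
    (latticeRow I (b + 1)).image (fun a => 2 * a + 1) with hS
  have hcard : S.card = (latticeRow I b).card + (latticeRow I (b + 1)).card := by
    rw [hS, Finset.card_union_of_disjoint, Finset.card_image_of_injective,
      Finset.card_image_of_injective]
    · intro a a' h
      dsimp only at h
      omega
    · intro a a' h
      dsimp only at h
      omega
    · rw [Finset.disjoint_left]
      simp only [Finset.mem_image]
      rintro _ ⟨a, -, rfl⟩ ⟨a', -, h⟩
      omega
  have hmem : ∀ u ∈ S, (0 ≤ x₀ + (c - √3 * s) * b + c * u ∧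
      x₀ + (c - √3 * s) * b + c * u ≤ X) ∨ (0 ≤ x₀ + (c - √3 * s) * b + c * u - √3 * s ∧
      x₀ + (c - √3 * s) * b + c * u - √3 * s ≤ X) := by
    intro u hu
    rw [hS, Finset.mem_union, Finset.mem_image, Finset.mem_image] at hu
    rcases hu with ⟨a, ha, rfl⟩ | ⟨a, ha, rfl⟩
    · left
      have := R.x_mem _ (mem_latticeRow.1 ha)
      push_cast at this ⊢
      constructor <;> linarith
    · right
      have := R.x_mem _ (mem_latticeRow.1 ha)
      push_cast at this ⊢
      constructor <;> linarith
  rw [← Nat.cast_add, ← hcard]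
  refine card_le_of_sub_le (by positivity) fun u hu u' hu' => ?_
  rw [le_div_iff₀ hc]
  rcases hmem u hu with h | h <;> rcases hmem u' hu' with h' | h' <;> linarith

/-- On the plateau a row has expected content X / (2 c), and two neighbouring rows exceed their
joint expectation by at most 1 + √3 s / c = 2 ρ instead of 2. Only the rows on the ramps are charged
with the full excess 1. -/
theorem RowsIn.card_le_of_plateau {I : Finset (ℤ × ℤ)} {c s x₀ y₀ X Y : ℝ}
    (R : RowsIn I c s (c - √3 * s) (s + √3 * c) x₀ y₀ X Y √3) (hs : 0 < s) (hI : I.Nonempty)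
    (hXY : s * X ≤ c * Y) (hsc : √3 * s ≤ c) {ρ : ℝ} (hρ : ρ = (1 + √3 * s / c) / 2) :
    ∃ e e' : ℝ, 0 ≤ e ∧ e ≤ s * X ∧ 0 ≤ e' ∧ e' ≤ s * X ∧
      (I.card : ℝ) ≤ X * Y / (2 * √3) + endGain √3 (s * c) e + endGain √3 (s * c) e' +
        ρ * (1 + (s * X + c * Y) / √3) + (1 - ρ) * (2 * (s * X) / √3 + 3) := by
  have hc := R.c_pos
  have hh := R.h_pos
  have hsc0 : 0 < s * c := mul_pos hs hc
  have hX0 := R.X_nonneg hI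
  have hX := mul_nonneg hs.le hX0
  obtain ⟨t, m, b, ht, h0, hth, hm, hm', hcard⟩ := R.exists_rows hI
  have hmin : min (s * X) (c * Y) = s * X := min_eq_left hXY
  have hγ : 0 ≤ 1 - ρ := by
    have : √3 * s / c ≤ 1 := (div_le_one hc).2 hsc
    linarith
  have h2q : 2 * (s * X) ≤ s * X + c * Y := by linarith
  have hrow : ∀ i ≤ m, ((latticeRow I (b + (i : ℕ))).card : ℝ) ≤
      profile (s * X + c * Y) (s * X) (t + √3 * i) / (2 * (s * c)) + 1 := by
    intro i hi
    have hi' : (i : ℝ) ≤ m := by exact_mod_cast hi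
    have h1 := mul_le_mul_of_nonneg_left hi' hh.le
    have := R.card_latticeRow_le hs hI (b + (i : ℕ)) (t := t + √3 * i) (by rw [ht]; push_cast; ring)
      (by positivity) (by linarith)
    rwa [hmin] at this
  have hplat := sum_le_of_plateau hh hγ hX hth hm'
    (fun i => ((latticeRow I (b + (i : ℕ))).card : ℝ) -
      profile (s * X + c * Y) (s * X) (t + √3 * i) / (2 * (s * c)) - ρ)
    (fun i hi => by have := hrow i hi; linarith) (fun i hi h1 h2 => by
      have h3 := R.card_add_card_le hX0 (b + (i : ℕ))
      rw [add_assoc b] at h3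
      have h4 : 0 ≤ √3 * i := by positivity
      rw [profile_of_mem h1 (by linarith), profile_of_mem (t := t + √3 * ((i + 1 : ℕ) : ℝ))
        (by push_cast; linarith) (by push_cast; linarith)]
      have h5 : s * X / (2 * (s * c)) = X / c / 2 := by field_simp
      rw [h5, hρ]
      rw [add_div] at h3
      push_cast at h3 ⊢
      linarith)
  rw [Finset.sum_sub_distrib, Finset.sum_sub_distrib, ← Nat.cast_sum, ← hcard,
    ← Finset.sum_div] at hplat
  have hends := sum_profile_le_ends hh hX h2q h0 hm
  have hhm : 0 ≤ √3 * m := by positivity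
  have hp0 := profile_le_min (t := t) h2q
  have hp1 := profile_le_min (t := t + √3 * m) h2q
  set e := profile (s * X + c * Y) (s * X) t
  set e' := profile (s * X + c * Y) (s * X) (t + √3 * m)
  refine ⟨e, e', profile_nonneg hX h2q h0 (by linarith), hp0.2.1,
    profile_nonneg hX h2q (by linarith) hm, hp1.2.1, ?_⟩
  have h5 := div_le_div_of_nonneg_right hends (show (0 : ℝ) ≤ 2 * (s * c) by positivity)
  have h7 : ((s * X) * (s * X + c * Y - s * X) / √3 + endTerm √3 e +
      endTerm √3 e') / (2 * (s * c)) = X * Y / (2 * √3) + endTerm √3 e / (2 * (s * c)) +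
        endTerm √3 e' / (2 * (s * c)) := by
    field_simp
    ring
  rw [h7] at h5
  have h8 : (m : ℝ) = (s * X + c * Y) / √3 - t / √3 - (s * X + c * Y - (t + √3 * m)) / √3 := by
    field_simp
    ring
  set T' := s * X + c * Y - (t + √3 * m) with hT'
  have h9 : e / √3 ≤ t / √3 := div_le_div_of_nonneg_right hp0.1 hh.le
  have h10 : e' / √3 ≤ T' / √3 := div_le_div_of_nonneg_right hp1.2.2 hh.le
  simp only [Finset.sum_const, Finset.card_range, nsmul_eq_mul, Nat.cast_add,
    Nat.cast_one, endGain] at hplat ⊢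
  rw [sub_div, sub_div] at hplat
  have h11 : (I.card : ℝ) ≤ X * Y / (2 * √3) + endTerm √3 e / (2 * (s * c)) +
      endTerm √3 e' / (2 * (s * c)) + ρ * ((s * X + c * Y) / √3 - t / √3 - T' / √3 + 1) +
      (1 - ρ) * (s * X / √3 - t / √3 + (s * X / √3 - T' / √3) + 3) := by
    rw [← h8]
    linarith
  have h12 : ρ * ((s * X + c * Y) / √3 - t / √3 - T' / √3 + 1) +
      (1 - ρ) * (s * X / √3 - t / √3 + (s * X / √3 - T' / √3) + 3) =
      ρ * (1 + (s * X + c * Y) / √3) + (1 - ρ) * (2 * (s * X) / √3 + 3) - t / √3 - T' / √3 := by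
    ring
  linarith

/-! ### Optimal packings have two centres on a line parallel to a side -/

/-- The coordinates of a point after a rotation. -/
def rotX (φ : ℝ) (p : Plane) : ℝ := Real.cos φ * p 0 - Real.sin φ * p 1

/-- The coordinates of a point after a rotation. -/
def rotY (φ : ℝ) (p : Plane) : ℝ := Real.sin φ * p 0 + Real.cos φ * p 1

theorem exists_rotated {W H : ℝ} {C : Finset Plane} (hC : IsPackingIn W H C) (φ : ℝ)
    {l r b t : Plane} (hl : ∀ p ∈ C, rotX φ l ≤ rotX φ p) (hr : ∀ p ∈ C, rotX φ p ≤ rotX φ r)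
    (hb : ∀ p ∈ C, rotY φ b ≤ rotY φ p) (ht : ∀ p ∈ C, rotY φ p ≤ rotY φ t) :
    ∃ C' : Finset Plane, C'.card = C.card ∧
      IsPackingIn (2 + rotX φ r - rotX φ l) (2 + rotY φ t - rotY φ b) C' := by
  classical
  have hcs := Real.sin_sq_add_cos_sq φ
  set g : Plane → Plane := fun p => !₂[1 + rotX φ p - rotX φ l, 1 + rotY φ p - rotY φ b] with hg
  have hg0 : ∀ p, g p 0 = 1 + rotX φ p - rotX φ l := fun p => by simp [hg]
  have hg1 : ∀ p, g p 1 = 1 + rotY φ p - rotY φ b := fun p => by simp [hg]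
  have hdist : ∀ p ∈ C, ∀ q ∈ C, p ≠ q → 2 ≤ dist (g p) (g q) := by
    intro p hp q hq hpq
    have h1 := (two_le_dist_iff p q).1 (hC.2 p hp q hq hpq)
    rw [two_le_dist_iff, hg0, hg0, hg1, hg1]
    have h2 : (1 + rotX φ p - rotX φ l - (1 + rotX φ q - rotX φ l)) ^ 2 +
        (1 + rotY φ p - rotY φ b - (1 + rotY φ q - rotY φ b)) ^ 2 =
        (Real.sin φ ^ 2 + Real.cos φ ^ 2) * ((p 0 - q 0) ^ 2 + (p 1 - q 1) ^ 2) := by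
      unfold rotX rotY
      ring
    rw [h2, hcs, one_mul]
    exact h1
  refine ⟨C.image g, Finset.card_image_of_injOn ?_, ?_, ?_⟩
  · intro p hp q hq hpq
    by_contra hne
    have := hdist p hp q hq hne
    rw [hpq, dist_self] at this
    norm_num at this
  · intro p hp
    obtain ⟨p', hp', rfl⟩ := Finset.mem_image.1 hp
    rw [hg0, hg1]
    have := hl p' hp'
    have := hr p' hp'
    have := hb p' hp'
    have := ht p' hp'
    refine ⟨?_, ?_, ?_, ?_⟩ <;> linarith
  · intro p hp q hq hpq
    obtain ⟨p', hp', rfl⟩ := Finset.mem_image.1 hp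
    obtain ⟨q', hq', rfl⟩ := Finset.mem_image.1 hq
    exact hdist p' hp' q' hq' (fun h => hpq (by rw [h]))

theorem eventually_rotX_lt (C : Finset Plane) :
    ∀ᶠ φ in nhds (0 : ℝ), ∀ p ∈ C, ∀ q ∈ C, p 0 < q 0 → rotX φ p < rotX φ q := by
  rw [Filter.eventually_all_finset]
  intro p _
  rw [Filter.eventually_all_finset]
  intro q _
  by_cases h : p 0 < q 0
  · have hcont : ∀ p : Plane, Continuous fun φ => rotX φ p := fun p => by unfold rotX; fun_prop
    have := (hcont p).continuousAt.eventually_lt (hcont q).continuousAt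
      (show rotX 0 p < rotX 0 q by simpa [rotX] using h)
    filter_upwards [this] with φ hφ _ using hφ
  · exact Filter.Eventually.of_forall fun φ h' => absurd h' h

theorem eventually_rotY_lt (C : Finset Plane) :
    ∀ᶠ φ in nhds (0 : ℝ), ∀ p ∈ C, ∀ q ∈ C, p 1 < q 1 → rotY φ p < rotY φ q := by
  rw [Filter.eventually_all_finset]
  intro p _
  rw [Filter.eventually_all_finset]
  intro q _
  by_cases h : p 1 < q 1
  · have hcont : ∀ p : Plane, Continuous fun φ => rotY φ p := fun p => by unfold rotY; fun_prop
    have := (hcont p).continuousAt.eventually_lt (hcont q).continuousAt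
      (show rotY 0 p < rotY 0 q by simpa [rotY] using h)
    filter_upwards [this] with φ hφ _ using hφ
  · exact Filter.Eventually.of_forall fun φ h' => absurd h' h

/-- The product of the two areas on the right is (u ^ 2 - u' ^ 2) (v ^ 2 - v' ^ 2) ≤ (u v) ^ 2 < (U
V) ^ 2, so they cannot both be at least U V. -/
theorem mul_sub_add_contradiction {u v u' v' U V : ℝ} (hu0 : 0 < u) (hv0 : 0 < v) (huU : u < U)
    (hvV : v < V) (h1 : 0 ≤ u - u') (h3 : 0 ≤ v + v') (h4 : 0 ≤ v - v')
    (h5 : U * V ≤ (u - u') * (v + v')) (h6 : U * V ≤ (u + u') * (v - v')) : False := by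
  have huv : u * v < U * V := mul_lt_mul'' huU hvV hu0.le hv0.le
  have h0 : 0 < u * v := mul_pos hu0 hv0
  have h7 : (U * V) * (U * V) ≤ ((u - u') * (v + v')) * ((u + u') * (v - v')) :=
    mul_le_mul h5 h6 (h0.trans huv).le (mul_nonneg h1 h3)
  have h8 : (u * v) * (u * v) < (U * V) * (U * V) := mul_lt_mul'' huv huv h0.le h0.le
  have h9 : ((u - u') * (u + u')) * ((v + v') * (v - v')) ≤ u ^ 2 * v ^ 2 :=
    mul_le_mul (by linarith [sq_nonneg u']) (by linarith [sq_nonneg v'])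
      (mul_nonneg h3 h4) (sq_nonneg u)
  linarith

/-- If no two centres share a coordinate, the extreme circles stay extreme under small rotations by
φ and -φ. The sine terms in the new side lengths have opposite signs for the two rotations, and the
cosine shortens the sides; hence one of the two rectangles is smaller than the original. -/
theorem IsOptimal.exists_aligned {W H : ℝ} {C : Finset Plane} (hC : IsOptimal W H C)
    (hcard : 2 ≤ C.card) : ∃ p ∈ C, ∃ q ∈ C, p ≠ q ∧ (p 0 = q 0 ∨ p 1 = q 1) := by
  by_contra! hcon
  obtain ⟨p, hp, q, hq, hpq⟩ := Finset.one_lt_card.1 hcard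
  have hne : C.Nonempty := ⟨p, hp⟩
  obtain ⟨l, hl, hl'⟩ := C.exists_min_image (fun p => p 0) hne
  obtain ⟨r, hr, hr'⟩ := C.exists_max_image (fun p => p 0) hne
  obtain ⟨b, hb, hb'⟩ := C.exists_min_image (fun p => p 1) hne
  obtain ⟨t, ht, ht'⟩ := C.exists_max_image (fun p => p 1) hne
  have h1 : ∀ᶠ φ in nhds (0 : ℝ), rotX φ l ≤ rotX φ r ∧ rotY φ b ≤ rotY φ t ∧ W * H ≤
      (2 + rotX φ r - rotX φ l) * (2 + rotY φ t - rotY φ b) := by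
    filter_upwards [eventually_rotX_lt C, eventually_rotY_lt C] with φ hx hy
    have hx' : ∀ p ∈ C, ∀ q ∈ C, p 0 ≤ q 0 → rotX φ p ≤ rotX φ q := by
      intro p hp q hq h
      rcases h.lt_or_eq with h | h
      · exact (hx p hp q hq h).le
      · by_contra h'
        have hne : p ≠ q := fun he => h' (by rw [he])
        exact (hcon p hp q hq hne).1 h
    have hy' : ∀ p ∈ C, ∀ q ∈ C, p 1 ≤ q 1 → rotY φ p ≤ rotY φ q := by
      intro p hp q hq h
      rcases h.lt_or_eq with h | h
      · exact (hy p hp q hq h).le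
      · by_contra h'
        have hne : p ≠ q := fun he => h' (by rw [he])
        exact (hcon p hp q hq hne).2 h
    obtain ⟨C', hC', hpack⟩ := exists_rotated hC.1 φ
      (fun p hp => hx' l hl p hp (hl' p hp)) (fun p hp => hx' p hp r hr (hr' p hp))
      (fun p hp => hy' b hb p hp (hb' p hp)) (fun p hp => hy' p hp t ht (ht' p hp))
    exact ⟨hx' l hl r hr (hl' r hr), hy' b hb t ht (hb' t ht), hC.2 _ _ C' hC' hpack⟩
  have h2 : ∀ᶠ φ in nhds (0 : ℝ), rotX (-φ) l ≤ rotX (-φ) r ∧ rotY (-φ) b ≤ rotY (-φ) t ∧ W * H ≤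
      (2 + rotX (-φ) r - rotX (-φ) l) * (2 + rotY (-φ) t - rotY (-φ) b) :=
    (show Filter.Tendsto (fun φ : ℝ => -φ) (nhds 0) (nhds 0) by
      simpa using (continuous_neg (G := ℝ)).tendsto 0).eventually h1
  have h3 : ∀ᶠ φ in nhds (0 : ℝ), φ < 1 := gt_mem_nhds one_pos
  obtain ⟨φ, ⟨hφ1, hφ2, hφ3⟩, hφ0⟩ :=
    (((h1.and (h2.and h3)).filter_mono nhdsWithin_le_nhds).and
      (self_mem_nhdsWithin (s := Set.Ioi (0 : ℝ)))).exists
  have hφ0 : 0 < φ := hφ0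
  have hcos1 : Real.cos φ < 1 := by
    rw [← Real.cos_zero]
    exact Real.cos_lt_cos_of_nonneg_of_le_pi_div_two le_rfl (by linarith [Real.pi_gt_three]) hφ0
  have hcos0 : 0 < Real.cos φ := Real.cos_pos_of_mem_Ioo
    ⟨by linarith [Real.pi_gt_three], by linarith [Real.pi_gt_three]⟩
  have hx : 0 < r 0 - l 0 := by
    rcases lt_or_gt_of_ne (hcon p hp q hq hpq).1 with h | h
    · linarith [hl' p hp, hr' q hq]
    · linarith [hl' q hq, hr' p hp]
  have hy : 0 < t 1 - b 1 := by
    rcases lt_or_gt_of_ne (hcon p hp q hq hpq).2 with h | h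
    · linarith [hb' p hp, ht' q hq]
    · linarith [hb' q hq, ht' p hp]
  have hW : 2 + (r 0 - l 0) ≤ W := by
    have := hC.1.1 l hl
    have := hC.1.1 r hr
    linarith
  have hH : 2 + (t 1 - b 1) ≤ H := by
    have := hC.1.1 b hb
    have := hC.1.1 t ht
    linarith
  unfold rotX rotY at hφ1 hφ2
  rw [Real.cos_neg, Real.sin_neg] at hφ2
  refine mul_sub_add_contradiction (u := 2 + Real.cos φ * (r 0 - l 0))
    (v := 2 + Real.cos φ * (t 1 - b 1)) (u' := Real.sin φ * (r 1 - l 1))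
    (v' := Real.sin φ * (t 0 - b 0)) (U := W) (V := H) (by positivity) (by positivity)
    (by nlinarith) (by nlinarith) (by linarith [hφ1.1])
    (by linarith [hφ1.2.1]) (by linarith [hφ2.2.1]) (hφ1.2.2.trans (le_of_eq (by ring)))
    (hφ2.2.2.trans (le_of_eq (by ring)))

/-! ### Finite subsets of lattices, up to symmetry -/

/-- The rectangle `[0, X] × [0, Y]` contains `n` points of a translate of the lattice spanned by
`(a₁, b₁)` and `(a₂, b₂)`, and, if `aligned`, two of them lie on a line parallel to a side. -/
def LatticeFits (aligned : Prop) (n : ℕ) (X Y a₁ b₁ a₂ b₂ : ℝ) : Prop :=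
  ∃ (I : Finset (ℤ × ℤ)) (x y : ℝ), I.card = n ∧
    (∀ p ∈ I, 0 ≤ x + a₁ * p.1 + a₂ * p.2 ∧ x + a₁ * p.1 + a₂ * p.2 ≤ X) ∧
    (∀ p ∈ I, 0 ≤ y + b₁ * p.1 + b₂ * p.2 ∧ y + b₁ * p.1 + b₂ * p.2 ≤ Y) ∧
    (aligned → ∃ p ∈ I, ∃ q ∈ I, p ≠ q ∧
      (a₁ * p.1 + a₂ * p.2 = a₁ * q.1 + a₂ * q.2 ∨ b₁ * p.1 + b₂ * p.2 = b₁ * q.1 + b₂ * q.2))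

namespace LatticeFits

variable {A : Prop} {n : ℕ} {X Y a₁ b₁ a₂ b₂ : ℝ}

theorem swap (h : LatticeFits A n X Y a₁ b₁ a₂ b₂) : LatticeFits A n Y X b₁ a₁ b₂ a₂ := by
  obtain ⟨I, x, y, h1, h2, h3, h4⟩ := h
  refine ⟨I, y, x, h1, h3, h2, fun ha => ?_⟩
  obtain ⟨p, hp, q, hq, hpq, h⟩ := h4 ha
  exact ⟨p, hp, q, hq, hpq, h.symm⟩

theorem reflect (h : LatticeFits A n X Y a₁ b₁ a₂ b₂) :
    LatticeFits A n X Y (-a₁) b₁ (-a₂) b₂ := by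
  obtain ⟨I, x, y, h1, h2, h3, h4⟩ := h
  refine ⟨I, X - x, y, h1, fun p hp => ?_, h3, fun ha => ?_⟩
  · have := h2 p hp
    constructor <;> linarith
  · obtain ⟨p, hp, q, hq, hpq, h⟩ := h4 ha
    exact ⟨p, hp, q, hq, hpq, h.imp_left fun h => by linarith⟩

/-- A change of basis. -/
theorem rebase (h : LatticeFits A n X Y a₁ b₁ a₂ b₂) {a₁' b₁' a₂' b₂' : ℝ} (k l r s : ℤ)
    (hdet : k * s - l * r ≠ 0) (ha₁ : a₁ = k * a₁' + l * a₂') (hb₁ : b₁ = k * b₁' + l * b₂')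
    (ha₂ : a₂ = r * a₁' + s * a₂') (hb₂ : b₂ = r * b₁' + s * b₂') :
    LatticeFits A n X Y a₁' b₁' a₂' b₂' := by
  classical
  obtain ⟨I, x, y, h1, h2, h3, h4⟩ := h
  have hinj : Function.Injective
      fun p : ℤ × ℤ => ((k * p.1 + r * p.2, l * p.1 + s * p.2) : ℤ × ℤ) := by
    rintro ⟨p, q⟩ ⟨p', q'⟩ h
    simp only [Prod.mk.injEq] at h ⊢
    obtain ⟨e1, e2⟩ := h
    have e3 : (k * s - l * r) * (p - p') = 0 := by linear_combination s * e1 - r * e2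
    have e4 : (k * s - l * r) * (q - q') = 0 := by linear_combination k * e2 - l * e1
    have e5 := (mul_eq_zero.1 e3).resolve_left hdet
    have e6 := (mul_eq_zero.1 e4).resolve_left hdet
    constructor <;> omega
  have ha : ∀ p : ℤ × ℤ, a₁' * ((k * p.1 + r * p.2 : ℤ) : ℝ) + a₂' * ((l * p.1 + s * p.2 : ℤ) : ℝ) =
      a₁ * p.1 + a₂ * p.2 := by
    intro p
    rw [ha₁, ha₂]
    push_cast
    ring
  have hb : ∀ p : ℤ × ℤ, b₁' * ((k * p.1 + r * p.2 : ℤ) : ℝ) + b₂' * ((l * p.1 + s * p.2 : ℤ) : ℝ) =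
      b₁ * p.1 + b₂ * p.2 := by
    intro p
    rw [hb₁, hb₂]
    push_cast
    ring
  refine ⟨I.image fun p => (k * p.1 + r * p.2, l * p.1 + s * p.2), x, y, ?_, ?_, ?_, fun hA => ?_⟩
  · rw [Finset.card_image_of_injective _ hinj, h1]
  · intro p hp
    obtain ⟨p, hp, rfl⟩ := Finset.mem_image.1 hp
    rw [add_assoc, ha, ← add_assoc]
    exact h2 _ (by assumption)
  · intro p hp
    obtain ⟨p, hp, rfl⟩ := Finset.mem_image.1 hp
    rw [add_assoc, hb, ← add_assoc]
    exact h3 _ (by assumption)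
  · obtain ⟨p, hp, q, hq, hpq, h⟩ := h4 hA
    refine ⟨_, Finset.mem_image_of_mem _ hp, _, Finset.mem_image_of_mem _ hq,
      fun he => hpq (hinj he), ?_⟩
    rwa [ha, ha, hb, hb]

end LatticeFits

/-- A hexagonal packing in direction `(c, s)`. -/
def HexFits (n : ℕ) (X Y c s : ℝ) : Prop :=
  LatticeFits True n X Y (2 * c) (2 * s) (c - √3 * s) (s + √3 * c)

namespace HexFits

variable {n : ℕ} {X Y c s : ℝ}

theorem neg (h : HexFits n X Y c s) : HexFits n X Y (-c) (-s) :=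
  h.rebase (-1) 0 0 (-1) (by norm_num) (by push_cast; ring) (by push_cast; ring) (by push_cast; ring)
    (by push_cast; ring)

theorem reflect (h : HexFits n X Y c s) : HexFits n X Y c (-s) :=
  (LatticeFits.reflect h).rebase (-1) 0 (-1) 1 (by norm_num) (by push_cast; ring)
    (by push_cast; ring) (by push_cast; ring) (by push_cast; ring)

theorem swap (h : HexFits n X Y c s) : HexFits n Y X s c :=
  (LatticeFits.swap h).rebase 1 0 1 (-1) (by norm_num) (by push_cast; ring)
    (by push_cast; ring) (by push_cast; ring) (by push_cast; ring)

theorem rotate (h : HexFits n X Y c s) : HexFits n X Y ((c + √3 * s) / 2) ((s - √3 * c) / 2) := by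
  have h3 := sqrt_three_sq
  refine h.rebase 0 1 (-1) 1 (by norm_num) ?_ ?_ ?_ ?_ <;> push_cast
  · linear_combination (-c / 2) * h3
  · linear_combination (-s / 2) * h3
  · linear_combination (-c / 2) * h3
  · linear_combination (-s / 2) * h3

theorem reduce_to_right (h : HexFits n X Y c s) (hcs : c ^ 2 + s ^ 2 = 1) :
    ∃ c s : ℝ, c ^ 2 + s ^ 2 = 1 ∧ 0 ≤ c ∧ 0 ≤ s ∧ HexFits n X Y c s := by
  rcases le_total 0 c with hc | hc <;> rcases le_total 0 s with hs | hs
  · exact ⟨c, s, hcs, hc, hs, h⟩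
  · exact ⟨c, -s, by rw [neg_sq, hcs], hc, by linarith, h.reflect⟩
  · exact ⟨-c, s, by rw [neg_sq, hcs], by linarith, hs, by simpa using h.neg.reflect⟩
  · exact ⟨-c, -s, by rw [neg_sq, neg_sq, hcs], by linarith, by linarith, h.neg⟩

/-- The lattice is invariant under rotation by 60°, which together with a reflection brings the
direction to an angle of at most 30°. -/
theorem reduce_to_sector (h : HexFits n X Y c s) (hcs : c ^ 2 + s ^ 2 = 1) :
    ∃ c s : ℝ, c ^ 2 + s ^ 2 = 1 ∧ 0 < c ∧ 0 ≤ s ∧ √3 * s ≤ c ∧ HexFits n X Y c s := by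
  obtain ⟨c, s, hcs, hc, hs, h⟩ := h.reduce_to_right hcs
  have h3 := sqrt_three_sq
  obtain ⟨hl, hu⟩ := sqrt_three_bounds
  rcases le_or_gt (√3 * s) c with h1 | h1
  · exact ⟨c, s, hcs, lt_of_le_of_ne hc fun h0 => by
      have : s = 0 := by nlinarith
      rw [← h0, this] at hcs
      norm_num at hcs, hs, h1, h⟩
  have hs0 : 0 < s := by nlinarith
  have hcs' : ((c + √3 * s) / 2) ^ 2 + ((s - √3 * c) / 2) ^ 2 = 1 := by
    linear_combination hcs + (s ^ 2 + c ^ 2) / 4 * h3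
  have h4 : √3 * ((s - √3 * c) / 2) = (√3 * s - 3 * c) / 2 := by linear_combination (-c / 2) * h3
  rcases le_total 0 ((s - √3 * c) / 2) with h5 | h5
  · refine ⟨_, _, hcs', by positivity, h5, ?_, h.rotate⟩
    rw [h4]
    linarith
  · refine ⟨_, _, by rw [neg_sq]; exact hcs', by positivity, neg_nonneg.2 h5, ?_, h.rotate.reflect⟩
    rw [mul_neg, h4]
    linarith

/-- An angle θ between 15° and 30° becomes 30° - θ when the sides of the rectangle are exchanged,
and 2 - √3 = tan 15°. -/
theorem reduce (h : HexFits n X Y c s) (hcs : c ^ 2 + s ^ 2 = 1) :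
    ∃ c s X' Y' : ℝ, (X' = X ∧ Y' = Y ∨ X' = Y ∧ Y' = X) ∧ c ^ 2 + s ^ 2 = 1 ∧ 0 < c ∧ 0 ≤ s ∧
      s ≤ (2 - √3) * c ∧ HexFits n X' Y' c s := by
  obtain ⟨c, s, hcs, hc, hs, h1, h⟩ := h.reduce_to_sector hcs
  have h3 := sqrt_three_sq
  obtain ⟨hl, hu⟩ := sqrt_three_bounds
  rcases le_or_gt s ((2 - √3) * c) with h2 | h2
  · exact ⟨c, s, X, Y, Or.inl ⟨rfl, rfl⟩, hcs, hc, hs, h2, h⟩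
  · refine ⟨(s + √3 * c) / 2, (c - √3 * s) / 2, Y, X, Or.inr ⟨rfl, rfl⟩, ?_, by positivity,
      by linarith, ?_, h.swap.rotate⟩
    · linear_combination hcs + (s ^ 2 + c ^ 2) / 4 * h3
    · nlinarith

end HexFits

/-- A square grid in direction `(c, s)`. -/
def SquareFits (n : ℕ) (X Y c s : ℝ) : Prop :=
  LatticeFits False n X Y (2 * c) (2 * s) (-(2 * s)) (2 * c)

namespace SquareFits

variable {n : ℕ} {X Y c s : ℝ}

theorem neg (h : SquareFits n X Y c s) : SquareFits n X Y (-c) (-s) :=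
  h.rebase (-1) 0 0 (-1) (by norm_num) (by push_cast; ring) (by push_cast; ring) (by push_cast; ring)
    (by push_cast; ring)

theorem reflect (h : SquareFits n X Y c s) : SquareFits n X Y c (-s) :=
  (LatticeFits.reflect h).rebase (-1) 0 0 1 (by norm_num) (by push_cast; ring)
    (by push_cast; ring) (by push_cast; ring) (by push_cast; ring)

theorem swap (h : SquareFits n X Y c s) : SquareFits n Y X s c :=
  (LatticeFits.swap h).rebase 1 0 0 (-1) (by norm_num) (by push_cast; ring)
    (by push_cast; ring) (by push_cast; ring) (by push_cast; ring)

theorem reduce (h : SquareFits n X Y c s) (hcs : c ^ 2 + s ^ 2 = 1) :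
    ∃ c s X' Y' : ℝ, (X' = X ∧ Y' = Y ∨ X' = Y ∧ Y' = X) ∧ c ^ 2 + s ^ 2 = 1 ∧ 0 < c ∧ 0 ≤ s ∧
      s ≤ c ∧ SquareFits n X' Y' c s := by
  have h1 : ∃ c s : ℝ, c ^ 2 + s ^ 2 = 1 ∧ 0 ≤ c ∧ 0 ≤ s ∧ SquareFits n X Y c s := by
    rcases le_total 0 c with hc | hc <;> rcases le_total 0 s with hs | hs
    · exact ⟨c, s, hcs, hc, hs, h⟩
    · exact ⟨c, -s, by rw [neg_sq, hcs], hc, by linarith, h.reflect⟩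
    · exact ⟨-c, s, by rw [neg_sq, hcs], by linarith, hs, by simpa using h.neg.reflect⟩
    · exact ⟨-c, -s, by rw [neg_sq, neg_sq, hcs], by linarith, by linarith, h.neg⟩
  obtain ⟨c, s, hcs, hc, hs, h⟩ := h1
  rcases le_total s c with h2 | h2
  · exact ⟨c, s, X, Y, Or.inl ⟨rfl, rfl⟩, hcs, by nlinarith, hs, h2, h⟩
  · exact ⟨s, c, Y, X, Or.inr ⟨rfl, rfl⟩, by linarith, by nlinarith, hc, h2, h.swap⟩

end SquareFits

/-! ### Carved packings -/

/-- An isometry of the plane is affine; (c, s) is the image of the first basis vector under its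
linear part and k is the determinant. -/
theorem Isometry.exists_coords {f : Plane → Plane} (hf : Isometry f) :
    ∃ (o : Plane) (c s k : ℝ), c ^ 2 + s ^ 2 = 1 ∧ (k = 1 ∨ k = -1) ∧
      ∀ x y : ℝ, f !₂[x, y] 0 = o 0 + x * c - k * y * s ∧
        f !₂[x, y] 1 = o 1 + x * s + k * y * c := by
  set F := hf.affineIsometryOfStrictConvexSpace with hF
  set L := F.linearIsometry with hL
  have hLf : ∀ v, f v = L v + f 0 := fun v => by
    have := F.map_vadd 0 v
    simpa [hF] using this
  set e := L !₂[1, 0] with he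
  set e' := L !₂[0, 1] with he'
  have hnorm : ∀ v : Plane, ‖v‖ ^ 2 = v 0 ^ 2 + v 1 ^ 2 := fun v => by
    rw [EuclideanSpace.norm_sq_eq]
    simp [Fin.sum_univ_two]
  have h1 : e 0 ^ 2 + e 1 ^ 2 = 1 := by
    rw [← hnorm, he, L.norm_map, hnorm]
    simp
  have h2 : e' 0 ^ 2 + e' 1 ^ 2 = 1 := by
    rw [← hnorm, he', L.norm_map, hnorm]
    simp
  have h3 : (e 0 + e' 0) ^ 2 + (e 1 + e' 1) ^ 2 = 2 := by
    have h4 : ‖L (!₂[1, 0] + !₂[0, 1])‖ ^ 2 = 2 := by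
      rw [L.norm_map, hnorm]
      norm_num
    rw [L.map_add, hnorm] at h4
    simpa using h4
  have h4 : e 0 * e' 0 + e 1 * e' 1 = 0 := by linarith
  set k := e 0 * e' 1 - e 1 * e' 0 with hk
  have hk2 : k ^ 2 = 1 := by
    rw [hk]
    linear_combination (e' 0 ^ 2 + e' 1 ^ 2) * h1 + h2 - (e 0 * e' 0 + e 1 * e' 1) * h4
  have h5 : e' 0 = -(k * e 1) := by
    rw [hk]
    linear_combination (-e' 0) * h1 + e 0 * h4
  have h6 : e' 1 = k * e 0 := by
    rw [hk]
    linear_combination (-e' 1) * h1 + e 1 * h4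
  refine ⟨f 0, e 0, e 1, k, h1, sq_eq_one_iff.1 hk2, fun x y => ?_⟩
  have h7 : (!₂[x, y] : Plane) = x • !₂[1, 0] + y • !₂[0, 1] := by
    ext i
    fin_cases i <;> simp
  rw [hLf, h7, L.map_add, L.map_smul, L.map_smul, ← he, ← he']
  simp only [PiLp.add_apply, PiLp.smul_apply, smul_eq_mul, h5, h6]
  constructor <;> ring

theorem LatticeFits.of_packing {A : Prop} {W H x y a₁ b₁ a₂ b₂ : ℝ} {C : Finset Plane}
    (hC : IsPackingIn W H C)
    (h : ∀ p ∈ C, ∃ a b : ℤ, p 0 = x + a₁ * a + a₂ * b ∧ p 1 = y + b₁ * a + b₂ * b)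
    (hA : A → ∃ p ∈ C, ∃ q ∈ C, p ≠ q ∧ (p 0 = q 0 ∨ p 1 = q 1)) :
    LatticeFits A C.card (W - 2) (H - 2) a₁ b₁ a₂ b₂ := by
  classical
  choose! f g hfg using h
  have hinj : Set.InjOn (fun p => (f p, g p)) C := by
    intro p hp q hq hpq
    simp only [Prod.mk.injEq] at hpq
    have hp := hfg p hp
    have hq := hfg q hq
    rw [hpq.1, hpq.2] at hp
    ext i
    fin_cases i
    · exact hp.1.trans hq.1.symm
    · exact hp.2.trans hq.2.symm
  refine ⟨C.image fun p => (f p, g p), x - 1, y - 1, Finset.card_image_of_injOn hinj, ?_, ?_,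
    fun ha => ?_⟩
  · intro p' hp'
    obtain ⟨p, hp, rfl⟩ := Finset.mem_image.1 hp'
    have h1 := (hfg p hp).1
    have h2 := hC.1 p hp
    dsimp only
    constructor <;> linarith
  · intro p' hp'
    obtain ⟨p, hp, rfl⟩ := Finset.mem_image.1 hp'
    have h1 := (hfg p hp).2
    have h2 := hC.1 p hp
    dsimp only
    constructor <;> linarith
  · obtain ⟨p, hp, q, hq, hpq, h⟩ := hA ha
    refine ⟨_, Finset.mem_image_of_mem _ hp, _, Finset.mem_image_of_mem _ hq,
      fun he => hpq (hinj hp hq he), ?_⟩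
    have h1 := hfg p hp
    have h2 := hfg q hq
    dsimp only
    exact h.imp (fun h => by linarith) fun h => by linarith

theorem CarvedFrom.hexFits {W H : ℝ} {C : Finset Plane} (hC : IsOptimal W H C)
    (hcard : 2 ≤ C.card) (h : CarvedFrom hexGrid C) :
    ∃ c s : ℝ, c ^ 2 + s ^ 2 = 1 ∧ HexFits C.card (W - 2) (H - 2) c s := by
  obtain ⟨f, hf, h⟩ := h
  obtain ⟨o, c, s, k, hcs, hk, hfo⟩ := Isometry.exists_coords hf
  refine ⟨c, s, hcs, ?_⟩
  have h1 : LatticeFits True C.card (W - 2) (H - 2) (2 * c) (2 * s) (c - k * √3 * s)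
      (s + k * √3 * c) := by
    refine LatticeFits.of_packing (x := o 0) (y := o 1) hC.1 (fun p hp => ?_)
      fun _ => hC.exists_aligned hcard
    obtain ⟨_, ⟨a, b, rfl⟩, rfl⟩ := h p hp
    refine ⟨a, b, ?_, ?_⟩
    · rw [(hfo _ _).1]
      ring
    · rw [(hfo _ _).2]
      ring
  rcases hk with rfl | rfl
  · exact h1.rebase 1 0 0 1 (by norm_num) (by push_cast; ring) (by push_cast; ring)
      (by push_cast; ring) (by push_cast; ring)
  · exact h1.rebase 1 0 1 (-1) (by norm_num) (by push_cast; ring) (by push_cast; ring)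
      (by push_cast; ring) (by push_cast; ring)

theorem CarvedFrom.squareFits {W H : ℝ} {C : Finset Plane} (hC : IsPackingIn W H C)
    (h : CarvedFrom squareGrid C) :
    ∃ c s : ℝ, c ^ 2 + s ^ 2 = 1 ∧ SquareFits C.card (W - 2) (H - 2) c s := by
  obtain ⟨f, hf, h⟩ := h
  obtain ⟨o, c, s, k, hcs, hk, hfo⟩ := Isometry.exists_coords hf
  refine ⟨c, s, hcs, ?_⟩
  have h1 : LatticeFits False C.card (W - 2) (H - 2) (2 * c) (2 * s) (-(2 * k * s))
      (2 * k * c) := by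
    refine LatticeFits.of_packing (x := o 0) (y := o 1) hC (fun p hp => ?_) False.elim
    obtain ⟨_, ⟨a, b, rfl⟩, rfl⟩ := h p hp
    refine ⟨a, b, ?_, ?_⟩
    · rw [(hfo _ _).1]
      ring
    · rw [(hfo _ _).2]
      ring
  rcases hk with rfl | rfl
  · exact h1.rebase 1 0 0 1 (by norm_num) (by push_cast; ring) (by push_cast; ring)
      (by push_cast; ring) (by push_cast; ring)
  · exact h1.rebase 1 0 0 (-1) (by norm_num) (by push_cast; ring) (by push_cast; ring)
      (by push_cast; ring) (by push_cast; ring)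

/-! ### Lattice packings with rows parallel to a side, and square grids -/

theorem HexFits.exists_rowsIn {n : ℕ} {X Y c s : ℝ} (h : HexFits n X Y c s) (hc : 0 < c)
    (hs : 0 ≤ s) (hcs : c ^ 2 + s ^ 2 = 1) :
    ∃ (I : Finset (ℤ × ℤ)) (x y : ℝ), I.card = n ∧
      RowsIn I c s (c - √3 * s) (s + √3 * c) x y X Y √3 ∧ ∃ p ∈ I, ∃ q ∈ I, p ≠ q ∧
      (2 * c * p.1 + (c - √3 * s) * p.2 = 2 * c * q.1 + (c - √3 * s) * q.2 ∨
        2 * s * p.1 + (s + √3 * c) * p.2 = 2 * s * q.1 + (s + √3 * c) * q.2) := by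
  obtain ⟨I, x, y, h1, h2, h3, h4⟩ := h
  exact ⟨I, x, y, h1, ⟨hc, hs, hcs, by positivity, by linear_combination √3 * hcs, h2, h3⟩,
    h4 trivial⟩

theorem SquareFits.exists_rowsIn {n : ℕ} {X Y c s : ℝ} (h : SquareFits n X Y c s) (hc : 0 < c)
    (hs : 0 ≤ s) (hcs : c ^ 2 + s ^ 2 = 1) :
    ∃ (I : Finset (ℤ × ℤ)) (x y : ℝ), I.card = n ∧
      RowsIn I c s (-(2 * s)) (2 * c) x y X Y 2 := by
  obtain ⟨I, x, y, h1, h2, h3, -⟩ := h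
  exact ⟨I, x, y, h1, ⟨hc, hs, hcs, by positivity, by linear_combination 2 * hcs, h2, h3⟩⟩

theorem RowsIn.card_latticeRow_le_floor {I : Finset (ℤ × ℤ)} {α β x₀ y₀ X Y h : ℝ}
    (R : RowsIn I 1 0 α β x₀ y₀ X Y h) (hI : I.Nonempty) (b : ℤ) :
    (latticeRow I b).card ≤ ⌊X / 2⌋₊ + 1 := by
  have hX := R.X_nonneg hI
  have h1 : ((latticeRow I b).card : ℝ) ≤ X / 2 + 1 := by
    refine card_le_of_sub_le (by positivity) fun a ha a' ha' => ?_
    have h2 := R.x_mem _ (mem_latticeRow.1 ha)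
    have h3 := R.x_mem _ (mem_latticeRow.1 ha')
    dsimp only at h2 h3
    linarith
  rw [← Nat.floor_add_one (by positivity)]
  exact Nat.le_floor h1

theorem sum_add_half_le {w : ℕ} (m : ℕ) : ∀ k : ℕ → ℕ, (∀ i < m, k i ≤ w) →
    (∀ i, i + 1 < m → k i + k (i + 1) + 1 ≤ 2 * w) →
    ∑ i ∈ Finset.range m, k i + m / 2 ≤ w * m := by
  induction m using Nat.strong_induction_on with
  | _ m ih =>
    intro k h1 h2
    obtain _ | _ | m := m
    · simp
    · simpa using h1 0 (by norm_num)
    · rw [Finset.sum_range_succ, Finset.sum_range_succ]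
      have h3 := ih m (by omega) k (fun i hi => h1 i (by omega)) (fun i hi => h2 i (by omega))
      have h4 := h2 m (by omega)
      have h5 : (m + 1 + 1) / 2 = m / 2 + 1 := by omega
      rw [h5]
      linarith

/-- Let w be the largest number of centres that fit into a row. If X ≥ 2 w - 1, the width admits
full shifted rows; otherwise neighbouring rows together hold at most 2 w - 1 circles, as in a
depleted arrangement. -/
theorem HexFits.entryArea_le_of_aligned {n : ℕ} {X Y : ℝ} (h : HexFits n X Y 1 0) (h1 : 1 ≤ n)
    (h2 : n ≤ 5001) : entryArea (entry n) ≤ (X + 2) * (Y + 2) := by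
  obtain ⟨I, x, y, hcard, R, -⟩ := h.exists_rowsIn one_pos le_rfl (by norm_num)
  have hI : I.Nonempty := by
    rw [← Finset.card_pos]
    omega
  have hX := R.X_nonneg hI
  obtain ⟨t, m, b, -, h0, -, hm, -, hsum⟩ := R.exists_rows hI
  have hY : √3 * m ≤ Y := by linarith
  have hfl := Nat.floor_le (show 0 ≤ X / 2 by positivity)
  have hrow := R.card_latticeRow_le_floor hI
  have hpair := fun b => R.card_add_card_le hX b
  set w := ⌊X / 2⌋₊ + 1 with hw
  have hwX : (2 * w : ℝ) ≤ X + 2 := by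
    rw [hw]
    push_cast
    linarith
  have h3 : (0 : ℝ) ≤ 2 * (1 : ℕ) + √3 * m := by positivity
  rcases lt_or_ge X (2 * w - 1) with hlt | hge
  · have h4 : n + (m + 1) / 2 ≤ w * (1 + m) := by
      rw [← hcard, hsum, add_comm 1 m]
      refine sum_add_half_le _ _ (fun i _ => hrow _) fun i _ => ?_
      have h5 := hpair (b + (i : ℕ))
      rw [add_assoc b] at h5
      have h6 : ((latticeRow I (b + (i : ℕ))).card + (latticeRow I (b + ((i : ℕ) + 1))).card : ℝ) <
          2 * w := by linarith
      have h7 : (latticeRow I (b + (i : ℕ))).card + (latticeRow I (b + ((i : ℕ) + 1))).card <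
          2 * w := by exact_mod_cast h6
      push_cast
      omega
    refine (entryArea_le_depleted h1 h2 (by omega) le_rfl h4).trans ?_
    refine mul_le_mul hwX ?_ h3 (by linarith)
    push_cast
    linarith
  · have h4 : n ≤ w * (1 + m) := by
      rw [← hcard, hsum, add_comm 1 m]
      refine (Finset.sum_le_card_nsmul _ _ w fun i _ => hrow _).trans ?_
      simp [mul_comm]
    refine (entryArea_le_full h1 h2 (by omega) le_rfl h4).trans ?_
    refine mul_le_mul (by linarith) ?_ h3 (by linarith)
    push_cast
    linarith

theorem SquareFits.card_le_of_aligned {n : ℕ} {X Y : ℝ} (h : SquareFits n X Y 1 0) (h1 : 1 ≤ n) :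
    4 * (n : ℝ) ≤ (X + 2) * (Y + 2) := by
  obtain ⟨I, x, y, hcard, R⟩ := h.exists_rowsIn one_pos le_rfl (by norm_num)
  have hI : I.Nonempty := by
    rw [← Finset.card_pos]
    omega
  have hX := R.X_nonneg hI
  obtain ⟨t, m, b, -, h0, -, hm, -, hsum⟩ := R.exists_rows hI
  have hfl := Nat.floor_le (show 0 ≤ X / 2 by positivity)
  have h4 : n ≤ (⌊X / 2⌋₊ + 1) * (m + 1) := by
    rw [← hcard, hsum]
    refine (Finset.sum_le_card_nsmul _ _ (⌊X / 2⌋₊ + 1)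
      fun i _ => R.card_latticeRow_le_floor hI _).trans ?_
    simp [mul_comm]
  have h5 : (n : ℝ) ≤ (⌊X / 2⌋₊ + 1) * (m + 1) := by exact_mod_cast h4
  have h6 : (⌊X / 2⌋₊ + 1 : ℝ) * (m + 1) ≤ (X / 2 + 1) * (Y / 2 + 1) :=
    mul_le_mul (by linarith) (by linarith) (by positivity) (by positivity)
  linarith

/-- The coefficient 1 - s is what is needed: two end gains together with the term s X of
`RowsIn.card_le` then give 2 X, as in (X + 2) (Y + 2). -/
theorem endGain_two_le {c s X e : ℝ} (hc : 0 < c) (hs : 0 < s) (hsc : s ≤ c)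
    (hcs : c ^ 2 + s ^ 2 = 1) (he : 0 ≤ e) (heX : e ≤ s * X) :
    8 * RowsIn.endGain 2 (s * c) e ≤ 2 * (1 - s) * X + 4 := by
  have hs1 : s < 1 := by nlinarith
  have hc1 : c ≤ 1 := by nlinarith
  have h1 : e / s ≤ X := by
    rw [div_le_iff₀ hs]
    linarith
  obtain ⟨d, rfl⟩ : ∃ d, e = s * d := ⟨e / s, by field_simp⟩
  have hd : 0 ≤ d := nonneg_of_mul_nonneg_right he hs
  rw [mul_div_cancel_left₀ _ hs.ne'] at h1
  have h2 : 8 * RowsIn.endGain 2 (s * c) (s * d) = (2 * d - s * d ^ 2) / c - 4 * s * d := by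
    unfold RowsIn.endGain endTerm
    field_simp
    ring
  have h3 : 2 * (1 - s) * d ≤ 2 * (1 - s) * X := mul_le_mul_of_nonneg_left h1 (by linarith)
  have h4 : (2 * d - s * d ^ 2) / c ≤ 2 * (1 + s) * d := by
    rw [div_le_iff₀ hc]
    have h5 : 1 ≤ (1 + s) * c := by nlinarith
    nlinarith [mul_nonneg hd (sub_nonneg.2 h5), mul_nonneg hs.le (sq_nonneg d)]
  linarith

theorem SquareFits.card_le {n : ℕ} {X Y c s : ℝ} (h : SquareFits n X Y c s)
    (hcs : c ^ 2 + s ^ 2 = 1) (h1 : 1 ≤ n) : 4 * (n : ℝ) ≤ (X + 2) * (Y + 2) + 4 := by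
  obtain ⟨c, s, X', Y', hXY, hcs, hc, hs, hsc, h⟩ := h.reduce hcs
  suffices 4 * (n : ℝ) ≤ (X' + 2) * (Y' + 2) + 4 by
    rcases hXY with ⟨rfl, rfl⟩ | ⟨rfl, rfl⟩ <;> linarith
  rcases hs.eq_or_lt with rfl | hs
  · obtain rfl : c = 1 := by nlinarith
    linarith [h.card_le_of_aligned h1]
  · obtain ⟨I, x, y, hcard, R⟩ := h.exists_rowsIn hc hs.le hcs
    have hI : I.Nonempty := by
      rw [← Finset.card_pos]
      omega
    have hY := R.Y_nonneg hI
    have hc1 : c ≤ 1 := by nlinarith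
    obtain ⟨e, e', he, heX, he', heX', hle⟩ := R.card_le hs hI
    have h2 := endGain_two_le hc hs hsc hcs he (heX.trans (min_le_left _ _))
    have h3 := endGain_two_le hc hs hsc hcs he' (heX'.trans (min_le_left _ _))
    rw [hcard] at hle
    have h4 : c * Y' ≤ Y' := mul_le_of_le_one_left hY hc1
    linarith

/-- The surplus 4 - 2√3 per circle outweighs both the loss of the table and the constant 4 once √n ≥
7. -/
theorem entryArea_le_of_four_mul_le {n : ℕ} (h1 : 49 ≤ n) (h2 : n ≤ 5001) {A : ℝ}
    (h : 4 * (n : ℝ) ≤ A + 4) : entryArea (entry n) ≤ A := by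
  refine (entryArea_le_sqrt (by omega) (by omega)).trans ?_
  have h3 : (7 : ℝ) ≤ √n := Real.le_sqrt_of_sq_le (by norm_num; exact_mod_cast h1)
  have h4 : √(n : ℝ) ^ 2 = n := Real.sq_sqrt n.cast_nonneg
  obtain ⟨-, h5⟩ := sqrt_three_bounds
  have h6 : 2 * √3 * (n + 0.682 * √n) ≤ 2 * 1.7320509 * (n + 0.682 * √n) := by gcongr
  nlinarith

/-! ### Tilted hexagonal packings -/

theorem inv_sqrt_three_bounds : 0.57735 < 1 / √3 ∧ 1 / √3 < 0.5773503 := by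
  obtain ⟨h1, h2⟩ := sqrt_three_bounds
  have h3 : 0 < √3 := by positivity
  constructor
  · rw [lt_div_iff₀ h3]
    linarith
  · rw [div_lt_iff₀ h3]
    linarith

/-- If `n` points cost an area that is larger than the hexagonal one by a linear amount in the sides
of the rectangle, then the rectangle is larger than the best one of the table. -/
theorem area_le_of_linear_loss {n : ℕ} (hn : 49 ≤ n) {X Y a b α κ : ℝ} (hX : 0 ≤ X) (hY : 0 ≤ Y)
    (h : (n : ℝ) ≤ (X + 2) * (Y + 2) / (2 * √3) - a * X - b * Y + κ) (ha : 0 ≤ a) (hb : 0 ≤ b)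
    (hα : 0.3665 ≤ α) (hαab : α ^ 2 ≤ 4 * a * b)
    (hκ : κ + 2 * a + 2 * b < 7 * (1.8612 * α - 0.682)) (hκ' : κ + 2 * a + 2 * b < 49) :
    2 * √3 * (n + 0.682 * √n) ≤ (X + 2) * (Y + 2) := by
  by_contra! hcon
  have h3 : (7 : ℝ) ≤ √n := Real.le_sqrt_of_sq_le (by norm_num; exact_mod_cast hn)
  have h4 : √(n : ℝ) ^ 2 = n := Real.sq_sqrt n.cast_nonneg
  have hn' : (49 : ℝ) ≤ n := by exact_mod_cast hn
  obtain ⟨h5, -⟩ := sqrt_three_bounds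
  have hs : 0 < 2 * √3 := by positivity
  set P := (n : ℝ) + 0.682 * √n with hP
  have hP0 : 0 ≤ 2 * √3 * P := by positivity
  have hA0 : 0 ≤ (X + 2) * (Y + 2) := by positivity
  set G := √((X + 2) * (Y + 2)) with hG
  set G₁ := √(2 * √3 * P) with hG₁
  have hG2 : G ^ 2 = (X + 2) * (Y + 2) := Real.sq_sqrt hA0
  have hG12 : G₁ ^ 2 = 2 * √3 * P := Real.sq_sqrt hP0
  have hG0 : 0 ≤ G := Real.sqrt_nonneg _
  have hGG : G ≤ G₁ := Real.sqrt_le_sqrt hcon.le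
  -- Here 1.8612 < √(2√3). Since 1.8612 * 0.3665 > 0.682, the coefficient 1.8612 α - 0.682 is
  -- positive, so that √n may finally be replaced by 7.
  have hlow : 1.8612 * √n ≤ G₁ := Real.le_sqrt_of_sq_le (by
    rw [mul_pow, h4, hP]
    nlinarith)
  -- The inequality between the means: for a given area the linear loss is at least 2 √(a b) times
  -- the side G of the square of that area.
  have hlin : α * G ≤ a * (X + 2) + b * (Y + 2) := by
    refine le_of_sq_le_sq ?_ (by positivity)
    rw [mul_pow, hG2]
    nlinarith [sq_nonneg (a * (X + 2) - b * (Y + 2)), mul_le_mul_of_nonneg_right hαab hA0]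
  have h6 : (n : ℝ) ≤ G ^ 2 / (2 * √3) - α * G + (κ + 2 * a + 2 * b) := by
    rw [hG2]
    linarith
  have h7 : G ^ 2 / (2 * √3) - α * G = G * (G / (2 * √3) - α) := by ring
  have h8 : G / (2 * √3) ≤ G₁ / (2 * √3) := div_le_div_of_nonneg_right hGG hs.le
  rcases le_total (G₁ / (2 * √3) - α) 0 with h9 | h9
  · have : G * (G / (2 * √3) - α) ≤ 0 := mul_nonpos_of_nonneg_of_nonpos hG0 (by linarith)
    linarith
  · have h10 : G * (G / (2 * √3) - α) ≤ G₁ * (G₁ / (2 * √3) - α) :=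
      (mul_le_mul_of_nonneg_left (by linarith) hG0).trans (mul_le_mul_of_nonneg_right hGG h9)
    have h11 : G₁ * (G₁ / (2 * √3) - α) = P - α * G₁ := by
      have : G₁ * (G₁ / (2 * √3)) = P := by
        rw [← mul_div_assoc, ← sq, hG12]
        field_simp
      rw [mul_sub, this]
      ring
    have h12 : α * (1.8612 * √n) ≤ α * G₁ := mul_le_mul_of_nonneg_left hlow (by linarith)
    have h13 : (1.8612 * α - 0.682) * 7 ≤ (1.8612 * α - 0.682) * √n :=
      mul_le_mul_of_nonneg_left h3 (by linarith)
    linarith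

/-- The end gain is a concave quadratic in e, and the right side is its tangent of slope μ / (4 w).
The parameter μ trades the constant of order 1 / w against a term linear in e. -/
theorem endGain_sqrt_three_le {w : ℝ} (hw : 0 < w) (μ e : ℝ) :
    RowsIn.endGain √3 w e ≤
      μ * e / (4 * w) + (1 - μ) ^ 2 * √3 / (16 * w) - (1 - μ) / 2 + w * (1 / √3) := by
  have h3 := sqrt_three_sq
  have hr : 0 < √3 := by positivity
  have h1 : μ * e / (4 * w) + (1 - μ) ^ 2 * √3 / (16 * w) - (1 - μ) / 2 + w * (1 / √3) -
      RowsIn.endGain √3 w e = (e - 2 * √3 * w * ((1 - μ) / (4 * w) - 1 / √3)) ^ 2 /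
        (4 * √3 * w) := by
    unfold RowsIn.endGain endTerm
    field_simp
    ring_nf
  have h2 : 0 ≤ (e - 2 * √3 * w * ((1 - μ) / (4 * w) - 1 / √3)) ^ 2 / (4 * √3 * w) := by
    positivity
  linarith

theorem two_endGains_le {c s X μ e e' : ℝ} (hc : 0 < c) (hs : 0 < s) (hμ : 0 ≤ μ)
    (he : e ≤ s * X) (he' : e' ≤ s * X) :
    RowsIn.endGain √3 (s * c) e + RowsIn.endGain √3 (s * c) e' ≤
      μ * X / (2 * c) + (1 - μ) ^ 2 * √3 / (8 * (s * c)) - (1 - μ) + 2 * (s * c) * (1 / √3) := by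
  have hw : 0 < s * c := mul_pos hs hc
  have h1 := endGain_sqrt_three_le hw μ e
  have h2 := endGain_sqrt_three_le hw μ e'
  have h3 : μ * e / (4 * (s * c)) ≤ μ * (s * X) / (4 * (s * c)) := by gcongr
  have h4 : μ * e' / (4 * (s * c)) ≤ μ * (s * X) / (4 * (s * c)) := by gcongr
  have h5 : μ * (s * X) / (4 * (s * c)) = μ * X / (2 * c) / 2 := by
    field_simp
    ring
  have h6 : (1 - μ) ^ 2 * √3 / (16 * (s * c)) = (1 - μ) ^ 2 * √3 / (8 * (s * c)) / 2 := by
    field_simp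
    ring
  rw [h5] at h3 h4
  rw [h6] at h1 h2
  linarith

section tilted

variable {I : Finset (ℤ × ℤ)} {c s x y X Y : ℝ}

/-- Two points on a line parallel to a side are far apart if the packing is hardly tilted. -/
theorem RowsIn.sides_of_aligned
    (R : RowsIn I c s (c - √3 * s) (s + √3 * c) x y X Y √3) (hs : 0 < s)
    (h : ∃ p ∈ I, ∃ q ∈ I, p ≠ q ∧
      (2 * c * p.1 + (c - √3 * s) * p.2 = 2 * c * q.1 + (c - √3 * s) * q.2 ∨
        2 * s * p.1 + (s + √3 * c) * p.2 = 2 * s * q.1 + (s + √3 * c) * q.2)) :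
    √3 ≤ s * X ∨ 1 ≤ s * Y := by
  obtain ⟨⟨a, b⟩, hp, ⟨a', b'⟩, hq, hpq, h⟩ := h
  have hpx := R.x_mem _ hp
  have hpy := R.y_mem _ hp
  have hqx := R.x_mem _ hq
  have hqy := R.y_mem _ hq
  have hcs := R.sq_add_sq
  have hr : 0 < √3 := by positivity
  dsimp only at *
  rcases h with h | h
  · right
    set E := 2 * s * ((a : ℝ) - a') + (s + √3 * c) * (b - b') with hE
    -- The vector (0, E) has the component s E along the rows, and for lattice vectors this
    -- component is an integer.
    have h1 : s * E = ((2 * (a - a') + (b - b') : ℤ) : ℝ) := by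
      push_cast
      rw [hE]
      linear_combination (2 * ((a : ℝ) - a') + (b - b')) * hcs - c * h
    have hEY : |E| ≤ Y := abs_le.2 ⟨by linarith, by linarith⟩
    have h2 : (2 * (a - a') + (b - b') : ℤ) ≠ 0 := by
      intro h0
      rw [h0, Int.cast_zero, mul_eq_zero, or_iff_right hs.ne'] at h1
      have h3 : √3 * ((b : ℝ) - b') = 0 := by
        linear_combination (-√3 * ((b : ℝ) - b')) * hcs - s * h + c * (h1 - hE)
      rw [mul_eq_zero, or_iff_right hr.ne', sub_eq_zero] at h3
      have h4 : b = b' := by exact_mod_cast h3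
      subst h4
      exact hpq (by rw [Prod.mk.injEq]; omega)
    have h3 : (1 : ℝ) ≤ |((2 * (a - a') + (b - b') : ℤ) : ℝ)| := by
      exact_mod_cast Int.one_le_abs h2
    rw [← h1, abs_mul, abs_of_pos hs] at h3
    exact h3.trans (mul_le_mul_of_nonneg_left hEY hs.le)
  · left
    set D := 2 * c * ((a : ℝ) - a') + (c - √3 * s) * (b - b') with hD
    -- The vector (D, 0) has the component -s D across the rows, a multiple of the row distance √3.
    have h1 : s * D = √3 * ((b' - b : ℤ) : ℝ) := by
      push_cast
      rw [hD]
      linear_combination (-√3 * ((b : ℝ) - b')) * hcs + c * h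
    have hDX : |D| ≤ X := abs_le.2 ⟨by linarith, by linarith⟩
    have h2 : (b' - b : ℤ) ≠ 0 := by
      intro h0
      obtain rfl : b' = b := by omega
      have h3 : (2 * s) * ((a : ℝ) - a') = 0 := by linarith
      rw [mul_eq_zero, or_iff_right (by positivity), sub_eq_zero] at h3
      exact hpq (by rw [show a = a' by exact_mod_cast h3])
    have h3 : (1 : ℝ) ≤ |((b' - b : ℤ) : ℝ)| := by exact_mod_cast Int.one_le_abs h2
    calc √3 ≤ √3 * |((b' - b : ℤ) : ℝ)| := le_mul_of_one_le_right hr.le h3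
      _ = |s * D| := by rw [h1, abs_mul, abs_of_pos hr]
      _ = s * |D| := by rw [abs_mul, abs_of_pos hs]
      _ ≤ s * X := mul_le_mul_of_nonneg_left hDX hs.le

theorem area_div_eq (X Y : ℝ) : (X + 2) * (Y + 2) / (2 * √3) =
    X * Y / (2 * √3) + (X + Y + 2) * (1 / √3) := by
  field_simp
  ring

/-- The coefficients of the sides and the constant term for a tilted packing with long rows. -/
theorem long_rows_coeffs (hc : 0 < c) (hs : 0 < s) (hcs : c ^ 2 + s ^ 2 = 1) (hsc : √3 * s ≤ c)
    {q k : ℝ} (hq : q = 1 / √3) (hk : k = √3 * s / c) :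
    0.57735 * (1 - 1.5 * s + 0.866 * s ^ 2) ≤ q * (1 - (1.5 * s - k * s / 2)) ∧
      0.57735 * (0.5 - 0.8660255 * s + s ^ 2 / 4) ≤ q * (1 - (c / 2 + k * c / 2)) ∧
      2 - k + 2 * (s * c) * q - 2 * q - 1 ≤ -0.1547 - 0.577 * s := by
  obtain ⟨h3, h3'⟩ := sqrt_three_bounds
  obtain ⟨h4, h4'⟩ := inv_sqrt_three_bounds
  have hs3 := sqrt_three_sq
  rw [← hq] at h4 h4'
  have hq0 : 0 ≤ q := by linarith only [h4]
  have hc1 : c ≤ 1 := le_of_sq_le_sq (by linarith only [hcs, sq_nonneg s]) zero_le_one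
  have hq3 : √3 * q = 1 := by
    rw [hq]
    field_simp
  have hkc : k * c = √3 * s := by
    rw [hk]
    field_simp
  have hks : √3 * s ≤ k := by
    rw [hk, le_div_iff₀ hc]
    exact mul_le_of_le_one_right (by positivity) hc1
  have hsmall : s ≤ 0.5 := by
    have h5 : (√3 * s) ^ 2 ≤ c ^ 2 := pow_le_pow_left₀ (by positivity) hsc 2
    have h6 : (√3 * s) ^ 2 = 3 * s ^ 2 := by linear_combination s ^ 2 * hs3
    exact le_of_sq_le_sq (by linarith only [h5, h6, hcs]) (by norm_num)
  have hs2 := sq_nonneg s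
  refine ⟨mul_le_mul h4.le ?_ (by linarith only [hsmall, hs2]) hq0,
    mul_le_mul h4.le ?_ (by linarith only [hsmall, hs2]) hq0, ?_⟩
  · have h5 : 1.7320508 * s ≤ k := (mul_le_mul_of_nonneg_right h3.le hs.le).trans hks
    have h6 : 1.7320508 * s * s ≤ k * s := mul_le_mul_of_nonneg_right h5 hs.le
    linarith only [h6, hs2]
  · have h5 : c ≤ 1 - s ^ 2 / 2 := by
      have h6 : s ^ 2 ≤ 1 := by linarith only [hcs, sq_nonneg c]
      refine le_of_sq_le_sq ?_ (by linarith only [h6])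
      linarith only [hcs, sq_nonneg (s ^ 2), show (1 - s ^ 2 / 2) ^ 2 =
        1 - s ^ 2 + (s ^ 2) ^ 2 / 4 by ring]
    have h6 : √3 * s ≤ 1.7320509 * s := mul_le_mul_of_nonneg_right h3'.le hs.le
    rw [hkc]
    linarith only [h5, h6, hs]
  · have h8 : s * c * q ≤ s * q :=
      mul_le_mul_of_nonneg_right (mul_le_of_le_one_right hs.le hc1) hq0
    have h9 : √3 * s = 3 * (s * q) := by linear_combination (-s * √3) * hq3 + s * q * hs3
    have h10 : 0.577 * s ≤ s * q := by
      rw [mul_comm s q]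
      exact mul_le_mul_of_nonneg_right (by linarith only [h4]) hs.le
    linarith only [h8, h9, h10, hks, h4]

/-- The number of circles of a tilted packing with long rows. -/
theorem RowsIn.card_le_of_long
    (R : RowsIn I c s (c - √3 * s) (s + √3 * c) x y X Y √3) (hs : 0 < s) (hI : I.Nonempty)
    (hXY : s * X ≤ c * Y) (hsc : √3 * s ≤ c) {μ : ℝ} (hμ : 0 ≤ μ) :
    (I.card : ℝ) ≤ (X + 2) * (Y + 2) / (2 * √3) -
      (0.57735 * (1 - 1.5 * s + 0.866 * s ^ 2) - μ / (2 * c)) * X -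
      0.57735 * (0.5 - 0.8660255 * s + s ^ 2 / 4) * Y +
      (μ - 0.1547 - 0.577 * s + (1 - μ) ^ 2 * √3 / (8 * (s * c))) := by
  obtain ⟨e, e', -, he, -, he', h⟩ := R.card_le_of_plateau hs hI hXY hsc rfl
  have hE := two_endGains_le R.c_pos hs hμ he he'
  obtain ⟨hA, hB, hK⟩ := long_rows_coeffs R.c_pos hs R.sq_add_sq hsc rfl rfl
  rw [area_div_eq]
  have hA' := mul_le_mul_of_nonneg_right hA (R.X_nonneg hI)
  have hB' := mul_le_mul_of_nonneg_right hB (R.Y_nonneg hI)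
  generalize √3 * s / c = k at *
  have e1 : (s * X + c * Y) / √3 = (s * X + c * Y) * (1 / √3) := by ring
  have e2 : 2 * (s * X) / √3 = 2 * (s * X) * (1 / √3) := by ring
  have e4 : μ * X / (2 * c) = μ / (2 * c) * X := by ring
  rw [e1, e2] at h
  rw [e4] at hE
  generalize 1 / √3 = q at *
  have e3 : (1 + k) / 2 * (1 + (s * X + c * Y) * q) +
      (1 - (1 + k) / 2) * (2 * (s * X) * q + 3) =
      2 - k + q * (1.5 * s - k * s / 2) * X + q * (c / 2 + k * c / 2) * Y := by ring
  rw [add_assoc, e3] at h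
  linarith only [h, hE, hA', hB', hK]

end tilted

section tilted

variable {I : Finset (ℤ × ℤ)} {c s x y X Y : ℝ}

/-- The number v bounds 1 / (s c), and 0.21651 is √3 / 8 rounded up. -/
theorem sqrt_three_div_le_of_bound {k v : ℝ} (hk : 0 ≤ k) (hw : 0 < s * c) (hv : 0 < v)
    (h : 1 / v ≤ s * c) : k * √3 / (8 * (s * c)) ≤ 0.21651 * k * v := by
  obtain ⟨-, h3'⟩ := sqrt_three_bounds
  rw [div_le_iff₀ (by positivity)]
  rw [div_le_iff₀ hv] at h
  have h1 : k * √3 ≤ k * 1.7320509 := mul_le_mul_of_nonneg_left h3'.le hk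
  have h2 : k ≤ k * (s * c * v) := le_mul_of_one_le_right hk h
  linarith

/-- On [l, r] all terms are monotone: the coefficients of the sides are least at r, while s and s c,
on which the constant depends, are least at l. -/
theorem RowsIn.area_le_of_mem_interval
    (R : RowsIn I c s (c - √3 * s) (s + √3 * c) x y X Y √3) (hs : 0 < s) (hI : 49 ≤ I.card)
    (hXY : s * X ≤ c * Y) (hsc : √3 * s ≤ c) {l r v a b α : ℝ} (hl : 0 ≤ l) (hls : l ≤ s)
    (hsr : s ≤ r) (hr : r ≤ 0.5) (hv : 0 < v) (hlv : (1 / v) ^ 2 ≤ l ^ 2 * (1 - l ^ 2))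
    (ha0 : 0 ≤ a) (hb0 : 0 ≤ b)
    (ha : a ≤ 0.57735 * (1 - 1.5 * r + 0.866 * r ^ 2))
    (hb : b ≤ 0.57735 * (0.5 - 0.8660255 * r + r ^ 2 / 4))
    (hα : 0.3665 ≤ α) (hαab : α ^ 2 ≤ 4 * a * b)
    (hκ : -0.1547 - 0.577 * l + 0.21651 * v + 2 * a + 2 * b < 7 * (1.8612 * α - 0.682))
    (hκ' : -0.1547 - 0.577 * l + 0.21651 * v + 2 * a + 2 * b < 49) :
    2 * √3 * (I.card + 0.682 * √I.card) ≤ (X + 2) * (Y + 2) := by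
  have hne : I.Nonempty := by
    rw [← Finset.card_pos]
    omega
  have hX := R.X_nonneg hne
  have hY := R.Y_nonneg hne
  have hcs := R.sq_add_sq
  have hw : 0 < s * c := mul_pos hs R.c_pos
  have h1 := R.card_le_of_long hs hne hXY hsc (μ := 0) le_rfl
  have h2 : 1 / v ≤ s * c := by
    refine le_of_sq_le_sq (hlv.trans ?_) hw.le
    have h3 : l ^ 2 ≤ s ^ 2 := pow_le_pow_left₀ hl hls 2
    have h4 : s ^ 2 ≤ 0.5 ^ 2 := pow_le_pow_left₀ hs.le (hsr.trans hr) 2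
    have h5 : (s * c) ^ 2 = s ^ 2 * (1 - s ^ 2) := by linear_combination s ^ 2 * hcs
    have h6 := mul_nonneg (sub_nonneg.2 h3) (show 0 ≤ 1 - s ^ 2 - l ^ 2 by linarith)
    rw [h5]
    linarith
  have h3 := sqrt_three_div_le_of_bound (k := 1) zero_le_one hw hv h2
  have hrs := mul_nonneg (sub_nonneg.2 hsr) (show 0 ≤ 1 - r - s by linarith)
  have h4 : a ≤ 0.57735 * (1 - 1.5 * s + 0.866 * s ^ 2) := by linarith
  have h5 : b ≤ 0.57735 * (0.5 - 0.8660255 * s + s ^ 2 / 4) := by linarith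
  have h6 := mul_le_mul_of_nonneg_right h4 hX
  have h7 := mul_le_mul_of_nonneg_right h5 hY
  have e1 : ((1 : ℝ) - 0) ^ 2 = 1 := by norm_num
  rw [e1, zero_div, sub_zero] at h1
  exact area_le_of_linear_loss hI hX hY (κ := -0.1547 - 0.577 * l + 0.21651 * v)
    (by linarith only [h1, h3, h6, h7, hls]) ha0 hb0 hα hαab hκ hκ'

/-- On each interval v is 1 / (l √(1 - l ^ 2)) rounded up, a and b are the coefficients at r rounded
down, and α is slightly below 2 √(a b). The last endpoint exceeds sin 15°. -/
theorem RowsIn.area_le_of_long_of_tilt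
    (R : RowsIn I c s (c - √3 * s) (s + √3 * c) x y X Y √3) (hI : 49 ≤ I.card)
    (hXY : s * X ≤ c * Y) (hsc : √3 * s ≤ c) (h1 : 0.0745 ≤ s) (h2 : s ≤ 0.25882) :
    2 * √3 * (I.card + 0.682 * √I.card) ≤ (X + 2) * (Y + 2) := by
  have hs : 0 < s := by linarith
  rcases le_total s 0.085 with h3 | h3
  · exact R.area_le_of_mem_interval hs hI hXY hsc (l := 0.0745) (r := 0.085) (v := 13.461)
      (a := 0.50735) (b := 0.2472) (α := 0.7082) (by norm_num) h1 h3 (by norm_num) (by norm_num)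
      (by norm_num) (by norm_num) (by norm_num) (by norm_num) (by norm_num) (by norm_num)
      (by norm_num) (by norm_num) (by norm_num)
  rcases le_total s 0.12 with h4 | h4
  · exact R.area_le_of_mem_interval hs hI hXY hsc (l := 0.085) (r := 0.12) (v := 11.808)
      (a := 0.48062) (b := 0.23075) (α := 0.666) (by norm_num) h3 h4 (by norm_num) (by norm_num)
      (by norm_num) (by norm_num) (by norm_num) (by norm_num) (by norm_num) (by norm_num)
      (by norm_num) (by norm_num) (by norm_num)
  rcases le_total s 0.18 with h5 | h5
  · exact R.area_le_of_mem_interval hs hI hXY hsc (l := 0.12) (r := 0.18) (v := 8.395)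
      (a := 0.43766) (b := 0.20335) (α := 0.5966) (by norm_num) h4 h5 (by norm_num) (by norm_num)
      (by norm_num) (by norm_num) (by norm_num) (by norm_num) (by norm_num) (by norm_num)
      (by norm_num) (by norm_num) (by norm_num)
  rcases le_total s 0.22 with h6 | h6
  · exact R.area_le_of_mem_interval hs hI hXY hsc (l := 0.18) (r := 0.22) (v := 5.648)
      (a := 0.411) (b := 0.18565) (α := 0.5524) (by norm_num) h5 h6 (by norm_num) (by norm_num)
      (by norm_num) (by norm_num) (by norm_num) (by norm_num) (by norm_num) (by norm_num)
      (by norm_num) (by norm_num) (by norm_num)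
  · exact R.area_le_of_mem_interval hs hI hXY hsc (l := 0.22) (r := 0.25882) (v := 4.66)
      (a := 0.38669) (b := 0.16892) (α := 0.511) (by norm_num) h6 h2 (by norm_num) (by norm_num)
      (by norm_num) (by norm_num) (by norm_num) (by norm_num) (by norm_num) (by norm_num)
      (by norm_num) (by norm_num) (by norm_num)

theorem cos_lower_bound (hc : 0 < c) (hs : 0 < s) (hcs : c ^ 2 + s ^ 2 = 1) {r d : ℝ} (hsr : s ≤ r)
    (hd : d ^ 2 ≤ 1 - r ^ 2) : d ≤ c := by
  have : s ^ 2 ≤ r ^ 2 := pow_le_pow_left₀ hs.le hsr 2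
  exact le_of_sq_le_sq (by linarith) hc.le

/-- For small tilts the term √3 / (8 s c) is unbounded, but s X ≥ √3 makes it at most about X / 8,
which the coefficient of X absorbs. -/
theorem RowsIn.area_le_of_long_of_horizontal
    (R : RowsIn I c s (c - √3 * s) (s + √3 * c) x y X Y √3) (hs : 0 < s) (hI : 49 ≤ I.card)
    (hXY : s * X ≤ c * Y) (hsc : √3 * s ≤ c) (h2 : s ≤ 0.0745) (h : √3 ≤ s * X) :
    2 * √3 * (I.card + 0.682 * √I.card) ≤ (X + 2) * (Y + 2) := by
  have hne : I.Nonempty := by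
    rw [← Finset.card_pos]
    omega
  have hX := R.X_nonneg hne
  have hY := R.Y_nonneg hne
  have hc := R.c_pos
  have h1 := R.card_le_of_long hs hne hXY hsc (μ := 0) le_rfl
  have h3 : (0.997 : ℝ) ≤ c := cos_lower_bound hc hs R.sq_add_sq h2 (by norm_num)
  have h4 : √3 / (8 * (s * c)) ≤ 0.1254 * X := by
    rw [div_le_iff₀ (by positivity)]
    have : 0.997 * √3 ≤ c * (s * X) :=
      mul_le_mul h3 h (Real.sqrt_nonneg 3) hc.le
    linarith [sqrt_three_bounds.1]
  have h5 : (0.5151 : ℝ) ≤ 0.57735 * (1 - 1.5 * s + 0.866 * s ^ 2) := by nlinarith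
  have h6 : (0.2514 : ℝ) ≤ 0.57735 * (0.5 - 0.8660255 * s + s ^ 2 / 4) := by nlinarith
  have h7 := mul_le_mul_of_nonneg_right h5 hX
  have h8 := mul_le_mul_of_nonneg_right h6 hY
  have e1 : ((1 : ℝ) - 0) ^ 2 = 1 := by norm_num
  rw [e1, one_mul, zero_div, sub_zero] at h1
  exact area_le_of_linear_loss hI hX hY (a := 0.3897) (b := 0.2514) (α := 0.626) (κ := 0)
    (by linarith only [h1, h4, h7, h8, hs]) (by norm_num) (by norm_num) (by norm_num)
    (by norm_num) (by norm_num) (by norm_num)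

/-- With μ = 0 the term √3 / (8 s c) would cost about 0.217 Y of the available 0.252 Y. The choice μ
= 0.4 reduces it by the factor 0.36 at the expense of about 0.2 X, which keeps the product a b
large. -/
theorem RowsIn.area_le_of_long_of_vertical
    (R : RowsIn I c s (c - √3 * s) (s + √3 * c) x y X Y √3) (hs : 0 < s) (hI : 49 ≤ I.card)
    (hXY : s * X ≤ c * Y) (hsc : √3 * s ≤ c) (h2 : s ≤ 0.0745) (h : 1 ≤ s * Y) :
    2 * √3 * (I.card + 0.682 * √I.card) ≤ (X + 2) * (Y + 2) := by
  have hne : I.Nonempty := by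
    rw [← Finset.card_pos]
    omega
  have hX := R.X_nonneg hne
  have hY := R.Y_nonneg hne
  have hc := R.c_pos
  have h1 := R.card_le_of_long hs hne hXY hsc (μ := 0.4) (by norm_num)
  have h3 : (0.9972 : ℝ) ≤ c := cos_lower_bound hc hs R.sq_add_sq h2 (by norm_num)
  have e1 : ((1 : ℝ) - 0.4) ^ 2 = 0.36 := by norm_num
  rw [e1] at h1
  have h4 : 0.36 * √3 / (8 * (s * c)) ≤ 0.07817 * Y := by
    rw [div_le_iff₀ (by positivity)]
    have : 0.9972 * 1 ≤ c * (s * Y) := mul_le_mul h3 h zero_le_one hc.le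
    linarith [sqrt_three_bounds.2]
  have h9 : 0.4 / (2 * c) ≤ 0.20057 := by
    rw [div_le_iff₀ (by positivity)]
    linarith
  have h5 : (0.51559 : ℝ) ≤ 0.57735 * (1 - 1.5 * s + 0.866 * s ^ 2) := by nlinarith
  have h6 : (0.25222 : ℝ) ≤ 0.57735 * (0.5 - 0.8660255 * s + s ^ 2 / 4) := by nlinarith
  have h7 := mul_le_mul_of_nonneg_right (sub_le_sub h5 h9) hX
  have h8 := mul_le_mul_of_nonneg_right h6 hY
  exact area_le_of_linear_loss hI hX hY (a := 0.31502) (b := 0.17405) (α := 0.4683) (κ := 0.2453)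
    (by linarith only [h1, h4, h7, h8, hs]) (by norm_num) (by norm_num) (by norm_num)
    (by norm_num) (by norm_num) (by norm_num)

/-- Such a rectangle is flat, with X ≥ 3.73 Y. Either alternative then bounds 1 / s by a multiple of
X, and the interleaving of rows is not needed. -/
theorem RowsIn.area_le_of_short
    (R : RowsIn I c s (c - √3 * s) (s + √3 * c) x y X Y √3) (hs : 0 < s) (hI : 49 ≤ I.card)
    (hXY : c * Y ≤ s * X) (h2 : s ≤ 0.25882) (h : √3 ≤ s * X ∨ 1 ≤ s * Y) :
    2 * √3 * (I.card + 0.682 * √I.card) ≤ (X + 2) * (Y + 2) := by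
  have hne : I.Nonempty := by
    rw [← Finset.card_pos]
    omega
  have hX := R.X_nonneg hne
  have hY := R.Y_nonneg hne
  have hc := R.c_pos
  have hcs := R.sq_add_sq
  have hc1 : c ≤ 1 := by nlinarith
  obtain ⟨e, e', -, he, -, he', h1⟩ := R.card_le hs hne
  have hE := two_endGains_le hc hs le_rfl (he.trans (min_le_left _ _)) (he'.trans (min_le_left _ _))
  have h3 : (0.9659 : ℝ) ≤ c := cos_lower_bound hc hs hcs h2 (by norm_num)
  obtain ⟨h4, h4'⟩ := inv_sqrt_three_bounds
  have hYX : 3.73 * Y ≤ X := by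
    have h5 : 0.9659 * Y ≤ 0.25882 * X := (mul_le_mul_of_nonneg_right h3 hY).trans
      (hXY.trans (mul_le_mul_of_nonneg_right h2 hX))
    linarith
  have h6 : √3 / (8 * (s * c)) ≤ 0.13 * X := by
    rw [div_le_iff₀ (by positivity)]
    rcases h with h | h
    · have : 0.9659 * √3 ≤ c * (s * X) := mul_le_mul h3 h (Real.sqrt_nonneg 3) hc.le
      linarith [sqrt_three_bounds.1]
    · have h7 : 1 ≤ s * (0.2682 * X) := h.trans (mul_le_mul_of_nonneg_left (by linarith) hs.le)
      have : 0.9659 * 1 ≤ c * (s * (0.2682 * X)) := mul_le_mul h3 h7 zero_le_one hc.le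
      linarith [sqrt_three_bounds.2]
  have e1 : ((1 : ℝ) - 0) ^ 2 = 1 := by norm_num
  rw [e1, one_mul, zero_mul, zero_div] at hE
  set q := 1 / √3 with hq
  have e2 : (s * X + c * Y) / √3 = s * X * q + c * Y * q := by
    rw [hq]
    ring
  rw [e2] at h1
  have hq0 : 0 ≤ q := by linarith
  have h7 : s * X * q ≤ 0.25882 * X * q := by gcongr
  have h8 : c * Y * q ≤ Y * q := 
    mul_le_mul_of_nonneg_right (mul_le_of_le_one_left hY hc1) hq0
  have h9 : s * c * q ≤ 0.25882 * q := 
    mul_le_mul_of_nonneg_right ((mul_le_of_le_one_right hs.le hc1).trans h2) hq0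
  have h10 : 0.57735 * X ≤ q * X := mul_le_mul_of_nonneg_right h4.le hX
  refine area_le_of_linear_loss hI hX hY (a := 0.15) (b := 0.5) (α := 0.547) (κ := 0)
    ?_ (by norm_num) (by norm_num) (by norm_num) (by norm_num) (by norm_num) (by norm_num)
  rw [area_div_eq, ← hq]
  clear_value q
  linarith only [h1, hE, h6, h7, h8, h9, h10, h4, hYX, hX, hY]

theorem RowsIn.area_le_of_tilted
    (R : RowsIn I c s (c - √3 * s) (s + √3 * c) x y X Y √3) (hs : 0 < s) (hI : 49 ≤ I.card)
    (hsc : s ≤ (2 - √3) * c) (h : √3 ≤ s * X ∨ 1 ≤ s * Y) :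
    2 * √3 * (I.card + 0.682 * √I.card) ≤ (X + 2) * (Y + 2) := by
  obtain ⟨h3, h3'⟩ := sqrt_three_bounds
  have hr := sqrt_three_sq
  have hc := R.c_pos
  have hcs := R.sq_add_sq
  have h1 : s ≤ 0.2679492 * c := hsc.trans (mul_le_mul_of_nonneg_right (by linarith) hc.le)
  have h2 : s ≤ 0.25882 := by
    have h4 : s ^ 2 ≤ (0.2679492 * c) ^ 2 := pow_le_pow_left₀ hs.le h1 2
    refine le_of_sq_le_sq ?_ (by norm_num)
    rw [mul_pow] at h4
    norm_num at h4 ⊢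
    linarith
  have h4 : √3 * s ≤ c := by
    have : √3 * s ≤ √3 * (0.2679492 * c) := mul_le_mul_of_nonneg_left h1 (Real.sqrt_nonneg 3)
    nlinarith
  rcases le_total (s * X) (c * Y) with hXY | hXY
  · rcases le_total s 0.0745 with h5 | h5
    · rcases h with h | h
      · exact R.area_le_of_long_of_horizontal hs hI hXY h4 h5 h
      · exact R.area_le_of_long_of_vertical hs hI hXY h4 h5 h
    · exact R.area_le_of_long_of_tilt hI hXY h4 h5 h2
  · exact R.area_le_of_short hs hI hXY h2 h

end tilted

/-! ### Conclusion for carved packings -/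

theorem HexFits.entryArea_le {n : ℕ} {X Y c s : ℝ} (h : HexFits n X Y c s)
    (hcs : c ^ 2 + s ^ 2 = 1) (h1 : 49 ≤ n) (h2 : n ≤ 5001) :
    entryArea (entry n) ≤ (X + 2) * (Y + 2) := by
  obtain ⟨c, s, X', Y', hXY, hcs, hc, hs, hsc, h⟩ := h.reduce hcs
  suffices entryArea (entry n) ≤ (X' + 2) * (Y' + 2) by
    rcases hXY with ⟨rfl, rfl⟩ | ⟨rfl, rfl⟩ <;> linarith
  rcases hs.eq_or_lt with rfl | hs
  · obtain rfl : c = 1 := by nlinarith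
    exact h.entryArea_le_of_aligned (by omega) h2
  · obtain ⟨I, x, y, rfl, R, hal⟩ := h.exists_rowsIn hc hs.le hcs
    exact (entryArea_le_sqrt (by omega) (by omega)).trans
      (R.area_le_of_tilted hs h1 hsc (R.sides_of_aligned hs hal))

theorem not_isOptimal_of_carved {n : ℕ} (hn : n ∈ irregularValues 5000) {W H : ℝ}
    {C : Finset Plane} (hC : C.card = n) (hcar : CarvedFrom squareGrid C ∨ CarvedFrom hexGrid C) :
    ¬ IsOptimal W H C := by
  intro hopt
  obtain ⟨W', H', C', hC', hpack, hlt⟩ := exists_smaller_of_irregular hn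
  obtain ⟨h49, h5000, -⟩ := irregular_spec hn
  have h1 := hopt.2 W' H' C' (by rw [hC', hC]) hpack
  have h2 : entryArea (entry n) ≤ (W - 2 + 2) * (H - 2 + 2) := by
    rcases hcar with h | h
    · obtain ⟨c, s, hcs, hfit⟩ := CarvedFrom.squareFits hopt.1 h
      rw [hC] at hfit
      exact entryArea_le_of_four_mul_le h49 (by omega) (hfit.card_le hcs (by omega))
    · obtain ⟨c, s, hcs, hfit⟩ := CarvedFrom.hexFits hopt (by omega) h
      rw [hC] at hfit
      exact hfit.entryArea_le hcs h49 (by omega)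
  rw [sub_add_cancel, sub_add_cancel] at h2
  linarith

end CirclePacking

end

open CirclePacking in
theorem mainTheorem1 :
    (irregularValues 5000).ncard = 1495 ∧
    {n ∈ irregularValues 5000 | n ≤ 107} = {49, 61, 79, 97, 107} ∧
    IsGreatest (irregularValues 5000) 4999 ∧
    ∀ n ∈ irregularValues 5000,
      (∀ (W H : ℝ) (C : Finset Plane), C.card = n → IsPackingIn W H C →
        CarvedFrom squareGrid C ∨ CarvedFrom hexGrid C → ¬ IsOptimal W H C) ∧
      ∀ P : SearchPacking, P.n = n → ¬ IsOptimal P.width P.height P.centers := by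
  refine ⟨irregularValues_ncard, irregularValues_small, irregularValues_greatest,
    fun n hn => ⟨fun W H C hC _ hcar => not_isOptimal_of_carved hn hC hcar,
      fun P hP hopt => ?_⟩⟩
  obtain ⟨W, H, C, hC, hpack, hlt⟩ := exists_smaller_of_irregular hn
  obtain ⟨h49, h5000, -⟩ := irregular_spec hn
  have h1 := hopt.2 W H C (by rw [hC, P.centers_card, hP]) hpack
  have h2 := P.entryArea_le_area (m := n) (by omega) (by omega) (by omega)
  unfold SearchPacking.area at h2
  linarith
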